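/- Let $S$ be a locally compact, separable metric space with Borel $\sigma$-algebra $\mathcal B(S)$, let $\nu_0$ be a diffuse probability measure on $S$ (that is, $\nu_0(\{x\})=0$ for all $x\in S$), and let $\theta>-1/2$, $\alpha=1/2$. **The two-parameter Dirichlet process.** Let $U_1,U_2,\dots$ be independent with $U_i\sim \mathrm{Beta}(1-\alpha,\theta+i\alpha)$, put $V_i=U_i\prod_{j<i}(1-U_j)$, let $P_1\ge P_2\ge\cdots$ be the sequence $(V_i)$ in descending order, and let $\xi_1,\xi_2,\dots$ be i.i.d. with law $\nu_0$, independent of $(U_i)$. Let $\Pi=\Pi_{\alpha,\theta,\nu_0}$ be the law of $\sum_k P_k\delta_{\xi_k}$ on the space $\mathcal P_1(S)$ of probability measures on $S$. **The bilinear form.** Let $\mathcal F$ be the set of functions $F(\mu)=f(\langle\phi_1,\mu\rangle,\dots,\langle\phi_d,\mu\rangle)$ on $\mathcal P_1(S)$ with $d\ge1$, $f\in C^\infty(\mathbb R^d)$ and $\phi_1,\dots,\phi_d$ bounded Borel functions on $S$. For such $F$ write $\nabla_xF(\mu)=\sum_i\partial_if(\langle\phi_1,\mu\rangle,\dots,\langle\phi_d,\mu\rangle)\,\phi_i(x)$,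 and for bounded Borel $g,h$ write $\langle g,h\rangle_\mu=\int gh\,d\mu-\int g\,d\mu\int h\,d\mu$. Put $$\mathcal E(F,G)=\tfrac12\int_{\mathcal P_1(S)}\langle\nabla F(\mu),\nabla G(\mu)\rangle_\mu\,\Pi(d\mu),\qquad F,G\in\mathcal F.$$ The relaxation $(\Xi,D(\Xi))$ of $(\mathcal E,\mathcal F)$ on $L^2(\Pi)$ is the greatest closed (lower semicontinuous) nonnegative symmetric bilinear form which is a minorant of $(\mathcal E,\mathcal F)$, i.e. with $\mathcal F\subset D(\Xi)$ and $\Xi(F,F)\le\mathcal E(F,F)$ for $F\in\mathcal F$. **The projection forms.** Fix Borel partitions $(B^k_1,\dots,B^k_{2^k})$ of $S$, $k\ge 0$, with $\nu_0(B^k_j)=2^{-k}$ and $B^k_j=B^{k+1}_{2j-1}\cup B^{k+1}_{2j}$, which generate $\mathcal B(S)$ up to $\nu_0$-null sets: every $A\in\mathcal B(S)$ differs by a $\nu_0$-null set from a set in $\sigma(B^k_j:k,j)$. Let $$\mathcal F_k=\{F(\mu)=f(\mu(B^k_1),\dots,\mu(B^k_{2^k-1})):f\in C^\infty(\mathbb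 R^{2^k-1})\},$$ and let $(\mathcal E,D(\mathcal E)_k)$ be the closure of $(\mathcal E,\mathcal F_k)$ on $L^2(\Pi)$. **Semigroups.** The semigroup associated with a closed form $(Q,D(Q))$ on $L^2(\Pi)$, not necessarily densely defined, is the strongly continuous contraction semigroup on the closure $\overline{D(Q)}$ whose generator $L$ is given by: $u\in D(L)$ and $Lu=w$ if and only if $u\in D(Q)$, $w\in \overline{D(Q)}$ and $Q(u,v)=-(w,v)_{L^2(\Pi)}$ for all $v\in D(Q)$; it is extended to $L^2(\Pi)$ by composing it with the orthogonal projection onto $\overline{D(Q)}$. **Theorem.** For each $k$ the closure $(\mathcal E,D(\mathcal E)_k)$ and its semigroup $(T^k_t)_{t\ge0}$ exist; the relaxation $(\Xi,D(\Xi))$ exists, is densely defined, and has an associated semigroup $(T_t)_{t\ge0}$; and for every $t\ge0$ the operators $T^k_t$ converge to $T_t$ in the strong operator topology as $k\to\infty$: $$\lim_{k\to\infty}\|T^k_tF-T_tF\|_{L^2(\Pi)}=0\qquad\text{for all }F\in L^2(\Pi).$$ -/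

import Mathlib

open MeasureTheory ProbabilityTheory Filter Topology
open scoped NNReal ENNReal ContDiff

namespace TwoParam

noncomputable section

/-! ### The two-parameter Dirichlet process -/

/-- Stick breaking: `V i = U i * ∏_{j < i} (1 - U j)`. -/
def stick (U : ℕ → ℝ) (i : ℕ) : ℝ :=
  U i * ∏ j ∈ Finset.range i, (1 - U j)

/-- The `(k+1)`-st largest entry (counted with multiplicity) of a sequence `v`, as the supremum
over all `(k+1)`-element index sets of the smallest entry with an index in the set.
For a summable sequence of nonnegative numbers, `ranked v` is `v` in descending order. -/
def ranked (v : ℕ → ℝ) (k : ℕ) : ℝ :=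
  ⨆ s : {s : Finset ℕ // s.card = k + 1},
    s.1.inf' (Finset.card_pos.1 (by rw [s.2]; exact Nat.succ_pos k)) v

/-- Joint law of the beta variables and of the types: all coordinates are independent, the
`i`-th beta variable (`i = 0, 1, …`) has law `Beta(1 - α, θ + (i + 1) α)`, each type has law `ν₀`. -/
def inputLaw {S : Type*} [MeasurableSpace S] (α θ : ℝ) (ν₀ : Measure S) :
    Measure ((ℕ → ℝ) × (ℕ → S)) :=
  (Measure.infinitePi fun i : ℕ => betaMeasure (1 - α) (θ + ((i : ℝ) + 1) * α)).prod
    (Measure.infinitePi fun _ : ℕ => ν₀)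

/-- The measure `∑ₖ Pₖ δ_{ξₖ}`, where `P` is the descending rearrangement of the stick-breaking
sequence. -/
def atomicMeasure {S : Type*} [MeasurableSpace S] (z : (ℕ → ℝ) × (ℕ → S)) : Measure S :=
  Measure.sum fun k => ENNReal.ofReal (ranked (stick z.1) k) • Measure.dirac (z.2 k)

open Classical in
/-- The random probability measure `∑ₖ Pₖ δ_{ξₖ}`. On the null event where the weights do not sum
up to one it is given the arbitrary value `δ_{ξ₀}`. -/
def randomMeasure {S : Type*} [MeasurableSpace S] (z : (ℕ → ℝ) × (ℕ → S)) :
    ProbabilityMeasure S :=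
  if h : IsProbabilityMeasure (atomicMeasure z) then ⟨atomicMeasure z, h⟩
  else ⟨Measure.dirac (z.2 0), inferInstance⟩

/-- The two-parameter Dirichlet process `Π_{α,θ,ν₀}`, a law on the space of probability measures. -/
def dirichletProcess {S : Type*} [MeasurableSpace S] (α θ : ℝ) (ν₀ : Measure S) :
    Measure (ProbabilityMeasure S) :=
  (inputLaw α θ ν₀).map randomMeasure

theorem isFiniteMeasure_infinitePi {ι : Type*} {X : ι → Type*} [∀ i, MeasurableSpace (X i)]
    (m : ∀ i, Measure (X i)) : IsFiniteMeasure (Measure.infinitePi m) := by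
  by_cases h : ∀ i, IsProbabilityMeasure (m i)
  · infer_instance
  · rw [Measure.infinitePi, dif_neg h]
    infer_instance

instance {S : Type*} [MeasurableSpace S] (α θ : ℝ) (ν₀ : Measure S) :
    IsFiniteMeasure (dirichletProcess α θ ν₀) := by
  have h1 := isFiniteMeasure_infinitePi
    fun i : ℕ => betaMeasure (1 - α) (θ + ((i : ℝ) + 1) * α)
  have h2 := isFiniteMeasure_infinitePi fun _ : ℕ => ν₀
  unfold dirichletProcess inputLaw
  infer_instance

/-! ### Cylinder functions and the bilinear form -/

/-- The data of a cylinder function `F(μ) = f(⟨φ₁, μ⟩, …, ⟨φ_d, μ⟩)` with `φᵢ` bounded and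
measurable and `f` smooth. (For `d = 0` these are the constants, which are also obtained
with `d = 1`.) -/
structure Cyl (S : Type*) [MeasurableSpace S] where
  d : ℕ
  φ : Fin d → S → ℝ
  measurable_φ : ∀ i, Measurable (φ i)
  bounded_φ : ∀ i, ∃ C, ∀ x, |φ i x| ≤ C
  f : (Fin d → ℝ) → ℝ
  smooth_f : ContDiff ℝ ∞ f

namespace Cyl

variable {S : Type*} [MeasurableSpace S]

/-- The vector `(⟨φ₁, μ⟩, …, ⟨φ_d, μ⟩)`. -/
def coords (F : Cyl S) (μ : ProbabilityMeasure S) : Fin F.d → ℝ :=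
  fun i => ∫ x, F.φ i x ∂(μ : Measure S)

/-- The value `F(μ)`. -/
def eval (F : Cyl S) (μ : ProbabilityMeasure S) : ℝ := F.f (F.coords μ)

/-- `∇ₓF(μ) = ∑ᵢ ∂ᵢf(⟨φ₁, μ⟩, …, ⟨φ_d, μ⟩) φᵢ(x)`. -/
def grad (F : Cyl S) (μ : ProbabilityMeasure S) (x : S) : ℝ :=
  ∑ i, fderiv ℝ F.f (F.coords μ) (Pi.single i 1) * F.φ i x

theorem measurable_coords (F : Cyl S) : Measurable F.coords := by
  refine measurable_pi_iff.2 fun i => ?_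
  let κ : Kernel (ProbabilityMeasure S) S := ⟨fun μ => (μ : Measure S), measurable_subtype_coe⟩
  have : IsMarkovKernel κ := ⟨fun μ => μ.2⟩
  exact ((F.measurable_φ i).stronglyMeasurable.integral_kernel (κ := κ)).measurable

theorem memLp_eval (F : Cyl S) (P : Measure (ProbabilityMeasure S)) [IsFiniteMeasure P] :
    MemLp F.eval 2 P := by
  choose C hC using F.bounded_φ
  have hK : IsCompact (Set.univ.pi fun i => Set.Icc (-(C i)) (C i)) :=
    isCompact_univ_pi fun i => isCompact_Icc
  obtain ⟨M, hM⟩ := hK.exists_bound_of_continuousOn F.smooth_f.continuous.continuousOn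
  refine MemLp.of_bound
    (F.smooth_f.continuous.measurable.comp F.measurable_coords).aestronglyMeasurable M
    (Eventually.of_forall fun μ => hM _ fun i _ => ?_)
  have h := norm_integral_le_of_norm_le_const (μ := (μ : Measure S)) (f := F.φ i) (C := C i)
    (Eventually.of_forall fun x => hC i x)
  have h' : |F.coords μ i| ≤ C i := by simpa [coords] using h
  exact abs_le.1 h'

/-- The class of `F` in `L²(P)`. -/
def toL2 (P : Measure (ProbabilityMeasure S)) [IsFiniteMeasure P] (F : Cyl S) : Lp ℝ 2 P :=
  (F.memLp_eval P).toLp F.eval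

end Cyl

/-- `⟨g, h⟩_μ = ∫ g h dμ - (∫ g dμ) (∫ h dμ)`. -/
def cov {S : Type*} [MeasurableSpace S] (μ : ProbabilityMeasure S) (g h : S → ℝ) : ℝ :=
  (∫ x, g x * h x ∂(μ : Measure S)) -
    (∫ x, g x ∂(μ : Measure S)) * ∫ x, h x ∂(μ : Measure S)

/-- `𝓔(F, G) = ½ ∫ ⟨∇F(μ), ∇G(μ)⟩_μ P(dμ)`. -/
def energy {S : Type*} [MeasurableSpace S] (P : Measure (ProbabilityMeasure S))
    (F G : Cyl S) : ℝ :=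
  (1 / 2) * ∫ μ, cov μ (F.grad μ) (G.grad μ) ∂P

/-! ### Dyadic partitions and projection classes -/

/-- A sequence of partitions `(B k 0, …, B k (2^k - 1))` of `S` into measurable sets of
`ν₀`-measure `2^{-k}`, each set being the union of two consecutive sets of the next partition.
(Level `k = 0` is the trivial partition `{S}`.) -/
structure DyadicPartition {S : Type*} [MeasurableSpace S] (ν₀ : Measure S) where
  B : (k : ℕ) → Fin (2 ^ k) → Set S
  measurableSet_B : ∀ k j, MeasurableSet (B k j)
  disjoint_B : ∀ k i j, i ≠ j → Disjoint (B k i) (B k j)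
  cover : ∀ k, ⋃ j, B k j = Set.univ
  measure_B : ∀ k j, ν₀ (B k j) = (2⁻¹ : ℝ≥0∞) ^ k
  refine_B : ∀ (k : ℕ) (j : Fin (2 ^ k)),
    B k j = B (k + 1) ⟨2 * (j : ℕ), by have := j.2; rw [pow_succ]; omega⟩ ∪
      B (k + 1) ⟨2 * (j : ℕ) + 1, by have := j.2; rw [pow_succ]; omega⟩

namespace DyadicPartition

variable {S : Type*} [MeasurableSpace S] {ν₀ : Measure S}

/-- The sets `B k j` generate the measurable sets up to `ν₀`-null sets. -/
def Generating (D : DyadicPartition ν₀) : Prop :=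
  ∀ A : Set S, MeasurableSet A →
    ∃ A' : Set S,
      MeasurableSet[MeasurableSpace.generateFrom {C | ∃ k j, C = D.B k j}] A' ∧ A =ᵐ[ν₀] A'

/-- The cylinder function `μ ↦ f(μ(B k 0), …, μ(B k (2^k - 2)))`. -/
def cyl (D : DyadicPartition ν₀) (k : ℕ) (f : (Fin (2 ^ k - 1) → ℝ) → ℝ) (hf : ContDiff ℝ ∞ f) :
    Cyl S where
  d := 2 ^ k - 1
  φ := fun i => (D.B k (Fin.castLE (Nat.sub_le _ _) i)).indicator fun _ => 1
  measurable_φ := fun i => measurable_const.indicator (D.measurableSet_B k _)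
  bounded_φ := fun i => ⟨1, fun x => by
    by_cases h : x ∈ D.B k (Fin.castLE (Nat.sub_le _ _) i) <;> simp [h]⟩
  f := f
  smooth_f := hf

/-- The class `𝓕ₖ`. -/
def cylSet (D : DyadicPartition ν₀) (k : ℕ) : Set (Cyl S) :=
  {F | ∃ f hf, F = D.cyl k f hf}

end DyadicPartition

/-! ### Closed forms, closures, relaxations, semigroups -/

/-- A closed, symmetric, nonnegative bilinear form on a real Hilbert space; the domain is a linear
subspace, not necessarily dense. -/
structure ClosedForm (H : Type*) [NormedAddCommGroup H] [InnerProductSpace ℝ H] where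
  dom : Submodule ℝ H
  form : dom →ₗ[ℝ] dom →ₗ[ℝ] ℝ
  symm : ∀ u v, form u v = form v u
  nonneg : ∀ u, 0 ≤ form u u
  closed : ∀ u : ℕ → dom, CauchySeq (fun n => (u n : H)) →
    (∀ ε > 0, ∃ N, ∀ m ≥ N, ∀ n ≥ N, form (u m - u n) (u m - u n) < ε) →
    ∃ v : dom, Tendsto (fun n => (u n : H)) atTop (𝓝 (v : H)) ∧
      Tendsto (fun n => form (u n - v) (u n - v)) atTop (𝓝 0)

namespace ClosedForm

variable {H : Type*} [NormedAddCommGroup H] [InnerProductSpace ℝ H] {A : Type*}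

/-- `Q` is the closure of the form `e` given on the elements `ι a`, `a ∈ s`, of `H`: it is a closed
extension of that form, and every element of its domain is the limit, in the norm of `H` and
in the energy, of elements `ι a`, `a ∈ s`. -/
def IsClosureOf (Q : ClosedForm H) (ι : A → H) (e : A → A → ℝ) (s : Set A) : Prop :=
  (∃ h : ∀ a ∈ s, ι a ∈ Q.dom,
    ∀ (a : A) (ha : a ∈ s) (b : A) (hb : b ∈ s),
      Q.form ⟨ι a, h a ha⟩ ⟨ι b, h b hb⟩ = e a b) ∧
  ∀ u : Q.dom, ∃ (a : ℕ → A) (v : ℕ → Q.dom), (∀ n, a n ∈ s ∧ (v n : H) = ι (a n)) ∧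
    Tendsto (fun n => (v n : H)) atTop (𝓝 (u : H)) ∧
    Tendsto (fun n => Q.form (v n - u) (v n - u)) atTop (𝓝 0)

/-- `Q` is a minorant of the form `e` given on the elements `ι a`: its domain contains these
elements and `Q(ι a, ι a) ≤ e(a, a)`. -/
def IsMinorantOf (Q : ClosedForm H) (ι : A → H) (e : A → A → ℝ) : Prop :=
  ∀ a, ∃ h : ι a ∈ Q.dom, Q.form ⟨ι a, h⟩ ⟨ι a, h⟩ ≤ e a a

/-- `Q ≤ R` as quadratic forms with value `+∞` outside their domains. -/
def IsLE (Q R : ClosedForm H) : Prop :=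
  ∀ u : R.dom, ∃ h : (u : H) ∈ Q.dom, Q.form ⟨u, h⟩ ⟨u, h⟩ ≤ R.form u u

/-- `Q` is the relaxation of the form `e` given on the elements `ι a`: the greatest closed (that is,
lower semicontinuous) form which is a minorant. -/
def IsRelaxationOf (Q : ClosedForm H) (ι : A → H) (e : A → A → ℝ) : Prop :=
  Q.IsMinorantOf ι e ∧ ∀ R : ClosedForm H, R.IsMinorantOf ι e → R.IsLE Q

/-- `T` is the semigroup associated with `Q`: a contraction semigroup, strongly continuous on
`[0, ∞)`, with `T 0` the orthogonal projection onto the closure of the domain of `Q` (the identity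
if `Q` is densely defined), so that `T` is a strongly continuous contraction semigroup on this
closure and vanishes on its orthogonal complement. Its generator `L` is the operator of `Q`:
`u ∈ D(L)` and `L u = w` if and only if `u ∈ D(Q)`, `w` lies in the closure of `D(Q)`, and
`Q(u, v) = -(w, v)` for all `v ∈ D(Q)`. -/
structure IsSemigroup [CompleteSpace H] (Q : ClosedForm H) (T : ℝ≥0 → H →L[ℝ] H) : Prop where
  zero : T 0 = Q.dom.topologicalClosure.starProjection
  add : ∀ s t, T (s + t) = (T s).comp (T t)
  contraction : ∀ t u, ‖T t u‖ ≤ ‖u‖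
  continuous : ∀ u, Continuous fun t => T t u
  generator : ∀ u w : H,
    Tendsto (fun t : ℝ≥0 => (t : ℝ)⁻¹ • (T t u - u)) (𝓝[>] 0) (𝓝 w) ↔
      ∃ hu : u ∈ Q.dom, w ∈ Q.dom.topologicalClosure ∧
        ∀ v : Q.dom, Q.form ⟨u, hu⟩ v = -inner ℝ w (v : H)

end ClosedForm

end

end TwoParam

open TwoParam

/-! The energy is half the squared norm of a gradient. The derivative of `F` at `μ` in the direction
`δₓ - μ` (`Cyl.dir`) is the centred gradient, so the covariance under `μ` of two gradients is the
integral of a product of such derivatives. Under the law `pairLaw` of a pair `(μ, x)`, with `x`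
drawn from `μ`, this gives `𝓔(F, G) = ½ (dir F, dir G)` in `L²` (`Cyl.energy_eq`).

The main point is that this gradient is closable on all cylinder functions
(`ae_eq_zero_of_tendsto_dir`). Since the types are i.i.d. and independent of the sticks, the ranking
may be undone and `μ = ∑ Vᵢ δ_{ξᵢ}` may be used (`dirichletProcess_eq_map_stickMeasure`). Varying a
single stick `Uᵢ` moves `μ` along a segment, and `(1 - u) d/du` of `F` along it is a combination
`stickSum` of the values `dir F (μ, ξⱼ)`, `j ≤ i` (`exists_hasDeriv_stick`). A beta density is
continuous and positive on `(0, 1)`, so `d/du` is closable (`ae_eq_zero_of_approx_deriv`). If `Fₙ →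
0` and `dir Fₙ → w`, then resampling `Uᵢ` and Fatou's lemma give `stickSum i w = 0` for every `i`.
This system is triangular with positive diagonal, so `w` vanishes at every atom.

By closability the relaxation is just the closure of the energy on all cylinder functions
(`isRelaxationOf_ofGraph`), and the projection forms are its restrictions to smaller domains. These
domains exhaust the large one in energy: the mean measure of the process is `ν₀` (`snd_pairLaw`),
and martingale convergence replaces the inner functions by step functions on the dyadic partitions
(`exists_tendsto_cylSet`).

The resolvent of a restricted form is the energy-orthogonal projection of the full resolvent onto
the smaller domain, so resolvents converge strongly (`tendsto_resolvent`). For `t > 0` the semigroup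
is the continuous function `exp (-t (1/x - 1))` of the resolvent, with value `0` at `x = 0`, and
polynomial approximation carries strong convergence over to it (`tendsto_fc_apply`). At `t = 0` the
operators are projections onto closures of domains and are treated directly. Closures, relaxations
and semigroups are unique, so the result holds for any objects with the defining properties. -/

open MeasureTheory ProbabilityTheory Filter Topology
open scoped NNReal ENNReal ContDiff
open TwoParam

namespace TwoParam

noncomputable section

/-! ### Continuous functional calculus of a self-adjoint operator `0 ≤ G ≤ 1` on a real Hilbert space -/

section FunctionalCalculus

open Polynomial

variable {H : Type*} [NormedAddCommGroup H] [InnerProductSpace ℝ H]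

/-- `G` is symmetric with `0 ≤ G ≤ 1`. -/
structure PosContraction (G : H →L[ℝ] H) : Prop where
  symm : ∀ x y, inner ℝ (G x) y = inner ℝ x (G y)
  nonneg : ∀ x, 0 ≤ inner ℝ (G x) x
  le_one : ∀ x, inner ℝ (G x) x ≤ ‖x‖ ^ 2

theorem repr_aeval_eigenvectorBasis {W : Type*} [NormedAddCommGroup W] [InnerProductSpace ℝ W]
    [FiniteDimensional ℝ W] {A : W →ₗ[ℝ] W} (hA : A.IsSymmetric) {n : ℕ}
    (hn : Module.finrank ℝ W = n) (p : ℝ[X]) (v : W) (i : Fin n) :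
    (hA.eigenvectorBasis hn).repr (aeval A p v) i =
      p.eval (hA.eigenvalues hn i) * (hA.eigenvectorBasis hn).repr v i := by
  induction p using Polynomial.induction_on generalizing v with
  | C a => simp
  | add p q hp hq => simp [hp, hq, add_mul]
  | monomial m a ih =>
    have h1 : aeval A (C a * X ^ (m + 1) : ℝ[X]) v = aeval A (C a * X ^ m : ℝ[X]) (A v) := by
      simp [pow_succ]
    rw [h1, ih, hA.eigenvectorBasis_apply_self_apply]
    simp [pow_succ]
    ring

/-- In an orthonormal eigenbasis `p(A)` multiplies coordinates by values of `p` at eigenvalues,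
which lie in `[0, 1]`; Parseval's identity does the rest. -/
theorem norm_aeval_apply_le_of_finiteDimensional {W : Type*} [NormedAddCommGroup W]
    [InnerProductSpace ℝ W] [FiniteDimensional ℝ W] {A : W →ₗ[ℝ] W} (hA : A.IsSymmetric)
    (h0 : ∀ x, 0 ≤ inner ℝ (A x) x) (h1 : ∀ x, inner ℝ (A x) x ≤ ‖x‖ ^ 2) (p : ℝ[X]) {M : ℝ}
    (hM : ∀ x ∈ Set.Icc (0 : ℝ) 1, |p.eval x| ≤ M) (v : W) : ‖aeval A p v‖ ≤ M * ‖v‖ := by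
  have hM0 : 0 ≤ M := (abs_nonneg _).trans (hM 0 (by simp))
  set b := hA.eigenvectorBasis rfl
  have hev : ∀ i, hA.eigenvalues rfl i ∈ Set.Icc (0 : ℝ) 1 := by
    intro i
    have h2 : inner ℝ (A (b i)) (b i) = hA.eigenvalues rfl i := by
      rw [hA.apply_eigenvectorBasis rfl i]
      simp [inner_smul_left, b]
    have h3 := h0 (b i)
    have h4 := h1 (b i)
    rw [h2] at h3 h4
    simp at h4
    exact ⟨h3, h4⟩
  refine abs_le_of_sq_le_sq' ?_ (by positivity) |>.2
  rw [mul_pow, ← b.repr.norm_map, ← b.repr.norm_map v, EuclideanSpace.norm_sq_eq,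
    EuclideanSpace.norm_sq_eq, Finset.mul_sum]
  refine Finset.sum_le_sum fun i _ => ?_
  rw [repr_aeval_eigenvectorBasis, norm_mul, mul_pow]
  gcongr
  exact hM _ (hev i)

/-- Only the Krylov space spanned by `v, Gv, …, Gⁿv` with `n = deg p` matters for `p(G)v`.
Compressing `G` to it reduces the spectral bound to finite dimension. -/
theorem PosContraction.norm_aeval_apply_le {G : H →L[ℝ] H} (hG : PosContraction G) (p : ℝ[X])
    {M : ℝ} (hM : ∀ x ∈ Set.Icc (0 : ℝ) 1, |p.eval x| ≤ M) (v : H) :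
    ‖aeval G p v‖ ≤ M * ‖v‖ := by
  set n := p.natDegree
  let W : Submodule ℝ H := Submodule.span ℝ (Set.range fun j : Fin (n + 1) => (G ^ (j : ℕ)) v)
  have : FiniteDimensional ℝ W := FiniteDimensional.span_of_finite ℝ (Set.finite_range _)
  have hmem : ∀ j, j ≤ n → (G ^ j) v ∈ W := fun j hj =>
    Submodule.subset_span ⟨⟨j, Nat.lt_succ_of_le hj⟩, rfl⟩
  let A : W →ₗ[ℝ] W := (W.orthogonalProjectionOnto ∘L G ∘L W.subtypeL : W →L[ℝ] W)
  have hAi : ∀ x y : W, inner ℝ (A x) y = inner ℝ (G x) (y : H) := by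
    intro x y
    simp [A]
  have hA : A.IsSymmetric := by
    intro x y
    change inner ℝ (A x) y = inner ℝ x (A y)
    rw [hAi, hG.symm, real_inner_comm, ← hAi y x, real_inner_comm]
  let w : W := ⟨v, by simpa using hmem 0 (Nat.zero_le _)⟩
  -- Up to the degree of `p` the compression does not lose anything, since `G` maps the earlier
  -- powers of `v` into `W`.
  have hpow : ∀ j, j ≤ n → (((A ^ j) w : W) : H) = (G ^ j) v := by
    intro j
    induction j with
    | zero => intro _; simp [w]
    | succ j ih =>
      intro hj
      rw [pow_succ', pow_succ', Module.End.mul_apply, mul_apply_eq_comp,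
        ← ih (by omega)]
      have h1 : G ((A ^ j) w : W) ∈ W := by
        rw [ih (by omega), ← mul_apply_eq_comp, ← pow_succ']
        exact hmem _ hj
      exact Submodule.starProjection_eq_self_iff.2 h1
  have hp : ((aeval A p w : W) : H) = aeval G p v := by
    rw [aeval_eq_sum_range, aeval_eq_sum_range]
    simp only [LinearMap.sum_apply, LinearMap.smul_apply, sum_apply,
      smul_apply, Submodule.coe_sum, Submodule.coe_smul]
    refine Finset.sum_congr rfl fun j hj => ?_
    rw [hpow j (by simpa [Nat.lt_succ_iff] using hj)]
  have := norm_aeval_apply_le_of_finiteDimensional hA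
    (fun x => by rw [hAi]; exact hG.nonneg x) (fun x => by rw [hAi]; exact hG.le_one x) p hM w
  rw [← hp]
  exact this

theorem PosContraction.norm_aeval_le {G : H →L[ℝ] H} (hG : PosContraction G) (p : ℝ[X])
    {M : ℝ} (hM : ∀ x ∈ Set.Icc (0 : ℝ) 1, |p.eval x| ≤ M) : ‖aeval G p‖ ≤ M :=
  ContinuousLinearMap.opNorm_le_bound _ ((abs_nonneg _).trans (hM 0 (by simp)))
    (hG.norm_aeval_apply_le p hM)

/-- `T = φ(G)`: whenever polynomials approximate `φ` uniformly on `[0, 1]`, they approximate `T`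
when applied to `G`. -/
def IsFC (G : H →L[ℝ] H) (φ : ℝ → ℝ) (T : H →L[ℝ] H) : Prop :=
  ∀ ε > 0, ∃ p : ℝ[X], (∀ x ∈ Set.Icc (0 : ℝ) 1, |p.eval x - φ x| ≤ ε) ∧ ‖aeval G p - T‖ ≤ ε

theorem isFC_poly (G : H →L[ℝ] H) (p : ℝ[X]) : IsFC G (fun x => p.eval x) (aeval G p) :=
  fun ε hε => ⟨p, by simp [hε.le], by simp [hε.le]⟩

theorem isFC_id (G : H →L[ℝ] H) : IsFC G (fun x => x) G := by
  simpa using isFC_poly G X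

theorem IsFC.congr {G T : H →L[ℝ] H} {φ ψ : ℝ → ℝ} (h : IsFC G φ T)
    (hφ : ∀ x ∈ Set.Icc (0 : ℝ) 1, φ x = ψ x) : IsFC G ψ T := by
  intro ε hε
  obtain ⟨p, hp, hp'⟩ := h ε hε
  exact ⟨p, fun x hx => by rw [← hφ x hx]; exact hp x hx, hp'⟩

/-- The polynomial bound passes to the limit. This single estimate gives uniqueness, the sup-norm
bound and all later spectral estimates. -/
theorem IsFC.norm_sub_le {G : H →L[ℝ] H} (hG : PosContraction G) {φ ψ : ℝ → ℝ} {T S : H →L[ℝ] H}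
    (hT : IsFC G φ T) (hS : IsFC G ψ S) {M : ℝ}
    (hM : ∀ x ∈ Set.Icc (0 : ℝ) 1, |φ x - ψ x| ≤ M) : ‖T - S‖ ≤ M := by
  refine le_of_forall_pos_le_add fun ε hε => ?_
  obtain ⟨p, hp, hpT⟩ := hT (ε / 4) (by positivity)
  obtain ⟨q, hq, hqS⟩ := hS (ε / 4) (by positivity)
  have h1 : ‖aeval G (p - q)‖ ≤ M + ε / 2 := by
    refine hG.norm_aeval_le _ fun x hx => ?_
    have h1 := abs_le.1 (hp x hx)
    have h2 := abs_le.1 (hq x hx)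
    have h3 := abs_le.1 (hM x hx)
    rw [eval_sub, abs_le]
    constructor <;> linarith
  have h2 : T - S = aeval G (p - q) - (aeval G p - T) + (aeval G q - S) := by
    rw [map_sub]; abel
  calc ‖T - S‖ ≤ ‖aeval G (p - q)‖ + ‖aeval G p - T‖ + ‖aeval G q - S‖ := by
        rw [h2]
        exact (norm_add_le _ _).trans (by gcongr; exact _root_.norm_sub_le _ _)
    _ ≤ M + ε := by linarith

theorem IsFC.unique {G : H →L[ℝ] H} (hG : PosContraction G) {φ : ℝ → ℝ} {T S : H →L[ℝ] H}
    (hT : IsFC G φ T) (hS : IsFC G φ S) : T = S := by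
  have := hT.norm_sub_le hG hS (M := 0) (by simp)
  exact sub_eq_zero.1 (norm_le_zero_iff.1 this)

theorem IsFC.norm_le {G : H →L[ℝ] H} (hG : PosContraction G) {φ : ℝ → ℝ} {T : H →L[ℝ] H}
    (hT : IsFC G φ T) {M : ℝ} (hM : ∀ x ∈ Set.Icc (0 : ℝ) 1, |φ x| ≤ M) : ‖T‖ ≤ M := by
  simpa using hT.norm_sub_le hG (isFC_poly G 0) (M := M) (by simpa using hM)

theorem IsFC.add {G : H →L[ℝ] H} {φ ψ : ℝ → ℝ} {T S : H →L[ℝ] H}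
    (hT : IsFC G φ T) (hS : IsFC G ψ S) : IsFC G (fun x => φ x + ψ x) (T + S) := by
  intro ε hε
  obtain ⟨p, hp, hpT⟩ := hT (ε / 2) (by positivity)
  obtain ⟨q, hq, hqS⟩ := hS (ε / 2) (by positivity)
  refine ⟨p + q, fun x hx => ?_, ?_⟩
  · rw [eval_add, add_sub_add_comm]
    exact (abs_add_le _ _).trans (by linarith [hp x hx, hq x hx])
  · rw [map_add, add_sub_add_comm]
    exact (norm_add_le _ _).trans (by linarith)

theorem IsFC.smul {G : H →L[ℝ] H} {φ : ℝ → ℝ} {T : H →L[ℝ] H} (c : ℝ)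
    (hT : IsFC G φ T) : IsFC G (fun x => c * φ x) (c • T) := by
  intro ε hε
  obtain ⟨p, hp, hpT⟩ := hT (ε / (|c| + 1)) (by positivity)
  have h1 : |c| * (ε / (|c| + 1)) ≤ ε := by
    rw [← mul_div_assoc, div_le_iff₀ (by positivity)]
    nlinarith [abs_nonneg c]
  refine ⟨c • p, fun x hx => ?_, ?_⟩
  · rw [eval_smul, smul_eq_mul, ← mul_sub, abs_mul]
    exact (mul_le_mul_of_nonneg_left (hp x hx) (abs_nonneg c)).trans h1
  · rw [map_smul, ← smul_sub, norm_smul]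
    exact (mul_le_mul_of_nonneg_left hpT (abs_nonneg c)).trans h1

theorem IsFC.sub {G : H →L[ℝ] H} {φ ψ : ℝ → ℝ} {T S : H →L[ℝ] H}
    (hT : IsFC G φ T) (hS : IsFC G ψ S) : IsFC G (fun x => φ x - ψ x) (T - S) := by
  have := hT.add (hS.smul (-1))
  simpa [sub_eq_add_neg] using this

theorem IsFC.exists_seq {G : H →L[ℝ] H} {φ : ℝ → ℝ} {T : H →L[ℝ] H} (hT : IsFC G φ T) :
    ∃ p : ℕ → ℝ[X], (∀ n, ∀ x ∈ Set.Icc (0 : ℝ) 1, |(p n).eval x - φ x| ≤ 1 / ((n : ℝ) + 1)) ∧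
      Tendsto (fun n => aeval G (p n)) atTop (𝓝 T) := by
  choose p hp hp' using fun n : ℕ => hT (1 / ((n : ℝ) + 1)) (by positivity)
  refine ⟨p, hp, ?_⟩
  rw [tendsto_iff_norm_sub_tendsto_zero]
  exact squeeze_zero (fun _ => norm_nonneg _) hp' tendsto_one_div_add_atTop_nhds_zero_nat

theorem isFC_of_seq {G : H →L[ℝ] H} {φ : ℝ → ℝ} {T : H →L[ℝ] H} {p : ℕ → ℝ[X]} {δ : ℕ → ℝ}
    (hδ : Tendsto δ atTop (𝓝 0))
    (hp : ∀ n, ∀ x ∈ Set.Icc (0 : ℝ) 1, |(p n).eval x - φ x| ≤ δ n)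
    (hT : Tendsto (fun n => aeval G (p n)) atTop (𝓝 T)) : IsFC G φ T := by
  intro ε hε
  rw [tendsto_iff_norm_sub_tendsto_zero] at hT
  obtain ⟨n, h1, h2⟩ := ((hδ.eventually (gt_mem_nhds hε)).and
    (hT.eventually (gt_mem_nhds hε))).exists
  exact ⟨p n, fun x hx => (hp n x hx).trans h1.le, h2.le⟩

/-- The error splits as `pq - φψ = (p - φ)q + φ(q - ψ)`, so mere boundedness of `φ` and `ψ` on `[0,
1]` suffices. -/
theorem IsFC.mul {G : H →L[ℝ] H} {φ ψ : ℝ → ℝ} {T S : H →L[ℝ] H} (hT : IsFC G φ T)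
    (hS : IsFC G ψ S) {M N : ℝ} (hφ : ∀ x ∈ Set.Icc (0 : ℝ) 1, |φ x| ≤ M)
    (hψ : ∀ x ∈ Set.Icc (0 : ℝ) 1, |ψ x| ≤ N) : IsFC G (fun x => φ x * ψ x) (T * S) := by
  obtain ⟨p, hp, hpT⟩ := hT.exists_seq
  obtain ⟨q, hq, hqS⟩ := hS.exists_seq
  have hδ := tendsto_one_div_add_atTop_nhds_zero_nat (𝕜 := ℝ)
  refine isFC_of_seq (p := fun n => p n * q n)
    (δ := fun n => 1 / ((n : ℝ) + 1) * (N + 1 / ((n : ℝ) + 1)) + M * (1 / ((n : ℝ) + 1))) ?_ ?_ ?_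
  · simpa using (hδ.mul (hδ.const_add N)).add (hδ.const_mul M)
  · intro n x hx
    have h1 : (p n * q n).eval x - φ x * ψ x =
        ((p n).eval x - φ x) * (q n).eval x + φ x * ((q n).eval x - ψ x) := by
      rw [eval_mul]; ring
    have h2 : |(q n).eval x| ≤ N + 1 / ((n : ℝ) + 1) := by
      have h3 := abs_le.1 (hq n x hx)
      have h4 := abs_le.1 (hψ x hx)
      rw [abs_le]
      constructor <;> linarith
    rw [h1]
    refine (abs_add_le _ _).trans ?_
    rw [abs_mul, abs_mul]
    gcongr
    · exact hp n x hx
    · exact (abs_nonneg _).trans (hφ x hx)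
    · exact hφ x hx
    · exact hq n x hx
  · simpa using hpT.mul hqS

/-- On the kernel of `G` a polynomial acts as multiplication by its constant term. With `φ 0 = 0`
this makes the semigroup vanish on the orthogonal complement of the domain. -/
theorem IsFC.apply_of_eq_zero {G : H →L[ℝ] H} {φ : ℝ → ℝ} {T : H →L[ℝ] H} (hT : IsFC G φ T)
    {f : H} (hf : G f = 0) : T f = φ 0 • f := by
  obtain ⟨p, hp, hpT⟩ := hT.exists_seq
  have h1 : ∀ q : ℝ[X], aeval G q f = q.eval 0 • f := by
    intro q
    induction q using Polynomial.induction_on with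
    | C a => simp [Algebra.algebraMap_eq_smul_one]
    | add p q hp hq => simp [hp, hq, add_smul]
    | monomial m a ih =>
      simp [pow_succ, hf]
  have h2 : Tendsto (fun n => aeval G (p n) f) atTop (𝓝 (T f)) :=
    ((ContinuousLinearMap.apply ℝ H f).continuous.tendsto T).comp hpT
  have h3 : Tendsto (fun n => (p n).eval 0) atTop (𝓝 (φ 0)) := by
    rw [tendsto_iff_norm_sub_tendsto_zero]
    exact squeeze_zero (fun _ => norm_nonneg _) (fun n => hp n 0 (by simp))
      tendsto_one_div_add_atTop_nhds_zero_nat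
  refine tendsto_nhds_unique h2 ?_
  simp_rw [h1]
  exact h3.smul_const f

theorem exists_isFC [CompleteSpace H] {G : H →L[ℝ] H} (hG : PosContraction G) {φ : ℝ → ℝ}
    (hφ : Continuous φ) : ∃ T, IsFC G φ T := by
  have hδ := tendsto_one_div_add_atTop_nhds_zero_nat (𝕜 := ℝ)
  choose p hp using fun n : ℕ => exists_polynomial_near_of_continuousOn 0 1 φ hφ.continuousOn
    (1 / ((n : ℝ) + 1)) (by positivity)
  have hc : CauchySeq fun n => aeval G (p n) := by
    refine cauchySeq_of_le_tendsto_0 (fun n : ℕ => 2 * (1 / ((n : ℝ) + 1))) (fun n m N hn hm => ?_)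
      (by simpa using hδ.const_mul 2)
    rw [dist_eq_norm, ← map_sub]
    refine hG.norm_aeval_le _ fun x hx => ?_
    have h1 := abs_lt.1 (hp n x hx)
    have h2 := abs_lt.1 (hp m x hx)
    have h3 : 1 / ((n : ℝ) + 1) ≤ 1 / ((N : ℝ) + 1) := by gcongr
    have h4 : 1 / ((m : ℝ) + 1) ≤ 1 / ((N : ℝ) + 1) := by gcongr
    rw [eval_sub, abs_le]
    constructor <;> linarith
  obtain ⟨T, hT⟩ := cauchySeq_tendsto_of_complete hc
  exact ⟨T, isFC_of_seq hδ (fun n x hx => (hp n x hx).le) hT⟩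

open Classical in
/-- The operator `φ(G)`. -/
def fc (G : H →L[ℝ] H) (φ : ℝ → ℝ) : H →L[ℝ] H :=
  -- The default `0` does not occur for a positive contraction on a complete space and continuous
  -- `φ`, by `exists_isFC`.
  if h : ∃ T, IsFC G φ T then h.choose else 0

theorem isFC_fc [CompleteSpace H] {G : H →L[ℝ] H} (hG : PosContraction G) {φ : ℝ → ℝ}
    (hφ : Continuous φ) : IsFC G φ (fc G φ) := by
  have h := exists_isFC hG hφ
  rw [fc, dif_pos h]
  exact h.choose_spec

theorem tendsto_aeval_apply {ι : Type*} {l : Filter ι} {Gn : ι → H →L[ℝ] H} {G : H →L[ℝ] H}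
    (hGn : ∀ i, PosContraction (Gn i)) (h : ∀ f, Tendsto (fun i => Gn i f) l (𝓝 (G f)))
    (p : ℝ[X]) (f : H) : Tendsto (fun i => aeval (Gn i) p f) l (𝓝 (aeval G p f)) := by
  induction p using Polynomial.induction_on generalizing f with
  | C a => simpa [Algebra.algebraMap_eq_smul_one] using tendsto_const_nhds
  | add p q hp hq => simpa using (hp f).add (hq f)
  | monomial m a ih =>
    have h1 : ∀ A : H →L[ℝ] H, aeval A (C a * X ^ (m + 1) : ℝ[X]) f =
        aeval A (C a * X ^ m : ℝ[X]) (A f) := by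
      intro A
      simp [pow_succ]
    simp_rw [h1]
    have h2 : ∀ x ∈ Set.Icc (0 : ℝ) 1, |(C a * X ^ m : ℝ[X]).eval x| ≤ |a| := by
      intro x hx
      simp only [eval_mul, eval_C, eval_pow, eval_X, abs_mul]
      refine mul_le_of_le_one_right (abs_nonneg _) ?_
      rw [abs_pow, abs_of_nonneg hx.1]
      exact pow_le_one₀ hx.1 hx.2
    -- The argument `Gn i f` moves with `i`; the bound `|a|`, uniform in `i`, lets it be replaced by
    -- `G f`.
    have h3 : Tendsto (fun i => aeval (Gn i) (C a * X ^ m : ℝ[X]) (Gn i f - G f)) l (𝓝 0) := by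
      refine squeeze_zero_norm (fun i => (hGn i).norm_aeval_apply_le _ h2 _) ?_
      simpa using (tendsto_iff_norm_sub_tendsto_zero.1 (h f)).const_mul |a|
    simpa [map_sub] using h3.add (ih (G f))

/-- One Weierstrass polynomial approximates `φ` on `[0, 1]`, with the same operator error for all
the `Gn i` and for `G`, so the polynomial case suffices. -/
theorem tendsto_fc_apply [CompleteSpace H] {ι : Type*} {l : Filter ι} {Gn : ι → H →L[ℝ] H}
    {G : H →L[ℝ] H} (hGn : ∀ i, PosContraction (Gn i)) (hG : PosContraction G)
    (h : ∀ f, Tendsto (fun i => Gn i f) l (𝓝 (G f))) {φ : ℝ → ℝ} (hφ : Continuous φ) (f : H) :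
    Tendsto (fun i => fc (Gn i) φ f) l (𝓝 (fc G φ f)) := by
  rw [Metric.tendsto_nhds]
  intro ε hε
  set δ := ε / (4 * (‖f‖ + 1)) with hδ
  have hδ0 : 0 < δ := by positivity
  obtain ⟨p, hp⟩ := exists_polynomial_near_of_continuousOn 0 1 φ hφ.continuousOn δ hδ0
  have h1 : ∀ A : H →L[ℝ] H, PosContraction A → ‖fc A φ f - aeval A p f‖ ≤ ε / 4 := by
    intro A hA
    have h2 : ‖fc A φ - aeval A p‖ ≤ δ := (isFC_fc hA hφ).norm_sub_le hA (isFC_poly A p)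
      fun x hx => by rw [abs_sub_comm]; exact (hp x hx).le
    calc ‖fc A φ f - aeval A p f‖ ≤ ‖fc A φ - aeval A p‖ * ‖f‖ :=
          (fc A φ - aeval A p).le_opNorm f
      _ ≤ δ * (‖f‖ + 1) := by gcongr; linarith
      _ = ε / 4 := by rw [hδ]; field_simp
  filter_upwards [(Metric.tendsto_nhds.1 (tendsto_aeval_apply hGn h p f)) (ε / 4) (by positivity)]
    with i hi
  rw [dist_eq_norm] at hi ⊢
  have h3 : fc (Gn i) φ f - fc G φ f = (fc (Gn i) φ f - aeval (Gn i) p f) +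
      (aeval (Gn i) p f - aeval G p f) - (fc G φ f - aeval G p f) := by abel
  rw [h3]
  refine (norm_sub_le _ _).trans_lt ?_
  have := norm_add_le (fc (Gn i) φ f - aeval (Gn i) p f) (aeval (Gn i) p f - aeval G p f)
  linarith [h1 _ (hGn i), h1 _ hG]

end FunctionalCalculus

end

end TwoParam

namespace TwoParam

noncomputable section

/-! ### Resolvent of a closed form -/

namespace ClosedForm

variable {H : Type*} [NormedAddCommGroup H] [InnerProductSpace ℝ H] (Q : ClosedForm H)

/-- The domain of `Q` with the inner product `Q(u, v) + (u, v)`. -/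
def EnergySpace : Type _ := Q.dom

instance : AddCommGroup Q.EnergySpace := inferInstanceAs (AddCommGroup Q.dom)
instance : Module ℝ Q.EnergySpace := inferInstanceAs (Module ℝ Q.dom)

/-- An element of the energy space, as an element of the domain. -/
def EnergySpace.toDom : Q.EnergySpace →ₗ[ℝ] Q.dom := LinearMap.id

/-- The inner product `Q(u, v) + (u, v)`. -/
@[reducible]
def energyCore : InnerProductSpace.Core ℝ Q.EnergySpace where
  inner u v := Q.form (EnergySpace.toDom Q u) (EnergySpace.toDom Q v) +
    inner ℝ (EnergySpace.toDom Q u : H) (EnergySpace.toDom Q v : H)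
  conj_inner_symm u v := by
    simp only [conj_trivial]
    rw [Q.symm, real_inner_comm]
  re_inner_nonneg u := by
    simp only [RCLike.re_to_real]
    exact add_nonneg (Q.nonneg _) real_inner_self_nonneg
  add_left u v w := by
    simp only [map_add, LinearMap.add_apply, Submodule.coe_add, inner_add_left]
    ring
  smul_left u v r := by
    simp only [map_smul, LinearMap.smul_apply, Submodule.coe_smul, inner_smul_left, smul_eq_mul,
      conj_trivial]
    ring
  definite u hu := by
    have h1 := Q.nonneg (EnergySpace.toDom Q u)
    have h2 := real_inner_self_nonneg (x := (EnergySpace.toDom Q u : H))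
    have h3 : inner ℝ (EnergySpace.toDom Q u : H) (EnergySpace.toDom Q u : H) = 0 := by
      linarith
    exact Subtype.ext (inner_self_eq_zero.1 h3)

instance : NormedAddCommGroup Q.EnergySpace :=
  Q.energyCore.toNormedAddCommGroup

instance : InnerProductSpace ℝ Q.EnergySpace :=
  InnerProductSpace.ofCore Q.energyCore.toCore

theorem energy_inner (u v : Q.EnergySpace) : inner ℝ u v =
    Q.form (EnergySpace.toDom Q u) (EnergySpace.toDom Q v) +
      inner ℝ (EnergySpace.toDom Q u : H) (EnergySpace.toDom Q v : H) := rfl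

theorem energy_norm_sq (u : Q.EnergySpace) : ‖u‖ ^ 2 =
    Q.form (EnergySpace.toDom Q u) (EnergySpace.toDom Q u) + ‖(EnergySpace.toDom Q u : H)‖ ^ 2 := by
  rw [← real_inner_self_eq_norm_sq, energy_inner, real_inner_self_eq_norm_sq]

theorem norm_toDom_le (u : Q.EnergySpace) : ‖(EnergySpace.toDom Q u : H)‖ ≤ ‖u‖ := by
  refine abs_le_of_sq_le_sq' ?_ (norm_nonneg _) |>.2
  rw [energy_norm_sq]
  linarith [Q.nonneg (EnergySpace.toDom Q u)]

theorem tendsto_energySpace_iff {ι : Type*} {l : Filter ι} {v : ι → Q.EnergySpace}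
    {u : Q.EnergySpace} : Tendsto v l (𝓝 u) ↔
      Tendsto (fun n => (EnergySpace.toDom Q (v n) : H)) l (𝓝 (EnergySpace.toDom Q u : H)) ∧
      Tendsto (fun n => Q.form (EnergySpace.toDom Q (v n) - EnergySpace.toDom Q u)
        (EnergySpace.toDom Q (v n) - EnergySpace.toDom Q u)) l (𝓝 0) := by
  have h0 : ∀ n, ‖v n - u‖ ^ 2 = Q.form (EnergySpace.toDom Q (v n) - EnergySpace.toDom Q u)
      (EnergySpace.toDom Q (v n) - EnergySpace.toDom Q u) +
      ‖(EnergySpace.toDom Q (v n) : H) - EnergySpace.toDom Q u‖ ^ 2 := fun n => by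
    rw [energy_norm_sq, map_sub, Submodule.coe_sub]
  constructor
  · intro h
    have h1 := (tendsto_iff_norm_sub_tendsto_zero.1 h).pow 2
    rw [zero_pow two_ne_zero] at h1
    refine ⟨?_, squeeze_zero (fun n => Q.nonneg _) (fun n => ?_) h1⟩
    · rw [tendsto_iff_norm_sub_tendsto_zero] at h ⊢
      refine squeeze_zero (fun _ => norm_nonneg _) (fun n => ?_) h
      rw [← Submodule.coe_sub, ← map_sub]
      exact norm_toDom_le Q _
    · rw [h0]
      exact le_add_of_nonneg_right (by positivity)
  · rintro ⟨h1, h2⟩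
    rw [tendsto_iff_norm_sub_tendsto_zero] at h1 ⊢
    have h3 : Tendsto (fun n => ‖v n - u‖ ^ 2) l (𝓝 0) := by
      simp_rw [h0]
      simpa using h2.add (h1.pow 2)
    simpa [Real.sqrt_sq (norm_nonneg _)] using h3.sqrt

/-- The form at `y` is the difference of the squared energy norm and the squared norm in `H`, and
both norms converge. -/
theorem tendsto_form_self {ι : Type*} {l : Filter ι} {v : ι → Q.dom} {u : Q.dom}
    (h1 : Tendsto (fun n => (v n : H)) l (𝓝 (u : H)))
    (h2 : Tendsto (fun n => Q.form (v n - u) (v n - u)) l (𝓝 0)) :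
    Tendsto (fun n => Q.form (v n) (v n)) l (𝓝 (Q.form u u)) := by
  let w : ι → Q.EnergySpace := v
  let x : Q.EnergySpace := u
  have h3 : Tendsto w l (𝓝 x) := Q.tendsto_energySpace_iff.2 ⟨h1, h2⟩
  have h4 := (h3.norm.pow 2).sub (h1.norm.pow 2)
  have h5 : ∀ y : Q.EnergySpace, ‖y‖ ^ 2 - ‖(EnergySpace.toDom Q y : H)‖ ^ 2 =
      Q.form (EnergySpace.toDom Q y) (EnergySpace.toDom Q y) := fun y => by
    rw [energy_norm_sq, add_sub_cancel_right]
  have h6 := h5 x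
  have h7 := fun n => h5 (w n)
  exact (h6 ▸ h4.congr h7 :)

/-- Closedness of the form is exactly completeness of its domain in the energy norm. -/
instance : CompleteSpace Q.EnergySpace := by
  refine Metric.complete_of_cauchySeq_tendsto fun u hu => ?_
  obtain ⟨v, hv1, hv2⟩ := Q.closed (fun n => EnergySpace.toDom Q (u n)) (by
      rw [Metric.cauchySeq_iff] at hu ⊢
      intro ε hε
      obtain ⟨N, hN⟩ := hu ε hε
      refine ⟨N, fun m hm n hn => lt_of_le_of_lt ?_ (hN m hm n hn)⟩
      rw [dist_eq_norm, dist_eq_norm, ← Submodule.coe_sub, ← map_sub]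
      exact norm_toDom_le Q _) (by
      rw [Metric.cauchySeq_iff] at hu
      intro ε hε
      obtain ⟨N, hN⟩ := hu (Real.sqrt ε) (Real.sqrt_pos.2 hε)
      refine ⟨N, fun m hm n hn => ?_⟩
      have h1 := hN m hm n hn
      rw [dist_eq_norm] at h1
      have h2 : ‖u m - u n‖ ^ 2 < ε := by
        rw [← Real.sq_sqrt hε.le]
        gcongr
      rw [energy_norm_sq] at h2
      rw [← map_sub]
      have := sq_nonneg ‖(EnergySpace.toDom Q (u m - u n) : H)‖
      linarith)
  let w : Q.EnergySpace := v
  exact ⟨w, Q.tendsto_energySpace_iff.2 ⟨hv1, hv2⟩⟩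

/-- The embedding of the energy space. -/
def energyEmb : Q.EnergySpace →L[ℝ] H :=
  LinearMap.mkContinuous (Q.dom.subtype ∘ₗ EnergySpace.toDom Q) 1 fun u => by
    simpa using norm_toDom_le Q u

variable [CompleteSpace H]

/-- The resolvent `(1 - L)⁻¹`, extended by zero to the orthogonal complement of the domain. -/
def resolvent : H →L[ℝ] H := Q.energyEmb ∘L Q.energyEmb.adjoint

theorem resolvent_mem (f : H) : Q.resolvent f ∈ Q.dom :=
  (EnergySpace.toDom Q (Q.energyEmb.adjoint f)).2

/-- The adjoint relation for the embedding of the energy space, written out, is the weak resolvent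
equation; the Riesz theorem enters only through the existence of the adjoint. -/
theorem form_resolvent (f : H) (v : Q.dom) :
    Q.form ⟨Q.resolvent f, Q.resolvent_mem f⟩ v + inner ℝ (Q.resolvent f) (v : H) =
      inner ℝ f (v : H) :=
  Q.energyEmb.adjoint_inner_left v f

theorem resolvent_eq_of_forall {u f : H} (hu : u ∈ Q.dom)
    (h : ∀ v : Q.dom, Q.form ⟨u, hu⟩ v + inner ℝ u (v : H) = inner ℝ f (v : H)) :
    Q.resolvent f = u := by
  let x : Q.EnergySpace := (⟨u, hu⟩ : Q.dom)
  have h1 : Q.energyEmb.adjoint f = x := by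
    refine ext_inner_right ℝ fun v => ?_
    rw [ContinuousLinearMap.adjoint_inner_left]
    exact (h v).symm
  change Q.energyEmb (Q.energyEmb.adjoint f) = u
  rw [h1]
  rfl

/-- With `J` the embedding, `(J J* x, x) = ‖J* x‖²`, and `‖J‖ ≤ 1` because the energy norm dominates
the norm of `H`. -/
theorem posContraction_resolvent : PosContraction Q.resolvent where
  symm x y := by
    exact (ContinuousLinearMap.adjoint_inner_right Q.energyEmb _ y).symm.trans
      (ContinuousLinearMap.adjoint_inner_left Q.energyEmb _ x)
  nonneg x := by
    simp only [resolvent, ContinuousLinearMap.comp_apply]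
    rw [← ContinuousLinearMap.adjoint_inner_right]
    exact real_inner_self_nonneg
  le_one x := by
    simp only [resolvent, ContinuousLinearMap.comp_apply]
    rw [← ContinuousLinearMap.adjoint_inner_right, real_inner_self_eq_norm_sq]
    have h1 : ‖Q.energyEmb.adjoint‖ ≤ 1 := by
      rw [LinearIsometryEquiv.norm_map]
      exact LinearMap.mkContinuous_norm_le _ zero_le_one _
    have h2 : ‖Q.energyEmb.adjoint x‖ ≤ ‖x‖ :=
      (ContinuousLinearMap.le_opNorm _ _).trans (mul_le_of_le_one_left (norm_nonneg _) h1)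
    gcongr

theorem resolvent_eq_zero {f : H} (hf : f ∈ Q.domᗮ) : Q.resolvent f = 0 :=
  Q.resolvent_eq_of_forall Q.dom.zero_mem fun v => by
    have h1 : (⟨0, Q.dom.zero_mem⟩ : Q.dom) = 0 := rfl
    rw [h1]
    simp [Submodule.inner_left_of_mem_orthogonal v.2 hf]

theorem mem_orthogonal_of_resolvent_eq_zero {f : H} (hf : Q.resolvent f = 0) : f ∈ Q.domᗮ := by
  rw [Submodule.mem_orthogonal']
  intro v hv
  have h1 := Q.form_resolvent f ⟨v, hv⟩
  have h2 : (⟨Q.resolvent f, Q.resolvent_mem f⟩ : Q.dom) = 0 := Subtype.ext hf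
  rw [h2, hf] at h1
  simpa using h1.symm

/-- The range of the resolvent is dense in the closure of the domain. -/
theorem exists_resolvent_near {f : H} (hf : f ∈ Q.dom.topologicalClosure) {ε : ℝ} (hε : 0 < ε) :
    ∃ g, ‖f - Q.resolvent g‖ < ε := by
  let R : Submodule ℝ H := LinearMap.range (Q.resolvent : H →ₗ[ℝ] H)
  -- After passing to orthogonal complements this says that vectors orthogonal to the range of the
  -- symmetric resolvent lie in its kernel, hence are orthogonal to the domain.
  have h1 : Q.dom.topologicalClosure ≤ R.topologicalClosure := by
    rw [← Submodule.orthogonal_orthogonal_eq_closure, ← Submodule.orthogonal_orthogonal_eq_closure]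
    refine Submodule.orthogonal_le fun x hx => Q.mem_orthogonal_of_resolvent_eq_zero ?_
    rw [Submodule.mem_orthogonal] at hx
    refine ext_inner_right ℝ fun y => ?_
    rw [Q.posContraction_resolvent.symm, inner_zero_left, real_inner_comm]
    exact hx _ ⟨y, rfl⟩
  have h2 : f ∈ closure (R : Set H) := h1 hf
  obtain ⟨y, ⟨g, rfl⟩, hg⟩ := Metric.mem_closure_iff.1 h2 ε hε
  exact ⟨g, by rw [← dist_eq_norm]; exact hg⟩

/-- Strong convergence on the range of the resolvent of uniformly bounded operators implies strong
convergence on the closure of the domain. -/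
theorem tendsto_of_tendsto_resolvent {ι : Type*} {l : Filter ι} {A : ι → H →L[ℝ] H}
    {B : H →L[ℝ] H} {C : ℝ} (hA : ∀ᶠ i in l, ‖A i‖ ≤ C)
    (h : ∀ g, Tendsto (fun i => A i (Q.resolvent g)) l (𝓝 (B (Q.resolvent g)))) {f : H}
    (hf : f ∈ Q.dom.topologicalClosure) : Tendsto (fun i => A i f) l (𝓝 (B f)) := by
  rw [Metric.tendsto_nhds]
  intro ε hε
  set M := |C| + ‖B‖ + 1
  have hM : 0 < M := by positivity
  obtain ⟨g, hg⟩ := Q.exists_resolvent_near hf (ε := ε / (2 * M)) (by positivity)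
  filter_upwards [hA, (Metric.tendsto_nhds.1 (h g)) (ε / 2) (by positivity)] with i hi hi2
  rw [dist_eq_norm] at hi2 ⊢
  have h1 : A i f - B f = (A i (Q.resolvent g) - B (Q.resolvent g)) +
      (A i - B) (f - Q.resolvent g) := by
    simp only [map_sub, sub_apply]
    abel
  have h2 : ‖A i - B‖ ≤ M :=
    (norm_sub_le _ _).trans (by linarith [le_abs_self C])
  have h3 : ‖(A i - B) (f - Q.resolvent g)‖ ≤ ε / 2 := by
    refine ((A i - B).le_opNorm _).trans ?_
    calc ‖A i - B‖ * ‖f - Q.resolvent g‖ ≤ M * (ε / (2 * M)) := by gcongr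
      _ = ε / 2 := by field_simp
  rw [h1]
  exact (norm_add_le _ _).trans_lt (by linarith)

end ClosedForm

end

end TwoParam

namespace TwoParam

noncomputable section

/-! ### The semigroup of a closed form -/

/-- The function `exp (-t (1 / x - 1))` of `x`, extended by zero to `x ≤ 0`. -/
def heat (t x : ℝ) : ℝ := Real.exp t * expNegInvGlue (x / t)

/-- Continuity at `x = 0` matters: this point stands for the infinite end of the spectrum of `-L`
and for the complement of the domain. The smooth gluing function provides it. -/
theorem continuous_heat (t : ℝ) : Continuous (heat t) := by
  have h : Continuous expNegInvGlue := (expNegInvGlue.contDiff (n := 0)).continuous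
  unfold heat
  fun_prop

theorem heat_zero (t : ℝ) : heat t 0 = 0 := by
  simp [heat, expNegInvGlue]

theorem heat_of_pos {t x : ℝ} (ht : 0 < t) (hx : 0 < x) :
    heat t x = Real.exp (-(t * (x⁻¹ - 1))) := by
  rw [heat, expNegInvGlue, if_neg (not_le.2 (div_pos hx ht)), ← Real.exp_add]
  congr 1
  rw [inv_div]
  ring

theorem heat_mem {t x : ℝ} (ht : 0 < t) (hx : x ∈ Set.Icc (0 : ℝ) 1) : |heat t x| ≤ 1 := by
  rcases hx.1.eq_or_lt with rfl | h0
  · simp [heat_zero]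
  · rw [heat_of_pos ht h0, abs_of_pos (Real.exp_pos _)]
    refine Real.exp_le_one_iff.2 ?_
    have : 1 ≤ x⁻¹ := (one_le_inv₀ h0).2 hx.2
    nlinarith

theorem heat_add {s t x : ℝ} (hs : 0 < s) (ht : 0 < t) (hx : x ∈ Set.Icc (0 : ℝ) 1) :
    heat (s + t) x = heat s x * heat t x := by
  rcases hx.1.eq_or_lt with rfl | h0
  · simp [heat_zero]
  · rw [heat_of_pos ht h0, heat_of_pos hs h0, heat_of_pos (add_pos hs ht) h0, ← Real.exp_add]
    congr 1
    ring

/-- From `e^{-y} ≥ 1 - y` with `y = t (1/x - 1)`: the factor `x` cancels the singularity, since `x y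
= t (1 - x)`. It yields `T_t R - R = O(t)`. -/
theorem abs_heat_mul_sub_le {t x : ℝ} (ht : 0 < t) (hx : x ∈ Set.Icc (0 : ℝ) 1) :
    |heat t x * x - x| ≤ t := by
  rcases hx.1.eq_or_lt with rfl | h0
  · simp [ht.le]
  · have h1 := (abs_le.1 (heat_mem ht hx)).2
    have h2 := Real.add_one_le_exp (-(t * (x⁻¹ - 1)))
    rw [← heat_of_pos ht h0] at h2
    have h3 : x * x⁻¹ = 1 := mul_inv_cancel₀ h0.ne'
    rw [abs_le]
    constructor
    · have : x * (-(t * (x⁻¹ - 1)) + 1) ≤ x * heat t x := by gcongr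
      nlinarith [hx.2]
    · nlinarith

theorem abs_exp_neg_sub_le {y : ℝ} (hy : 0 ≤ y) : |Real.exp (-y) - 1 + y| ≤ y ^ 2 / 2 := by
  have h1 := Real.add_one_le_exp (-y)
  have h2 := Real.quadratic_le_exp_of_nonneg hy
  have h3 : Real.exp (-y) * Real.exp y = 1 := by rw [← Real.exp_add]; simp
  have h4 := Real.exp_pos (-y)
  have h5 : Real.exp (-y) * (1 + y + y ^ 2 / 2) ≤ 1 := 
    (mul_le_mul_of_nonneg_left h2 h4.le).trans_eq h3
  have h6 : Real.exp (-y) ≤ 1 - y + y ^ 2 / 2 := by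
    have h7 : 0 < 1 + y + y ^ 2 / 2 := by positivity
    refine le_of_mul_le_mul_right (h5.trans ?_) h7
    -- The product `(1 - y + y²/2)(1 + y + y²/2)` equals `1 + y⁴/4`, which is at least `1`.
    nlinarith [sq_nonneg (y ^ 2)]
  rw [abs_le]
  constructor <;> nlinarith

/-- Spectral form of the convergence of difference quotients on the range of `R²`: two factors `x`
tame the second-order Taylor error `y²/2` through `x y = t (1 - x)`. -/
theorem abs_heat_second_le {t x : ℝ} (ht : 0 < t) (hx : x ∈ Set.Icc (0 : ℝ) 1) :
    |t⁻¹ * (heat t x * x - x) * x - (x * x - x)| ≤ t := by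
  rcases hx.1.eq_or_lt with rfl | h0
  · simp [ht.le]
  · have h3 : x * x⁻¹ = 1 := mul_inv_cancel₀ h0.ne'
    have h4 : 1 ≤ x⁻¹ := (one_le_inv₀ h0).2 hx.2
    set y := t * (x⁻¹ - 1) with hy
    have hy0 : 0 ≤ y := mul_nonneg ht.le (by linarith)
    have hxy : x * y = t * (1 - x) := by rw [hy]; linear_combination t * h3
    have h5 : t⁻¹ * (heat t x * x - x) * x - (x * x - x) =
        t⁻¹ * x ^ 2 * (Real.exp (-y) - 1 + y) := by
      rw [heat_of_pos ht h0]
      have h6 : t⁻¹ * t = 1 := inv_mul_cancel₀ ht.ne'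
      linear_combination -(t⁻¹ * x) * hxy - (x * (1 - x)) * h6
    rw [h5, abs_mul, abs_of_nonneg (by positivity)]
    calc t⁻¹ * x ^ 2 * |Real.exp (-y) - 1 + y| ≤ t⁻¹ * x ^ 2 * (y ^ 2 / 2) := by
          gcongr; exact abs_exp_neg_sub_le hy0
      _ = t⁻¹ * (x * y) ^ 2 / 2 := by ring
      _ = t * ((1 - x) ^ 2 / 2) := by rw [hxy]; field_simp
      _ ≤ t * 1 := by
          gcongr
          nlinarith [hx.1, hx.2]
      _ = t := mul_one t

namespace ClosedForm

variable {H : Type*} [NormedAddCommGroup H] [InnerProductSpace ℝ H] (Q : ClosedForm H)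

/-- Convergence of the difference quotient forces `T t u → u`, so `u`, and then `w`, is a limit of
elements of the closed subspace. -/
theorem mem_closure_of_tendsto_slope {T : ℝ≥0 → H →L[ℝ] H}
    (hT : ∀ t u, T t u ∈ Q.dom.topologicalClosure) {u w : H}
    (h : Tendsto (fun t : ℝ≥0 => (t : ℝ)⁻¹ • (T t u - u)) (𝓝[>] 0) (𝓝 w)) :
    u ∈ Q.dom.topologicalClosure ∧ w ∈ Q.dom.topologicalClosure := by
  have hcl := Submodule.isClosed_topologicalClosure Q.dom
  have h0 : Tendsto (fun t : ℝ≥0 => (t : ℝ)) (𝓝[>] 0) (𝓝 0) :=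
    (NNReal.continuous_coe.tendsto' 0 0 rfl).mono_left nhdsWithin_le_nhds
  have h1 : Tendsto (fun t => T t u) (𝓝[>] 0) (𝓝 u) := by
    have h2 := (h0.smul h).add_const u
    rw [zero_smul, zero_add] at h2
    refine h2.congr' ?_
    filter_upwards [self_mem_nhdsWithin] with t ht
    rw [smul_inv_smul₀ (NNReal.coe_ne_zero.2 (ne_of_gt ht)), sub_add_cancel]
  have hu : u ∈ Q.dom.topologicalClosure :=
    hcl.mem_of_tendsto h1 (Eventually.of_forall fun t => hT t u)
  exact ⟨hu, hcl.mem_of_tendsto h (Eventually.of_forall fun t =>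
    Submodule.smul_mem _ _ (Submodule.sub_mem _ (hT t u) hu))⟩

variable [CompleteSpace H]

open Classical in
/-- The semigroup of `Q`, as a function of the resolvent. -/
def semigroup (t : ℝ≥0) : H →L[ℝ] H :=
  -- Time zero needs its own clause: by the convention `x / 0 = 0`, `heat 0` is the zero function,
  -- whereas the operator must be the projection.
  if t = 0 then Q.dom.topologicalClosure.starProjection else fc Q.resolvent (heat t)

theorem isFC_semigroup {t : ℝ≥0} (ht : t ≠ 0) : IsFC Q.resolvent (heat t) (Q.semigroup t) := by
  rw [semigroup, if_neg ht]
  exact isFC_fc Q.posContraction_resolvent (continuous_heat _)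

theorem abs_id_le : ∀ x ∈ Set.Icc (0 : ℝ) 1, |x| ≤ 1 := fun x hx => by
  rw [abs_of_nonneg hx.1]; exact hx.2

theorem resolvent_mem_closure (f : H) : Q.resolvent f ∈ Q.dom.topologicalClosure :=
  Q.dom.le_topologicalClosure (Q.resolvent_mem f)

theorem sub_starProjection_mem (f : H) :
    f - Q.dom.topologicalClosure.starProjection f ∈ Q.domᗮ := by
  have := Q.dom.topologicalClosure.sub_starProjection_mem_orthogonal f
  rwa [Submodule.orthogonal_closure] at this

theorem semigroup_norm_le (t : ℝ≥0) : ‖Q.semigroup t‖ ≤ 1 := by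
  by_cases ht : t = 0
  · rw [semigroup, if_pos ht]
    exact Submodule.starProjection_norm_le _
  · exact (Q.isFC_semigroup ht).norm_le Q.posContraction_resolvent
      fun x hx => heat_mem (by positivity) hx

theorem semigroup_starProjection (t : ℝ≥0) (f : H) :
    Q.semigroup t (Q.dom.topologicalClosure.starProjection f) = Q.semigroup t f := by
  have h1 : Q.semigroup t (f - Q.dom.topologicalClosure.starProjection f) = 0 := by
    by_cases ht : t = 0
    · rw [semigroup, if_pos ht]
      rw [Submodule.starProjection_apply_eq_zero_iff, Submodule.orthogonal_closure]
      exact Q.sub_starProjection_mem f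
    · rw [(Q.isFC_semigroup ht).apply_of_eq_zero
        (Q.resolvent_eq_zero (Q.sub_starProjection_mem f)), heat_zero, zero_smul]
  rw [map_sub, sub_eq_zero] at h1
  exact h1.symm

theorem starProjection_of_mem {f : H} (hf : f ∈ Q.dom.topologicalClosure) :
    Q.dom.topologicalClosure.starProjection f = f :=
  Submodule.starProjection_eq_self_iff.2 hf

theorem isFC_semigroup_mul {t : ℝ≥0} (ht : t ≠ 0) :
    IsFC Q.resolvent (fun x => heat t x * x) (Q.semigroup t * Q.resolvent) :=
  (Q.isFC_semigroup ht).mul (isFC_id _) (fun x hx => heat_mem (by positivity) hx) abs_id_le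

theorem semigroup_resolvent {t : ℝ≥0} (ht : t ≠ 0) (f : H) :
    Q.semigroup t (Q.resolvent f) = Q.resolvent (Q.semigroup t f) := by
  have h1 := Q.isFC_semigroup_mul ht
  have h2 : IsFC Q.resolvent (fun x => x * heat t x) (Q.resolvent * Q.semigroup t) :=
    (isFC_id _).mul (Q.isFC_semigroup ht) abs_id_le (fun x hx => heat_mem (by positivity) hx)
  have h3 := h1.unique Q.posContraction_resolvent (h2.congr fun x _ => mul_comm _ _)
  exact congrArg (fun A : H →L[ℝ] H => A f) h3

/-- The semigroup commutes with the resolvent, whose range lies in the domain and is dense in its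
closure. -/
theorem semigroup_mem (t : ℝ≥0) (f : H) : Q.semigroup t f ∈ Q.dom.topologicalClosure := by
  by_cases ht : t = 0
  · rw [semigroup, if_pos ht]
    exact Submodule.starProjection_apply_mem _ _
  rw [← Q.semigroup_starProjection]
  set g := Q.dom.topologicalClosure.starProjection f
  have hg : g ∈ Q.dom.topologicalClosure := Submodule.starProjection_apply_mem _ _
  rw [← SetLike.mem_coe, ← (Submodule.isClosed_topologicalClosure Q.dom).closure_eq,
    Metric.mem_closure_iff]
  intro ε hε
  obtain ⟨y, hy⟩ := Q.exists_resolvent_near hg hε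
  refine ⟨Q.semigroup t (Q.resolvent y), ?_, ?_⟩
  · rw [Q.semigroup_resolvent ht]
    exact Q.resolvent_mem_closure _
  · rw [dist_eq_norm, ← map_sub]
    refine ((Q.semigroup t).le_opNorm _).trans_lt ?_
    exact (mul_le_of_le_one_left (norm_nonneg _) (Q.semigroup_norm_le t)).trans_lt hy

theorem semigroup_zero : Q.semigroup 0 = Q.dom.topologicalClosure.starProjection := by
  rw [semigroup, if_pos rfl]

theorem semigroup_add (s t : ℝ≥0) : Q.semigroup (s + t) = (Q.semigroup s).comp (Q.semigroup t) := by
  by_cases hs : s = 0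
  · ext f
    rw [hs, zero_add, semigroup_zero, ContinuousLinearMap.comp_apply,
      Q.starProjection_of_mem (Q.semigroup_mem t f)]
  by_cases ht : t = 0
  · ext f
    rw [ht, add_zero, semigroup_zero, ContinuousLinearMap.comp_apply, Q.semigroup_starProjection]
  have hs' : (0 : ℝ) < s := by positivity
  have ht' : (0 : ℝ) < t := by positivity
  refine IsFC.unique Q.posContraction_resolvent (Q.isFC_semigroup (by positivity)) ?_
  refine ((Q.isFC_semigroup hs).mul (Q.isFC_semigroup ht) (fun x hx => heat_mem hs' hx)
    (fun x hx => heat_mem ht' hx)).congr fun x hx => ?_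
  rw [NNReal.coe_add, heat_add hs' ht' hx]

theorem norm_semigroup_resolvent_sub_le (t : ℝ≥0) (g : H) :
    ‖Q.semigroup t (Q.resolvent g) - Q.resolvent g‖ ≤ t * ‖g‖ := by
  by_cases ht : t = 0
  · rw [ht, semigroup_zero, Q.starProjection_of_mem (Q.resolvent_mem_closure g)]
    simp
  have h1 : ‖Q.semigroup t * Q.resolvent - Q.resolvent‖ ≤ t :=
    (Q.isFC_semigroup_mul ht).norm_sub_le Q.posContraction_resolvent (isFC_id _)
      fun x hx => abs_heat_mul_sub_le (by positivity) hx
  exact ContinuousLinearMap.le_of_opNorm_le _ h1 g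

theorem tendsto_semigroup_zero {f : H} (hf : f ∈ Q.dom.topologicalClosure) :
    Tendsto (fun t => Q.semigroup t f) (𝓝 0) (𝓝 f) := by
  refine Q.tendsto_of_tendsto_resolvent (B := 1) (Eventually.of_forall Q.semigroup_norm_le)
    (fun g => ?_) hf
  rw [tendsto_iff_norm_sub_tendsto_zero]
  refine squeeze_zero (fun _ => norm_nonneg _)
    (fun t => Q.norm_semigroup_resolvent_sub_le t g) ?_
  have : Tendsto (fun t : ℝ≥0 => (t : ℝ)) (𝓝 0) (𝓝 0) :=
    NNReal.continuous_coe.tendsto' 0 0 rfl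
  simpa using this.mul_const ‖g‖

/-- By `T_{r+h} - T_r = T_r (T_h - 1)` and contractivity, continuity at every time reduces to
continuity at zero on the closure of the domain. -/
theorem norm_semigroup_sub_le (s t : ℝ≥0) (u : H) :
    ‖Q.semigroup t u - Q.semigroup s u‖ ≤
      ‖Q.semigroup (nndist t s) (Q.dom.topologicalClosure.starProjection u) -
        Q.dom.topologicalClosure.starProjection u‖ := by
  have key : ∀ r h : ℝ≥0, ‖Q.semigroup (r + h) u - Q.semigroup r u‖ ≤
      ‖Q.semigroup h (Q.dom.topologicalClosure.starProjection u) -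
        Q.dom.topologicalClosure.starProjection u‖ := by
    intro r h
    rw [semigroup_add, ContinuousLinearMap.comp_apply, ← Q.semigroup_starProjection r u,
      ← Q.semigroup_starProjection h u, ← map_sub]
    exact ((Q.semigroup r).le_opNorm _).trans
      (mul_le_of_le_one_left (norm_nonneg _) (Q.semigroup_norm_le r))
  rcases le_total s t with h | h
  · have h1 : t = s + nndist t s := by
      rw [← NNReal.coe_inj, NNReal.coe_add, coe_nndist, NNReal.dist_eq,
        abs_of_nonneg (sub_nonneg.2 (NNReal.coe_le_coe.2 h))]
      ring
    have h2 := key s (nndist t s)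
    rwa [← h1] at h2
  · have h1 : s = t + nndist t s := by
      rw [← NNReal.coe_inj, NNReal.coe_add, coe_nndist, NNReal.dist_eq,
        abs_of_nonpos (sub_nonpos.2 (NNReal.coe_le_coe.2 h))]
      ring
    have h2 := key t (nndist t s)
    rwa [← h1, norm_sub_rev] at h2

theorem continuous_semigroup (u : H) : Continuous fun t => Q.semigroup t u := by
  rw [continuous_iff_continuousAt]
  intro s
  rw [ContinuousAt, tendsto_iff_norm_sub_tendsto_zero]
  refine squeeze_zero (fun _ => norm_nonneg _) (fun t => Q.norm_semigroup_sub_le s t u) ?_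
  have h1 := Q.tendsto_semigroup_zero
    (Submodule.starProjection_apply_mem Q.dom.topologicalClosure u)
  rw [tendsto_iff_norm_sub_tendsto_zero] at h1
  refine h1.comp ?_
  have : Continuous fun t : ℝ≥0 => nndist t s := by fun_prop
  exact this.tendsto' s 0 (by simp)

/-- The operators `t⁻¹ (T_t R - R)` have norm at most `1` by the first-order estimate, and converge
on the range of `R` by the second-order one; density finishes. -/
theorem tendsto_slope_resolvent {f : H} (hf : f ∈ Q.dom.topologicalClosure) :
    Tendsto (fun t : ℝ≥0 => (t : ℝ)⁻¹ • (Q.semigroup t (Q.resolvent f) - Q.resolvent f))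
      (𝓝[>] 0) (𝓝 (Q.resolvent f - f)) := by
  have hfc : ∀ t : ℝ≥0, 0 < t → IsFC Q.resolvent (fun x => (t : ℝ)⁻¹ * (heat t x * x - x))
      ((t : ℝ)⁻¹ • (Q.semigroup t * Q.resolvent - Q.resolvent)) := fun t ht =>
    ((Q.isFC_semigroup_mul ht.ne').sub (isFC_id _)).smul _
  have hbd : ∀ t : ℝ≥0, 0 < t → ∀ x ∈ Set.Icc (0 : ℝ) 1,
      |(t : ℝ)⁻¹ * (heat t x * x - x)| ≤ 1 := by
    intro t ht x hx
    have ht' : (0 : ℝ) < t := ht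
    rw [abs_mul, abs_of_pos (inv_pos.2 ht'), inv_mul_le_iff₀ ht', mul_one]
    exact abs_heat_mul_sub_le ht' hx
  refine Q.tendsto_of_tendsto_resolvent (l := 𝓝[>] (0 : ℝ≥0))
    (A := fun t : ℝ≥0 => (t : ℝ)⁻¹ • (Q.semigroup t * Q.resolvent - Q.resolvent))
    (B := Q.resolvent - 1) (C := 1) ?_ (fun g => ?_) hf
  · filter_upwards [self_mem_nhdsWithin] with t ht
    exact (hfc t ht).norm_le Q.posContraction_resolvent (hbd t ht)
  · rw [tendsto_iff_norm_sub_tendsto_zero]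
    have h0 : Tendsto (fun t : ℝ≥0 => (t : ℝ) * ‖g‖) (𝓝[>] 0) (𝓝 0) := by
      have : Tendsto (fun t : ℝ≥0 => (t : ℝ)) (𝓝 0) (𝓝 0) :=
        NNReal.continuous_coe.tendsto' 0 0 rfl
      simpa using (this.mono_left nhdsWithin_le_nhds).mul_const ‖g‖
    refine squeeze_zero' (Eventually.of_forall fun _ => norm_nonneg _) ?_ h0
    filter_upwards [self_mem_nhdsWithin] with t ht
    have h1 := (hfc t ht).mul (isFC_id _) (hbd t ht) abs_id_le
    have h2 : IsFC Q.resolvent (fun x => x * x - x) (Q.resolvent * Q.resolvent - Q.resolvent) :=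
      ((isFC_id _).mul (isFC_id _) abs_id_le abs_id_le).sub (isFC_id _)
    have h3 := h1.norm_sub_le Q.posContraction_resolvent h2
      (fun x hx => abs_heat_second_le (NNReal.coe_pos.2 ht) hx)
    exact ContinuousLinearMap.le_of_opNorm_le _ h3 g

theorem isSemigroup_semigroup : Q.IsSemigroup Q.semigroup where
  zero := Q.semigroup_zero
  add := Q.semigroup_add
  contraction t u := ((Q.semigroup t).le_opNorm u).trans
    (mul_le_of_le_one_left (norm_nonneg _) (Q.semigroup_norm_le t))
  continuous := Q.continuous_semigroup
  generator u w := by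
    constructor
    · intro h
      obtain ⟨hu, hw⟩ := Q.mem_closure_of_tendsto_slope Q.semigroup_mem h
      -- Applying the resolvent to the quotients computes their limit a second time: `R w = R u -
      -- u`. Hence `u = R (u - w)`, which puts `u` in the domain.
      have h1 := (Q.resolvent.continuous.tendsto w).comp h
      have h2 := tendsto_nhds_unique (h1.congr' ?_) (Q.tendsto_slope_resolvent hu)
      · have h3 : Q.resolvent (u - w) = u := by
          rw [map_sub, h2]
          abel
        have h4 := Q.form_resolvent (u - w)
        have h5 : u ∈ Q.dom := by
          rw [← h3]
          exact Q.resolvent_mem _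
        refine ⟨h5, hw, fun v => ?_⟩
        have h6 := h4 v
        simp only [h3, inner_sub_left] at h6
        linarith
      · filter_upwards [self_mem_nhdsWithin] with t ht
        rw [Function.comp_apply, map_smul, map_sub, ← Q.semigroup_resolvent (ne_of_gt ht)]
    · rintro ⟨hu, hw, h⟩
      have h1 : Q.resolvent (u - w) = u := Q.resolvent_eq_of_forall hu fun v => by
        rw [h v, inner_sub_left]
        ring
      have h2 := Q.tendsto_slope_resolvent (f := u - w)
        (Submodule.sub_mem _ (Q.dom.le_topologicalClosure hu) hw)
      rw [h1] at h2
      simpa using h2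

/-! ### Uniqueness and convergence of semigroups -/

variable {Q}

theorem IsSemigroup.apply_starProjection {T : ℝ≥0 → H →L[ℝ] H} (hT : Q.IsSemigroup T) (t : ℝ≥0)
    (u : H) : T t (Q.dom.topologicalClosure.starProjection u) = T t u := by
  have := hT.add t 0
  rw [add_zero, hT.zero] at this
  exact (congrArg (fun A : H →L[ℝ] H => A u) this).symm

theorem IsSemigroup.tendsto_slope {T : ℝ≥0 → H →L[ℝ] H} (hT : Q.IsSemigroup T) {u w : H}
    (h : Tendsto (fun t : ℝ≥0 => (t : ℝ)⁻¹ • (T t u - u)) (𝓝[>] 0) (𝓝 w)) (s : ℝ≥0) :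
    Tendsto (fun t : ℝ≥0 => (t : ℝ)⁻¹ • (T t (T s u) - T s u)) (𝓝[>] 0) (𝓝 (T s w)) := by
  have h1 := ((T s).continuous.tendsto w).comp h
  refine h1.congr fun t => ?_
  have h2 : T t (T s u) = T s (T t u) := by
    rw [← ContinuousLinearMap.comp_apply, ← ContinuousLinearMap.comp_apply, ← hT.add, ← hT.add,
      add_comm]
  rw [Function.comp_apply, map_smul, map_sub, h2]

theorem IsSemigroup.hasDerivWithinAt {T : ℝ≥0 → H →L[ℝ] H} (hT : Q.IsSemigroup T) {u w : H}
    (h : Tendsto (fun t : ℝ≥0 => (t : ℝ)⁻¹ • (T t u - u)) (𝓝[>] 0) (𝓝 w)) {s : ℝ} (hs : 0 ≤ s) :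
    HasDerivWithinAt (fun r : ℝ => T r.toNNReal u) (T s.toNNReal w) (Set.Ici s) s := by
  rw [← hasDerivWithinAt_Ioi_iff_Ici, hasDerivWithinAt_iff_tendsto_slope' (by simp)]
  have h1 := hT.tendsto_slope h s.toNNReal
  have h2 : Tendsto (fun r : ℝ => (r - s).toNNReal) (𝓝[>] s) (𝓝[>] 0) := by
    refine tendsto_nhdsWithin_iff.2 ⟨?_, ?_⟩
    · have : Continuous fun r : ℝ => (r - s).toNNReal := by fun_prop
      exact (this.tendsto' s 0 (by simp)).mono_left nhdsWithin_le_nhds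
    · filter_upwards [self_mem_nhdsWithin] with r hr
      simpa using hr
  refine (h1.comp h2).congr' ?_
  filter_upwards [self_mem_nhdsWithin] with r hr
  have hr' : s < r := hr
  have h3 : r.toNNReal = (r - s).toNNReal + s.toNNReal := by
    rw [← Real.toNNReal_add (by linarith) hs, sub_add_cancel]
  rw [slope_def_module, Function.comp_apply, h3, hT.add, ContinuousLinearMap.comp_apply,
    Real.coe_toNNReal _ (by linarith)]

/-- For `u` in the range of the resolvent let `x_s = T_s u - S_s u`. The right derivative of
`‖x_s‖²` is `2 (L x_s, x_s) = -2 Q(x_s, x_s) ≤ 0`, and `x_0 = 0`. Density and the projection at time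
zero extend the equality to all vectors. -/
theorem IsSemigroup.unique {T S : ℝ≥0 → H →L[ℝ] H} (hT : Q.IsSemigroup T) (hS : Q.IsSemigroup S) :
    T = S := by
  have key : ∀ g t, T t (Q.resolvent g) = S t (Q.resolvent g) := by
    intro g t
    set u := Q.resolvent g
    set w := u - Q.dom.topologicalClosure.starProjection g
    have hgen : ∃ hu : u ∈ Q.dom, w ∈ Q.dom.topologicalClosure ∧
        ∀ v : Q.dom, Q.form ⟨u, hu⟩ v = -inner ℝ w (v : H) := by
      refine ⟨Q.resolvent_mem g, Submodule.sub_mem _ (Q.resolvent_mem_closure g)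
        (Submodule.starProjection_apply_mem _ _), fun v => ?_⟩
      have h1 := Q.form_resolvent g v
      have h2 := Submodule.inner_left_of_mem_orthogonal v.2 (Q.sub_starProjection_mem g)
      rw [inner_sub_left] at h2
      rw [inner_sub_left]
      linarith
    have hTu := (hT.generator u w).2 hgen
    have hSu := (hS.generator u w).2 hgen
    have hd : ∀ s ∈ Set.Ico (0 : ℝ) t, HasDerivWithinAt
        (fun r : ℝ => ‖T r.toNNReal u - S r.toNNReal u‖ ^ 2)
        (2 * inner ℝ (T s.toNNReal u - S s.toNNReal u) (T s.toNNReal w - S s.toNNReal w))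
        (Set.Ici s) s := fun s hs =>
      ((hT.hasDerivWithinAt hTu hs.1).sub (hS.hasDerivWithinAt hSu hs.1)).norm_sq
    have hc : ContinuousOn (fun r : ℝ => ‖T r.toNNReal u - S r.toNNReal u‖ ^ 2)
        (Set.Icc (0 : ℝ) t) := by
      have h1 := (hT.continuous u).comp continuous_real_toNNReal
      have h2 := (hS.continuous u).comp continuous_real_toNNReal
      exact ((h1.sub h2).norm.pow 2).continuousOn
    have hle := image_le_of_deriv_right_le_deriv_boundary hc hd (B := fun _ => 0) (B' := fun _ => 0)
      (by simp [hT.zero, hS.zero]) continuousOn_const (fun s _ => hasDerivWithinAt_const _ _ _)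
      (fun s _ => ?_) (x := t) ⟨t.2, le_rfl⟩
    · simp only [Real.toNNReal_coe] at hle
      have h1 : ‖T t u - S t u‖ = 0 := by
        have h2 := norm_nonneg (T t u - S t u)
        nlinarith
      exact sub_eq_zero.1 (norm_eq_zero.1 h1)
    · obtain ⟨h1, -, h2⟩ := (hT.generator _ _).1 (hT.tendsto_slope hTu s.toNNReal)
      obtain ⟨h3, -, h4⟩ := (hS.generator _ _).1 (hS.tendsto_slope hSu s.toNNReal)
      set x : Q.dom := ⟨_, h1⟩ - ⟨_, h3⟩ with hx
      have h5 : Q.form x x = -inner ℝ (T s.toNNReal w - S s.toNNReal w)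
          (T s.toNNReal u - S s.toNNReal u) := by
        have h6 : Q.form x x = Q.form ⟨_, h1⟩ x - Q.form ⟨_, h3⟩ x := by
          rw [← LinearMap.sub_apply, ← map_sub]
        rw [h6, h2, h4, inner_sub_left, hx, Submodule.coe_sub]
        ring
      have h7 := Q.nonneg x
      rw [h5, real_inner_comm] at h7
      linarith
  funext t
  ext f
  rw [← hT.apply_starProjection, ← hS.apply_starProjection]
  have hf : Q.dom.topologicalClosure.starProjection f ∈ Q.dom.topologicalClosure :=
    Submodule.starProjection_apply_mem _ _
  -- The density principle is applied to constant families over a one-point index set, so that its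
  -- limit statement is an equality.
  have h1 := Q.tendsto_of_tendsto_resolvent (l := (⊤ : Filter Unit)) (A := fun _ => T t)
    (B := S t) (C := ‖T t‖) (Eventually.of_forall fun _ => le_rfl)
    (fun g => by rw [key]; exact tendsto_const_nhds) hf
  exact tendsto_nhds_unique tendsto_const_nhds h1

/-- Strong convergence of the resolvents to the resolvent of a densely defined form implies strong
convergence of the semigroups. -/
theorem tendsto_semigroup {Qn : ℕ → ClosedForm H} (hQ : Dense (Q.dom : Set H))
    (h : ∀ f, Tendsto (fun n => (Qn n).resolvent f) atTop (𝓝 (Q.resolvent f))) (t : ℝ≥0) (f : H) :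
    Tendsto (fun n => (Qn n).semigroup t f) atTop (𝓝 (Q.semigroup t f)) := by
  by_cases ht : t = 0
  · have htop : ∀ x, x ∈ Q.dom.topologicalClosure := fun x => hQ x
    rw [ht, semigroup_zero, Q.starProjection_of_mem (htop f), Metric.tendsto_nhds]
    intro ε hε
    obtain ⟨g, hg⟩ := Q.exists_resolvent_near (htop f) hε
    have h1 : Tendsto (fun n => ‖f - (Qn n).resolvent g‖) atTop (𝓝 ‖f - Q.resolvent g‖) :=
      ((h g).const_sub f).norm
    filter_upwards [h1.eventually (gt_mem_nhds hg)] with n hn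
    rw [semigroup_zero, dist_comm, dist_eq_norm]
    refine lt_of_le_of_lt ?_ hn
    -- The projection is the nearest point, so its error is at most the distance from `f` to the
    -- competitor `(Qn n).resolvent g`.
    rw [Submodule.starProjection_minimal]
    exact ciInf_le ⟨0, by rintro _ ⟨x, rfl⟩; exact norm_nonneg _⟩
      (⟨(Qn n).resolvent g, (Qn n).resolvent_mem_closure g⟩ : (Qn n).dom.topologicalClosure)
  · simp only [semigroup, if_neg ht]
    exact tendsto_fc_apply (fun n => (Qn n).posContraction_resolvent) Q.posContraction_resolvent h
      (continuous_heat _) f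

/-- Strong convergence of the resolvents of restrictions of a closed form to domains which exhaust
its domain in the energy norm. -/
theorem tendsto_resolvent {Qn : ℕ → ClosedForm H}
    (hle : ∀ n, ∀ u : (Qn n).dom, ∃ hu : (u : H) ∈ Q.dom, ∀ v : (Qn n).dom, ∀ hv : (v : H) ∈ Q.dom,
      (Qn n).form u v = Q.form ⟨u, hu⟩ ⟨v, hv⟩)
    (happ : ∀ u : Q.dom, ∃ v : ℕ → Q.dom, (∀ n, (v n : H) ∈ (Qn n).dom) ∧
      Tendsto (fun n => (v n : H)) atTop (𝓝 (u : H)) ∧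
      Tendsto (fun n => Q.form (v n - u) (v n - u)) atTop (𝓝 0)) (f : H) :
    Tendsto (fun n => (Qn n).resolvent f) atTop (𝓝 (Q.resolvent f)) := by
  let u : Q.EnergySpace := (⟨Q.resolvent f, Q.resolvent_mem f⟩ : Q.dom)
  obtain ⟨v, hv, hv1, hv2⟩ := happ ⟨Q.resolvent f, Q.resolvent_mem f⟩
  have hmem : ∀ n, (Qn n).resolvent f ∈ Q.dom := fun n => (hle n ⟨_, (Qn n).resolvent_mem f⟩).1
  let un : ℕ → Q.EnergySpace := fun n => (⟨(Qn n).resolvent f, hmem n⟩ : Q.dom)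
  let vn : ℕ → Q.EnergySpace := fun n => (v n : Q.dom)
  -- Galerkin orthogonality: both resolvents solve the same weak equation against test vectors from
  -- the smaller domain.
  have horth : ∀ n, ∀ x : Q.EnergySpace, (EnergySpace.toDom Q x : H) ∈ (Qn n).dom →
      inner ℝ (un n - u) x = 0 := by
    intro n x hx
    have h1 := Q.form_resolvent f (EnergySpace.toDom Q x)
    have h2 := (Qn n).form_resolvent f ⟨_, hx⟩
    obtain ⟨h3, h4⟩ := hle n ⟨_, (Qn n).resolvent_mem f⟩
    rw [h4 ⟨_, hx⟩ (EnergySpace.toDom Q x).2] at h2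
    rw [inner_sub_left, sub_eq_zero]
    exact h2.trans h1.symm
  -- Orthogonality makes `un n` the best energy approximation of `u` in the smaller domain, hence no
  -- worse than the given `vn n`.
  have hbound : ∀ n, ‖un n - u‖ ≤ ‖vn n - u‖ := by
    intro n
    have h1 : inner ℝ (un n - u) (un n - vn n) = 0 :=
      horth n _ (by
        rw [map_sub, Submodule.coe_sub]
        exact Submodule.sub_mem _ ((Qn n).resolvent_mem f) (hv n))
    have h2 : ‖un n - u‖ * ‖un n - u‖ ≤ ‖un n - u‖ * ‖vn n - u‖ := by
      calc ‖un n - u‖ * ‖un n - u‖ = inner ℝ (un n - u) (un n - u) :=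
            (real_inner_self_eq_norm_mul_norm _).symm
        _ = inner ℝ (un n - u) (un n - vn n) + inner ℝ (un n - u) (vn n - u) := by
            rw [← inner_add_right, sub_add_sub_cancel]
        _ ≤ ‖un n - u‖ * ‖vn n - u‖ := by
            rw [h1, zero_add]
            exact real_inner_le_norm _ _
    rcases (norm_nonneg (un n - u)).eq_or_lt with h3 | h3
    · rw [← h3]; exact norm_nonneg _
    · exact le_of_mul_le_mul_left h2 h3
  have hlim : Tendsto (fun n => ‖vn n - u‖) atTop (𝓝 0) :=
    tendsto_iff_norm_sub_tendsto_zero.1 (Q.tendsto_energySpace_iff.2 ⟨hv1, hv2⟩)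
  rw [tendsto_iff_norm_sub_tendsto_zero]
  refine squeeze_zero (fun _ => norm_nonneg _) (fun n => ?_) hlim
  exact (norm_toDom_le Q (un n - u)).trans (hbound n)

end ClosedForm

end

end TwoParam

namespace TwoParam

noncomputable section

/-! ### Closures and relaxations of forms given by a closable operator -/

namespace ClosedForm

/-! ### Uniqueness of closures and relaxations. -/

section Order

variable {H : Type*} [NormedAddCommGroup H] [InnerProductSpace ℝ H] {A : Type*}

theorem form_add_self (Q : ClosedForm H) (u v : Q.dom) :
    Q.form (u + v) (u + v) = Q.form u u + 2 * Q.form u v + Q.form v v := by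
  simp only [map_add, LinearMap.add_apply]
  rw [Q.symm v u]
  ring

theorem form_sub_self (Q : ClosedForm H) (u v : Q.dom) :
    Q.form (u - v) (u - v) = Q.form u u - 2 * Q.form u v + Q.form v v := by
  simp only [map_sub, LinearMap.sub_apply]
  rw [Q.symm v u]
  ring

/-- The two inequalities give equal domains and equal quadratic forms; polarization recovers the
bilinear forms. -/
theorem IsLE.antisymm {Q R : ClosedForm H} (h1 : Q.IsLE R) (h2 : R.IsLE Q) : Q = R := by
  have hdom : Q.dom = R.dom :=
    le_antisymm (fun u hu => (h2 ⟨u, hu⟩).1) (fun u hu => (h1 ⟨u, hu⟩).1)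
  obtain ⟨Qd, Qf, Qs, Qn, Qc⟩ := Q
  obtain ⟨Rd, Rf, Rs, Rn, Rc⟩ := R
  obtain rfl : Qd = Rd := hdom
  have hself : ∀ u : Qd, Qf u u = Rf u u := fun u =>
    le_antisymm (h1 u).2 (h2 u).2
  have hform : Qf = Rf := by
    ext u v
    have e1 := form_add_self ⟨Qd, Qf, Qs, Qn, Qc⟩ u v
    have e2 := form_add_self ⟨Qd, Rf, Rs, Rn, Rc⟩ u v
    simp only at e1 e2
    have := hself (u + v)
    have := hself u
    have := hself v
    linarith
  subst hform
  rfl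

theorem IsRelaxationOf.unique {Q R : ClosedForm H} {ι : A → H} {e : A → A → ℝ}
    (hQ : Q.IsRelaxationOf ι e) (hR : R.IsRelaxationOf ι e) : Q = R :=
  IsLE.antisymm (hR.2 Q hQ.1) (hQ.2 R hR.1)

/-- The energies of an approximating sequence and of its differences are determined by `e` alone. A
sequence converging in the energy of `Q` is therefore Cauchy in that of `R`, with the same limiting
energy. -/
theorem IsClosureOf.isLE {Q R : ClosedForm H} {ι : A → H} {e : A → A → ℝ} {s : Set A}
    (hQ : Q.IsClosureOf ι e s) (hR : R.IsClosureOf ι e s) : R.IsLE Q := by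
  intro u
  obtain ⟨⟨hQd, hQe⟩, hQa⟩ := hQ
  obtain ⟨⟨hRd, hRe⟩, -⟩ := hR
  obtain ⟨a, v, hav, hv1, hv2⟩ := hQa u
  have hv : ∀ n, v n = ⟨ι (a n), hQd _ (hav n).1⟩ := fun n => Subtype.ext (hav n).2
  let w : ℕ → R.dom := fun n => ⟨ι (a n), hRd _ (hav n).1⟩
  have hw : ∀ n, (w n : H) = v n := fun n => (hav n).2.symm
  have hself : ∀ n, R.form (w n) (w n) = Q.form (v n) (v n) := fun n => by
    rw [hv, hQe _ (hav n).1 _ (hav n).1]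
    exact hRe _ (hav n).1 _ (hav n).1
  have hdiff : ∀ m n, R.form (w m - w n) (w m - w n) = Q.form (v m - v n) (v m - v n) := by
    intro m n
    rw [form_sub_self, form_sub_self, hself, hself, hv m, hv n, hQe _ (hav m).1 _ (hav n).1,
      hRe _ (hav m).1 _ (hav n).1]
  let v' : ℕ → Q.EnergySpace := v
  let u' : Q.EnergySpace := u
  have hconv : Tendsto v' atTop (𝓝 u') :=
    Q.tendsto_energySpace_iff.2 ⟨hv1, hv2⟩
  obtain ⟨x, hx1, hx2⟩ := R.closed w (by simpa only [hw] using hv1.cauchySeq) (by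
    intro ε hε
    obtain ⟨N, hN⟩ := Metric.cauchySeq_iff.1 hconv.cauchySeq (Real.sqrt ε) (Real.sqrt_pos.2 hε)
    refine ⟨N, fun m hm n hn => ?_⟩
    rw [hdiff]
    have h1 := hN m hm n hn
    rw [dist_eq_norm, Real.lt_sqrt (norm_nonneg _), energy_norm_sq] at h1
    exact lt_of_le_of_lt (le_add_of_nonneg_right (sq_nonneg _)) h1)
  have hxu : (x : H) = u := tendsto_nhds_unique (by simpa only [hw] using hx1) hv1
  have hmem : (u : H) ∈ R.dom := hxu ▸ x.2
  obtain rfl : x = ⟨u, hmem⟩ := Subtype.ext hxu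
  refine ⟨hmem, le_of_eq ?_⟩
  refine tendsto_nhds_unique (R.tendsto_form_self hx1 hx2) ?_
  simp_rw [hself]
  exact Q.tendsto_form_self hv1 hv2

theorem IsClosureOf.unique {Q R : ClosedForm H} {ι : A → H} {e : A → A → ℝ} {s : Set A}
    (hQ : Q.IsClosureOf ι e s) (hR : R.IsClosureOf ι e s) : Q = R :=
  IsLE.antisymm (hR.isLE hQ) (hQ.isLE hR)

end Order

/-! ### Forms of closed operators, described by their graphs. -/

section Graph

variable {H K : Type*} [NormedAddCommGroup H] [InnerProductSpace ℝ H] [CompleteSpace H]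
  [NormedAddCommGroup K] [InnerProductSpace ℝ K] [CompleteSpace K] {A : Type*}

/-- The form `½ (W u, W v)` of the closed operator `W` with graph `M`. -/
def ofGraph (M : Submodule ℝ (H × K)) (hM : IsClosed (M : Set (H × K)))
    (h0 : ∀ x ∈ M, x.1 = 0 → x.2 = 0) : ClosedForm H where
  dom := M.toLinearPMap.domain
  form := ((1 / 2 : ℝ) • innerₗ K).compl₁₂ M.toLinearPMap.toFun M.toLinearPMap.toFun
  symm u v := by simp [real_inner_comm]
  nonneg u := by simp
  closed u hu hW := by
    let W := M.toLinearPMap.toFun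
    have hg : ∀ x : M.toLinearPMap.domain, ((x : H), W x) ∈ M := fun x =>
      Submodule.mem_graph_toLinearPMap h0 x
    have hc : CauchySeq fun n => W (u n) := by
      rw [Metric.cauchySeq_iff]
      intro ε hε
      obtain ⟨N, hN⟩ := hW (ε ^ 2 / 2) (by positivity)
      refine ⟨N, fun m hm n hn => ?_⟩
      have h1 := hN m hm n hn
      simp only [LinearMap.compl₁₂_apply, LinearMap.smul_apply, innerₗ_apply_apply, smul_eq_mul] at h1
      rw [real_inner_self_eq_norm_sq, map_sub] at h1
      rw [dist_eq_norm]
      exact lt_of_pow_lt_pow_left₀ 2 hε.le (by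
        change 1 / 2 * ‖W (u m) - W (u n)‖ ^ 2 < _ at h1
        linarith)
    obtain ⟨x, hx⟩ := cauchySeq_tendsto_of_complete hu
    obtain ⟨y, hy⟩ := cauchySeq_tendsto_of_complete hc
    have hxy : (x, y) ∈ M :=
      hM.mem_of_tendsto (hx.prodMk_nhds hy) (Eventually.of_forall fun n => hg (u n))
    have hxd : x ∈ M.toLinearPMap.domain := Submodule.mem_map.2 ⟨(x, y), hxy, rfl⟩
    have hWx : W ⟨x, hxd⟩ = y := by
      -- Two graph points over the same `x` differ by a point over zero, so `h0` makes the second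
      -- coordinate unique.
      have h1 := M.sub_mem (hg ⟨x, hxd⟩) hxy
      exact sub_eq_zero.1 (h0 _ h1 (sub_self x))
    refine ⟨⟨x, hxd⟩, hx, ?_⟩
    have h2 := ((tendsto_iff_norm_sub_tendsto_zero.1 hy).pow 2).const_mul (1 / 2 : ℝ)
    simp only [ne_eq, OfNat.ofNat_ne_zero, not_false_eq_true, zero_pow, mul_zero] at h2
    refine h2.congr fun n => ?_
    simp only [LinearMap.compl₁₂_apply, LinearMap.smul_apply, innerₗ_apply_apply, smul_eq_mul]
    rw [real_inner_self_eq_norm_sq, map_sub]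
    change _ = 1 / 2 * ‖W (u n) - W ⟨x, hxd⟩‖ ^ 2
    rw [hWx]

variable {M : Submodule ℝ (H × K)} {hM : IsClosed (M : Set (H × K))}
  {h0 : ∀ x ∈ M, x.1 = 0 → x.2 = 0}

theorem mem_dom_ofGraph {u : H} {w : K} (h : (u, w) ∈ M) : u ∈ (ofGraph M hM h0).dom :=
  Submodule.mem_map.2 ⟨(u, w), h, rfl⟩

theorem exists_of_mem_dom_ofGraph (u : (ofGraph M hM h0).dom) : ∃ w, ((u : H), w) ∈ M :=
  ⟨_, Submodule.mem_graph_toLinearPMap h0 u⟩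

theorem ofGraph_form {u v : (ofGraph M hM h0).dom} {w x : K} (hu : ((u : H), w) ∈ M)
    (hv : ((v : H), x) ∈ M) : (ofGraph M hM h0).form u v = 1 / 2 * inner ℝ w x := by
  have key : ∀ (z : (ofGraph M hM h0).dom) (y : K), ((z : H), y) ∈ M →
      M.toLinearPMap.toFun z = y := by
    intro z y hz
    have h1 := M.sub_mem (Submodule.mem_graph_toLinearPMap h0 z) hz
    exact sub_eq_zero.1 (h0 _ h1 (sub_self (z : H)))
  change 1 / 2 * inner ℝ (M.toLinearPMap.toFun u) (M.toLinearPMap.toFun v) = _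
  rw [key u w hu, key v x hv]

variable {ι : A → H} {δ : A → K} {e : A → A → ℝ} {Γ : Submodule ℝ (H × K)} {s : Set A}

theorem isClosureOf_ofGraph (he : ∀ a b, e a b = 1 / 2 * inner ℝ (δ a) (δ b))
    (hΓ : ∀ m, m ∈ Γ ↔ ∃ a ∈ s, m = (ι a, δ a))
    (h0 : ∀ x ∈ Γ.topologicalClosure, x.1 = 0 → x.2 = 0) :
    (ofGraph Γ.topologicalClosure Γ.isClosed_topologicalClosure h0).IsClosureOf ι e s := by
  have hmem : ∀ a ∈ s, (ι a, δ a) ∈ Γ.topologicalClosure := fun a ha =>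
    Γ.le_topologicalClosure ((hΓ _).2 ⟨a, ha, rfl⟩)
  refine ⟨⟨fun a ha => mem_dom_ofGraph (hmem a ha), fun a ha b hb => ?_⟩, fun u => ?_⟩
  · rw [he]
    exact ofGraph_form (hmem a ha) (hmem b hb)
  · obtain ⟨w, hw⟩ := exists_of_mem_dom_ofGraph u
    obtain ⟨m, hm, hlim⟩ := mem_closure_iff_seq_limit.1
      (show ((u : H), w) ∈ closure (Γ : Set (H × K)) from hw)
    choose a ha hma using fun n => (hΓ _).1 (hm n)
    have h1 := ((continuous_fst.tendsto _).comp hlim)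
    have h2 := ((continuous_snd.tendsto _).comp hlim)
    simp only [Function.comp_def, hma] at h1 h2
    refine ⟨a, fun n => ⟨ι (a n), mem_dom_ofGraph (hmem _ (ha n))⟩, fun n => ⟨ha n, rfl⟩, h1, ?_⟩
    have h3 := ((tendsto_iff_norm_sub_tendsto_zero.1 h2).pow 2).const_mul (1 / 2 : ℝ)
    simp only [ne_eq, OfNat.ofNat_ne_zero, not_false_eq_true, zero_pow, mul_zero] at h3
    refine h3.congr fun n => ?_
    rw [← real_inner_self_eq_norm_sq]
    exact (ofGraph_form (Submodule.sub_mem _ (hmem _ (ha n)) hw)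
      (Submodule.sub_mem _ (hmem _ (ha n)) hw)).symm

/-- Any closed minorant `R` is dominated by the energy of a graph-convergent sequence and of its
differences. Closedness of `R` then gives membership of the limit and the inequality there, so the
closure is the greatest minorant. -/
theorem isRelaxationOf_ofGraph (he : ∀ a b, e a b = 1 / 2 * inner ℝ (δ a) (δ b))
    (hΓ : ∀ m, m ∈ Γ ↔ ∃ a, m = (ι a, δ a))
    (h0 : ∀ x ∈ Γ.topologicalClosure, x.1 = 0 → x.2 = 0) :
    (ofGraph Γ.topologicalClosure Γ.isClosed_topologicalClosure h0).IsRelaxationOf ι e := by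
  have hmem : ∀ a, (ι a, δ a) ∈ Γ.topologicalClosure := fun a =>
    Γ.le_topologicalClosure ((hΓ _).2 ⟨a, rfl⟩)
  refine ⟨fun a => ⟨mem_dom_ofGraph (hmem a), ?_⟩, fun R hR u => ?_⟩
  · rw [he, ofGraph_form (hmem a) (hmem a)]
  · obtain ⟨w, hw⟩ := exists_of_mem_dom_ofGraph u
    obtain ⟨m, hm, hlim⟩ := mem_closure_iff_seq_limit.1
      (show ((u : H), w) ∈ closure (Γ : Set (H × K)) from hw)
    choose a hma using fun n => (hΓ _).1 (hm n)
    have h1 := ((continuous_fst.tendsto _).comp hlim)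
    have h2 := ((continuous_snd.tendsto _).comp hlim)
    simp only [Function.comp_def, hma] at h1 h2
    choose hRd hRe using hR
    have hRself : ∀ n, R.form ⟨_, hRd (a n)⟩ ⟨_, hRd (a n)⟩ ≤ 1 / 2 * ‖δ (a n)‖ ^ 2 := fun n => by
      rw [← real_inner_self_eq_norm_sq, ← he]
      exact hRe (a n)
    have hRdiff : ∀ i j, R.form (⟨_, hRd (a i)⟩ - ⟨_, hRd (a j)⟩)
        (⟨_, hRd (a i)⟩ - ⟨_, hRd (a j)⟩) ≤ 1 / 2 * ‖δ (a i) - δ (a j)‖ ^ 2 := by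
      intro i j
      -- The minorant is controlled only at the given elements; linearity of `Γ` realizes the
      -- difference as one of them.
      obtain ⟨b, hb⟩ := (hΓ _).1 (Γ.sub_mem ((hΓ _).2 ⟨a i, rfl⟩) ((hΓ _).2 ⟨a j, rfl⟩))
      rw [Prod.mk_sub_mk, Prod.mk.injEq] at hb
      have h3 : (⟨_, hRd (a i)⟩ - ⟨_, hRd (a j)⟩ : R.dom) = ⟨_, hRd b⟩ := Subtype.ext hb.1
      rw [h3, hb.2, ← real_inner_self_eq_norm_sq, ← he]
      exact hRe b
    obtain ⟨x, hx1, hx2⟩ := R.closed (fun n => ⟨_, hRd (a n)⟩) h1.cauchySeq (by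
      intro ε hε
      obtain ⟨N, hN⟩ := Metric.cauchySeq_iff.1 h2.cauchySeq (Real.sqrt ε) (Real.sqrt_pos.2 hε)
      refine ⟨N, fun i hi j hj => (hRdiff i j).trans_lt ?_⟩
      have h3 := hN i hi j hj
      rw [dist_eq_norm, Real.lt_sqrt (norm_nonneg _)] at h3
      linarith)
    have hxu : (x : H) = u := tendsto_nhds_unique hx1 h1
    have hmemR : (u : H) ∈ R.dom := hxu ▸ x.2
    obtain rfl : x = ⟨u, hmemR⟩ := Subtype.ext hxu
    refine ⟨hmemR, ?_⟩
    rw [ofGraph_form hw hw, real_inner_self_eq_norm_sq]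
    exact le_of_tendsto_of_tendsto' (R.tendsto_form_self hx1 hx2)
      ((h2.norm.pow 2).const_mul (1 / 2)) hRself

theorem tendsto_resolvent_ofGraph {Γn : ℕ → Submodule ℝ (H × K)} (hle : ∀ n, Γn n ≤ Γ)
    (happ : ∀ m ∈ Γ, ∃ x : ℕ → H × K, (∀ n, x n ∈ Γn n) ∧ Tendsto x atTop (𝓝 m))
    (h0 : ∀ x ∈ Γ.topologicalClosure, x.1 = 0 → x.2 = 0)
    (h0n : ∀ n, ∀ x ∈ (Γn n).topologicalClosure, x.1 = 0 → x.2 = 0) (f : H) :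
    Tendsto (fun n => (ofGraph _ (Γn n).isClosed_topologicalClosure (h0n n)).resolvent f) atTop
      (𝓝 ((ofGraph _ Γ.isClosed_topologicalClosure h0).resolvent f)) := by
  have hlecl : ∀ n, (Γn n).topologicalClosure ≤ Γ.topologicalClosure := fun n =>
    Submodule.topologicalClosure_mono (hle n)
  -- Working with the distance to `Γn n` extends the approximation property from `Γ` to its closure
  -- without a diagonal choice.
  have hdist : ∀ m ∈ Γ.topologicalClosure,
      Tendsto (fun n => Metric.infDist m (Γn n : Set (H × K))) atTop (𝓝 0) := by
    intro m hm
    rw [Metric.tendsto_nhds]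
    intro ε hε
    obtain ⟨g, hg, hmg⟩ := Metric.mem_closure_iff.1
      (show m ∈ closure (Γ : Set (H × K)) from hm) (ε / 2) (by positivity)
    obtain ⟨x, hx, hlim⟩ := happ g hg
    filter_upwards [Metric.tendsto_nhds.1 hlim (ε / 2) (by positivity)] with n hn
    rw [Real.dist_0_eq_abs, abs_of_nonneg Metric.infDist_nonneg]
    refine (Metric.infDist_le_dist_of_mem (hx n)).trans_lt ?_
    rw [dist_comm] at hn
    linarith [dist_triangle m g (x n)]
  refine tendsto_resolvent (fun n u => ?_) (fun u => ?_) f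
  · obtain ⟨w, hw⟩ := exists_of_mem_dom_ofGraph u
    refine ⟨mem_dom_ofGraph (hlecl n hw), fun v hv => ?_⟩
    obtain ⟨x, hx⟩ := exists_of_mem_dom_ofGraph v
    rw [ofGraph_form hw hx]
    exact (ofGraph_form (hlecl n hw) (hlecl n hx)).symm
  · obtain ⟨w, hw⟩ := exists_of_mem_dom_ofGraph u
    -- The infimum need not be attained on a non-closed subspace, hence the slack `1/(n+1)`.
    have h1 : ∀ n : ℕ, ∃ y ∈ (Γn n : Set (H × K)), dist ((u : H), w) y <
        Metric.infDist ((u : H), w) (Γn n : Set (H × K)) + 1 / ((n : ℝ) + 1) := fun n =>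
      (Metric.infDist_lt_iff ⟨0, (Γn n).zero_mem⟩).1 (lt_add_of_pos_right _ (by positivity))
    choose y hy hyd using h1
    have h2 : Tendsto y atTop (𝓝 ((u : H), w)) := by
      rw [tendsto_iff_dist_tendsto_zero]
      have h3 : ∀ n, dist (y n) ((u : H), w) ≤
          Metric.infDist ((u : H), w) (Γn n : Set (H × K)) + 1 / ((n : ℝ) + 1) := fun n => by
        rw [dist_comm]; exact (hyd n).le
      refine squeeze_zero (fun _ => dist_nonneg) h3 ?_
      simpa using (hdist _ hw).add (tendsto_one_div_add_atTop_nhds_zero_nat (𝕜 := ℝ))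
    have hyn : ∀ n, ((y n).1, (y n).2) ∈ (Γn n).topologicalClosure := fun n =>
      (Γn n).le_topologicalClosure (hy n)
    have h3 := ((continuous_fst.tendsto _).comp h2)
    have h4 := ((continuous_snd.tendsto _).comp h2)
    refine ⟨fun n => ⟨(y n).1, mem_dom_ofGraph (hlecl n (hyn n))⟩,
      fun n => mem_dom_ofGraph (hyn n), h3, ?_⟩
    have h5 := ((tendsto_iff_norm_sub_tendsto_zero.1 h4).pow 2).const_mul (1 / 2 : ℝ)
    simp only [ne_eq, OfNat.ofNat_ne_zero, not_false_eq_true, zero_pow, mul_zero] at h5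
    refine h5.congr fun n => ?_
    rw [← real_inner_self_eq_norm_sq]
    exact (ofGraph_form (Submodule.sub_mem _ (hlecl n (hyn n)) hw)
      (Submodule.sub_mem _ (hlecl n (hyn n)) hw)).symm

end Graph

end ClosedForm

end

end TwoParam

namespace TwoParam

noncomputable section

/-! ### The gradient of cylinder functions -/

variable {S : Type*} [MeasurableSpace S]

/-- The kernel `μ ↦ μ`. -/
def evalKernel (S : Type*) [MeasurableSpace S] : Kernel (ProbabilityMeasure S) S :=
  ⟨fun μ => (μ : Measure S), measurable_subtype_coe⟩

instance : IsMarkovKernel (evalKernel S) := ⟨fun μ => μ.2⟩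

theorem evalKernel_apply (μ : ProbabilityMeasure S) : evalKernel S μ = (μ : Measure S) := rfl

/-- The law of `(μ, x)`, where `μ` has law `P` and `x` has law `μ` given `μ`. -/
abbrev pairLaw (P : Measure (ProbabilityMeasure S)) : Measure (ProbabilityMeasure S × S) :=
  P.compProd (evalKernel S)

namespace Cyl

theorem integrable_φ (F : Cyl S) (μ : ProbabilityMeasure S) (i : Fin F.d) :
    Integrable (F.φ i) (μ : Measure S) := by
  obtain ⟨C, hC⟩ := F.bounded_φ i
  exact Integrable.of_bound (F.measurable_φ i).aestronglyMeasurable C (Eventually.of_forall hC)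

theorem abs_coords_le (F : Cyl S) {i : Fin F.d} {C : ℝ} (hC : ∀ x, |F.φ i x| ≤ C)
    (μ : ProbabilityMeasure S) : |F.coords μ i| ≤ C := by
  have h := norm_integral_le_of_norm_le_const (μ := (μ : Measure S)) (f := F.φ i) (C := C)
    (Eventually.of_forall fun x => hC x)
  simpa [coords] using h

theorem measurable_eval (F : Cyl S) : Measurable F.eval :=
  F.smooth_f.continuous.measurable.comp F.measurable_coords

/-- The derivative of `F` at `μ` in the direction `δₓ - μ`. -/
def dir (F : Cyl S) (p : ProbabilityMeasure S × S) : ℝ :=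
  fderiv ℝ F.f (F.coords p.1) (fun i => F.φ i p.2 - F.coords p.1 i)

theorem continuous_fderiv_apply (F : Cyl S) :
    Continuous fun q : (Fin F.d → ℝ) × (Fin F.d → ℝ) => fderiv ℝ F.f q.1 q.2 :=
  F.smooth_f.continuous_fderiv_apply (by simp)

theorem differentiable_f (F : Cyl S) : Differentiable ℝ F.f :=
  F.smooth_f.differentiable (by simp)

theorem measurable_dir (F : Cyl S) : Measurable F.dir := by
  have h : Measurable fun p : ProbabilityMeasure S × S =>
      (F.coords p.1, fun i => F.φ i p.2 - F.coords p.1 i) := by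
    refine (F.measurable_coords.comp measurable_fst).prodMk (measurable_pi_iff.2 fun i => ?_)
    exact ((F.measurable_φ i).comp measurable_snd).sub
      ((measurable_pi_iff.1 F.measurable_coords i).comp measurable_fst)
  exact F.continuous_fderiv_apply.measurable.comp h

theorem dir_of_hasFDerivAt (F : Cyl S) (p : ProbabilityMeasure S × S)
    {L : (Fin F.d → ℝ) →L[ℝ] ℝ} (h : HasFDerivAt F.f L (F.coords p.1)) :
    F.dir p = L fun i => F.φ i p.2 - F.coords p.1 i := by
  rw [dir, h.fderiv]

theorem exists_bound_dir (F : Cyl S) : ∃ M, ∀ p, |F.dir p| ≤ M := by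
  choose C hC using F.bounded_φ
  have hK : IsCompact ((Set.univ.pi fun i => Set.Icc (-(C i)) (C i)) ×ˢ
      (Set.univ.pi fun i => Set.Icc (-(2 * C i)) (2 * C i))) :=
    (isCompact_univ_pi fun i => isCompact_Icc).prod (isCompact_univ_pi fun i => isCompact_Icc)
  obtain ⟨M, hM⟩ := hK.exists_bound_of_continuousOn F.continuous_fderiv_apply.continuousOn
  refine ⟨M, fun p => hM (F.coords p.1, _) ⟨fun i _ => ?_, fun i _ => ?_⟩⟩
  · exact abs_le.1 (F.abs_coords_le (hC i) p.1)
  · have h1 := abs_le.1 (F.abs_coords_le (hC i) p.1)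
    have h2 := abs_le.1 (hC i p.2)
    constructor <;> simp only <;> linarith

theorem memLp_dir (F : Cyl S) (P : Measure (ProbabilityMeasure S)) [IsFiniteMeasure P] :
    MemLp F.dir 2 (pairLaw P) := by
  obtain ⟨M, hM⟩ := F.exists_bound_dir
  exact MemLp.of_bound F.measurable_dir.aestronglyMeasurable M (Eventually.of_forall hM)

/-- The class of `F.dir` in `L²`. -/
def dirL2 (P : Measure (ProbabilityMeasure S)) [IsFiniteMeasure P] (F : Cyl S) :
    Lp ℝ 2 (pairLaw P) :=
  (F.memLp_dir P).toLp F.dir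

theorem grad_eq (F : Cyl S) (μ : ProbabilityMeasure S) (x : S) :
    F.grad μ x = fderiv ℝ F.f (F.coords μ) (fun i => F.φ i x) := by
  rw [← ContinuousLinearMap.coe_coe, LinearMap.pi_apply_eq_sum_univ, grad]
  refine Finset.sum_congr rfl fun i _ => ?_
  rw [smul_eq_mul, mul_comm, ContinuousLinearMap.coe_coe]
  congr 2
  ext j
  simp [Pi.single_apply, eq_comm]

theorem integrable_grad (F : Cyl S) (μ : ProbabilityMeasure S) :
    Integrable (F.grad μ) (μ : Measure S) :=
  integrable_finsetSum _ fun i _ => (F.integrable_φ μ i).const_mul _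

theorem integral_grad (F : Cyl S) (μ : ProbabilityMeasure S) :
    ∫ x, F.grad μ x ∂(μ : Measure S) = fderiv ℝ F.f (F.coords μ) (F.coords μ) := by
  unfold grad
  rw [integral_finsetSum _ fun i _ => (F.integrable_φ μ i).const_mul _]
  conv_rhs => rw [← ContinuousLinearMap.coe_coe, LinearMap.pi_apply_eq_sum_univ]
  refine Finset.sum_congr rfl fun i _ => ?_
  rw [integral_const_mul, smul_eq_mul, mul_comm, ContinuousLinearMap.coe_coe]
  congr 2
  ext j
  simp [Pi.single_apply, eq_comm]

theorem dir_eq (F : Cyl S) (μ : ProbabilityMeasure S) (x : S) :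
    F.dir (μ, x) = F.grad μ x - ∫ y, F.grad μ y ∂(μ : Measure S) := by
  rw [integral_grad, grad_eq, ← map_sub]
  rfl

theorem cov_grad (F G : Cyl S) (μ : ProbabilityMeasure S) :
    cov μ (F.grad μ) (G.grad μ) = ∫ x, F.dir (μ, x) * G.dir (μ, x) ∂(μ : Measure S) := by
  have hb : ∀ E : Cyl S, ∃ M, ∀ x, ‖E.grad μ x‖ ≤ M := fun E => by
    obtain ⟨M, hM⟩ := E.exists_bound_dir
    refine ⟨M + |∫ y, E.grad μ y ∂(μ : Measure S)|, fun x => ?_⟩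
    have h1 : E.grad μ x = E.dir (μ, x) + ∫ y, E.grad μ y ∂(μ : Measure S) := by
      rw [dir_eq]; ring
    rw [h1, Real.norm_eq_abs]
    exact (abs_add_le _ _).trans (by linarith [hM (μ, x)])
  obtain ⟨M, hM⟩ := hb F
  have hFG : Integrable (fun x => F.grad μ x * G.grad μ x) (μ : Measure S) :=
    (G.integrable_grad μ).bdd_mul (F.integrable_grad μ).aestronglyMeasurable
      (Eventually.of_forall hM)
  simp only [dir_eq]
  set a := ∫ y, F.grad μ y ∂(μ : Measure S)
  set b := ∫ y, G.grad μ y ∂(μ : Measure S)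
  have h1 : ∀ x, (F.grad μ x - a) * (G.grad μ x - b) =
      F.grad μ x * G.grad μ x - b * F.grad μ x - (a * G.grad μ x - a * b) := fun x => by ring
  simp_rw [h1]
  rw [integral_sub, integral_sub, integral_sub, integral_const_mul, integral_const_mul]
  · simp [cov, a, b]
    ring
  · exact (G.integrable_grad μ).const_mul _
  · exact integrable_const _
  · exact hFG
  · exact (F.integrable_grad μ).const_mul _
  · exact hFG.sub ((F.integrable_grad μ).const_mul _)
  · exact ((G.integrable_grad μ).const_mul _).sub (integrable_const _)

/-- Disintegration of `pairLaw` turns the averaged covariance into an inner product, so the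
Hilbert-space results on graphs apply to the energy. -/
theorem energy_eq (P : Measure (ProbabilityMeasure S)) [IsFiniteMeasure P] (F G : Cyl S) :
    energy P F G = 1 / 2 * inner ℝ (F.dirL2 P) (G.dirL2 P) := by
  have h1 : inner ℝ (F.dirL2 P) (G.dirL2 P) = ∫ p, F.dir p * G.dir p ∂(pairLaw P) := by
    rw [L2.inner_def]
    refine integral_congr_ae ?_
    filter_upwards [(F.memLp_dir P).coeFn_toLp, (G.memLp_dir P).coeFn_toLp] with p hF hG
    simp only [dirL2, hF, hG]
    simp [mul_comm]
  have h2 : Integrable (fun p => F.dir p * G.dir p) (pairLaw P) :=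
    (F.memLp_dir P).integrable_mul (G.memLp_dir P)
  rw [h1, Measure.integral_compProd h2, energy]
  simp_rw [cov_grad, evalKernel_apply]

/-! ### Linear operations on cylinder functions -/

/-- The sum of two cylinder functions. -/
def add (F G : Cyl S) : Cyl S where
  d := F.d + G.d
  φ := Fin.append F.φ G.φ
  measurable_φ := Fin.addCases (by simpa using F.measurable_φ) (by simpa using G.measurable_φ)
  bounded_φ := Fin.addCases (by simpa using F.bounded_φ) (by simpa using G.bounded_φ)
  f := fun x => F.f (fun i => x (Fin.castAdd _ i)) + G.f (fun i => x (Fin.natAdd _ i))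
  smooth_f := by
    have hF := F.smooth_f
    have hG := G.smooth_f
    fun_prop

/-- A multiple of a cylinder function. -/
def smul (c : ℝ) (F : Cyl S) : Cyl S where
  d := F.d
  φ := F.φ
  measurable_φ := F.measurable_φ
  bounded_φ := F.bounded_φ
  f := fun x => c * F.f x
  smooth_f := contDiff_const.mul F.smooth_f

theorem eval_add (F G : Cyl S) (μ : ProbabilityMeasure S) :
    (F.add G).eval μ = F.eval μ + G.eval μ := by
  simp [eval, add, coords]
  rfl

theorem eval_smul (c : ℝ) (F : Cyl S) (μ : ProbabilityMeasure S) :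
    (F.smul c).eval μ = c * F.eval μ := rfl

theorem dir_smul (c : ℝ) (F : Cyl S) (p : ProbabilityMeasure S × S) :
    (F.smul c).dir p = c * F.dir p := by
  have h : HasFDerivAt (fun x => c * F.f x) (c • fderiv ℝ F.f (F.coords p.1)) (F.coords p.1) :=
    (F.differentiable_f _).hasFDerivAt.const_mul c
  exact (F.smul c).dir_of_hasFDerivAt p h

theorem dir_add (F G : Cyl S) (p : ProbabilityMeasure S × S) :
    (F.add G).dir p = F.dir p + G.dir p := by
  let L₁ : (Fin (F.d + G.d) → ℝ) →L[ℝ] (Fin F.d → ℝ) :=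
    ContinuousLinearMap.pi fun i => ContinuousLinearMap.proj (Fin.castAdd _ i)
  let L₂ : (Fin (F.d + G.d) → ℝ) →L[ℝ] (Fin G.d → ℝ) :=
    ContinuousLinearMap.pi fun i => ContinuousLinearMap.proj (Fin.natAdd _ i)
  have h1 : ∀ x, HasFDerivAt (fun x => F.f (L₁ x) + G.f (L₂ x))
      ((fderiv ℝ F.f (L₁ x)).comp L₁ + (fderiv ℝ G.f (L₂ x)).comp L₂) x := fun x =>
    ((F.differentiable_f _).hasFDerivAt.comp x L₁.hasFDerivAt).add
      ((G.differentiable_f _).hasFDerivAt.comp x L₂.hasFDerivAt)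
  have h2 : L₁ ((F.add G).coords p.1) = F.coords p.1 := by
    ext i
    simp [L₁, coords, add]
  have h3 : L₂ ((F.add G).coords p.1) = G.coords p.1 := by
    ext i
    simp [L₂, coords, add]
  have h4 := (F.add G).dir_of_hasFDerivAt p (h1 ((F.add G).coords p.1))
  refine h4.trans ?_
  change fderiv ℝ F.f (L₁ ((F.add G).coords p.1)) (L₁ fun i => _) +
    fderiv ℝ G.f (L₂ ((F.add G).coords p.1)) (L₂ fun i => _) = _
  rw [h2, h3, dir, dir]
  congr 2
  · ext i
    simp [L₁, coords, add]
  · ext i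
    simp [L₂, coords, add]

/-- A class of cylinder functions which is closed under linear operations, as far as the values and
the gradients are concerned. -/
structure IsLinearClass (s : Set (Cyl S)) : Prop where
  nonempty : s.Nonempty
  add : ∀ F ∈ s, ∀ G ∈ s, ∃ E ∈ s, E.eval = F.eval + G.eval ∧ E.dir = F.dir + G.dir
  smul : ∀ (c : ℝ), ∀ F ∈ s, ∃ E ∈ s, E.eval = c • F.eval ∧ E.dir = c • F.dir

instance : Nonempty (Cyl S) :=
  ⟨⟨0, fun i => i.elim0, fun i => i.elim0, fun i => i.elim0, fun _ => 0, contDiff_const⟩⟩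

theorem isLinearClass_univ : IsLinearClass (Set.univ : Set (Cyl S)) where
  nonempty := Set.univ_nonempty
  add F _ G _ := ⟨F.add G, Set.mem_univ _, funext (eval_add F G), funext (dir_add F G)⟩
  smul c F _ := ⟨F.smul c, Set.mem_univ _, funext (eval_smul c F), funext (dir_smul c F)⟩

/-- The graph of the gradient on a linear class of cylinder functions. -/
def graph (P : Measure (ProbabilityMeasure S)) [IsFiniteMeasure P] {s : Set (Cyl S)}
    (hs : IsLinearClass s) : Submodule ℝ (Lp ℝ 2 P × Lp ℝ 2 (pairLaw P)) where
  carrier := {m | ∃ F ∈ s, m = (toL2 P F, dirL2 P F)}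
  add_mem' := by
    rintro _ _ ⟨F, hF, rfl⟩ ⟨G, hG, rfl⟩
    obtain ⟨E, hE, h1, h2⟩ := hs.add F hF G hG
    refine ⟨E, hE, ?_⟩
    simp only [toL2, dirL2, h1, h2, Prod.mk_add_mk]
    rfl
  zero_mem' := by
    obtain ⟨F, hF⟩ := hs.nonempty
    obtain ⟨E, hE, h1, h2⟩ := hs.smul 0 F hF
    refine ⟨E, hE, ?_⟩
    simp only [toL2, dirL2, h1, h2, zero_smul]
    rfl
  smul_mem' := by
    rintro c _ ⟨F, hF, rfl⟩
    obtain ⟨E, hE, h1, h2⟩ := hs.smul c F hF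
    refine ⟨E, hE, ?_⟩
    simp only [toL2, dirL2, h1, h2, Prod.smul_mk]
    rfl

theorem mem_graph {P : Measure (ProbabilityMeasure S)} [IsFiniteMeasure P] {s : Set (Cyl S)}
    {hs : IsLinearClass s} {m : Lp ℝ 2 P × Lp ℝ 2 (pairLaw P)} :
    m ∈ graph P hs ↔ ∃ F ∈ s, m = (toL2 P F, dirL2 P F) := Iff.rfl

end Cyl

/-! ### The projection classes -/

namespace DyadicPartition

variable {ν₀ : Measure S} (D : DyadicPartition ν₀)

theorem isLinearClass_cylSet (k : ℕ) : Cyl.IsLinearClass (D.cylSet k) where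
  nonempty := ⟨_, fun _ => 0, contDiff_const, rfl⟩
  add := by
    rintro _ ⟨f, hf, rfl⟩ _ ⟨g, hg, rfl⟩
    refine ⟨_, ⟨fun x => f x + g x, hf.add hg, rfl⟩, rfl, ?_⟩
    funext p
    exact Cyl.dir_of_hasFDerivAt (D.cyl k _ (hf.add hg)) p
      ((hf.differentiable (by simp) ((D.cyl k f hf).coords p.1)).hasFDerivAt.add
        (hg.differentiable (by simp) ((D.cyl k f hf).coords p.1)).hasFDerivAt)
  smul := by
    rintro c _ ⟨f, hf, rfl⟩
    refine ⟨_, ⟨fun x => c * f x, contDiff_const.mul hf, rfl⟩, rfl, ?_⟩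
    funext p
    exact Cyl.dir_of_hasFDerivAt (D.cyl k _ (contDiff_const.mul hf)) p
      ((hf.differentiable (by simp) ((D.cyl k f hf).coords p.1)).hasFDerivAt.const_mul c)

end DyadicPartition

end

end TwoParam

namespace TwoParam

noncomputable section

variable {S : Type*} [MeasurableSpace S]

/-! ### Purely atomic random measures -/

/-- The measure `∑ₖ pₖ δ_{ξₖ}`. -/
def atomSum (q : (ℕ → ℝ) × (ℕ → S)) : Measure S :=
  Measure.sum fun k => ENNReal.ofReal (q.1 k) • Measure.dirac (q.2 k)

open Classical in
/-- The measure `∑ₖ pₖ δ_{ξₖ}` if it is a probability measure, and `δ_{ξ₀}` otherwise. -/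
def toProb (q : (ℕ → ℝ) × (ℕ → S)) : ProbabilityMeasure S :=
  if h : IsProbabilityMeasure (atomSum q) then ⟨atomSum q, h⟩
  else ⟨Measure.dirac (q.2 0), inferInstance⟩

theorem toProb_pos {q : (ℕ → ℝ) × (ℕ → S)} (h : IsProbabilityMeasure (atomSum q)) :
    toProb q = ⟨atomSum q, h⟩ := dif_pos h

theorem toProb_neg {q : (ℕ → ℝ) × (ℕ → S)} (h : ¬IsProbabilityMeasure (atomSum q)) :
    toProb q = ⟨Measure.dirac (q.2 0), inferInstance⟩ := dif_neg h

theorem randomMeasure_eq (z : (ℕ → ℝ) × (ℕ → S)) :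
    randomMeasure z = toProb (ranked (stick z.1), z.2) := rfl

theorem measurable_atomSum : Measurable (atomSum (S := S)) := by
  refine Measure.measurable_of_measurable_coe _ fun A hA => ?_
  have h1 : ∀ q : (ℕ → ℝ) × (ℕ → S), atomSum q A =
      ∑' k, ENNReal.ofReal (q.1 k) * A.indicator 1 (q.2 k) := fun q => by
    rw [atomSum, Measure.sum_apply _ hA]
    simp [Measure.dirac_apply' _ hA]
  simp_rw [h1]
  refine Measurable.tsum fun k => Measurable.mul ?_ ?_
  · exact ((measurable_pi_apply k).comp measurable_fst).ennreal_ofReal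
  · exact (measurable_one.indicator hA).comp ((measurable_pi_apply k).comp measurable_snd)

theorem measurable_toProb : Measurable (toProb (S := S)) := by
  classical
  have h1 : Measurable fun q : (ℕ → ℝ) × (ℕ → S) => (toProb q : Measure S) := by
    have h2 : (fun q : (ℕ → ℝ) × (ℕ → S) => (toProb q : Measure S)) = fun q =>
        if atomSum q Set.univ = 1 then atomSum q else Measure.dirac (q.2 0) := by
      funext q
      by_cases h : atomSum q Set.univ = 1
      · rw [toProb_pos ⟨h⟩, if_pos h]
        rfl
      · rw [toProb_neg fun h' => h h'.measure_univ, if_neg h]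
        rfl
    rw [h2]
    refine Measurable.ite ?_ measurable_atomSum ?_
    · exact (Measure.measurable_coe MeasurableSet.univ).comp measurable_atomSum
        (measurableSet_singleton 1)
    · exact Measure.measurable_dirac.comp ((measurable_pi_apply 0).comp measurable_snd)
  exact h1.subtype_mk (h := fun q => (toProb q).2)

theorem isProbabilityMeasure_atomSum {q : (ℕ → ℝ) × (ℕ → S)} (h0 : ∀ i, 0 ≤ q.1 i)
    (h1 : HasSum q.1 1) : IsProbabilityMeasure (atomSum q) := by
  constructor
  rw [atomSum, Measure.sum_apply _ MeasurableSet.univ]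
  simp only [Measure.smul_apply, measure_univ, smul_eq_mul, mul_one]
  rw [← ENNReal.ofReal_tsum_of_nonneg h0 h1.summable, h1.tsum_eq, ENNReal.ofReal_one]

theorem coe_toProb {q : (ℕ → ℝ) × (ℕ → S)} (h : IsProbabilityMeasure (atomSum q)) :
    (toProb q : Measure S) = atomSum q := by
  rw [toProb_pos h]
  rfl

/-! ### Stick breaking -/

theorem sum_stick (U : ℕ → ℝ) (n : ℕ) :
    ∑ i ∈ Finset.range n, stick U i = 1 - ∏ i ∈ Finset.range n, (1 - U i) := by
  induction n with
  | zero => simp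
  | succ n ih =>
    rw [Finset.sum_range_succ, ih, Finset.prod_range_succ, stick]
    ring

/-- The sequences of sticks in `(0, 1)` which use up the whole unit. -/
def goodSticks : Set (ℕ → ℝ) :=
  {U | (∀ i, U i ∈ Set.Ioo (0 : ℝ) 1) ∧
    Tendsto (fun n => ∏ i ∈ Finset.range n, (1 - U i)) atTop (𝓝 0)}

theorem stick_pos {U : ℕ → ℝ} (hU : U ∈ goodSticks) (i : ℕ) : 0 < stick U i :=
  mul_pos (hU.1 i).1 (Finset.prod_pos fun j _ => sub_pos.2 (hU.1 j).2)

theorem hasSum_stick {U : ℕ → ℝ} (hU : U ∈ goodSticks) : HasSum (stick U) 1 := by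
  rw [hasSum_iff_tendsto_nat_of_nonneg fun i => (stick_pos hU i).le]
  simp_rw [sum_stick]
  simpa using hU.2.const_sub 1

/-- Beyond index `i` the partial products only change by the constant factor `(1 - u)/(1 - Uᵢ)`. -/
theorem update_mem_goodSticks {U : ℕ → ℝ} (hU : U ∈ goodSticks) (i : ℕ) {u : ℝ}
    (hu : u ∈ Set.Ioo (0 : ℝ) 1) : Function.update U i u ∈ goodSticks := by
  refine ⟨fun j => ?_, ?_⟩
  · rcases eq_or_ne j i with rfl | h
    · simpa using hu
    · simpa [h] using hU.1 j
  · have h1 := hU.2.const_mul ((1 - u) / (1 - U i))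
    rw [mul_zero] at h1
    refine h1.congr' ?_
    filter_upwards [eventually_gt_atTop i] with n hn
    have hi : i ∈ Finset.range n := Finset.mem_range.2 hn
    rw [← Finset.mul_prod_erase _ _ hi, ← Finset.mul_prod_erase _ _ hi, Function.update_self]
    have h2 : ∏ j ∈ (Finset.range n).erase i, (1 - Function.update U i u j) =
        ∏ j ∈ (Finset.range n).erase i, (1 - U j) :=
      Finset.prod_congr rfl fun j hj => by
        rw [Function.update_of_ne (Finset.ne_of_mem_erase hj)]
    have h3 : 1 - U i ≠ 0 := (sub_pos.2 (hU.1 i).2).ne'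
    rw [h2]
    field_simp

theorem measurable_stick : Measurable stick := by
  refine measurable_pi_iff.2 fun i => ?_
  unfold stick
  fun_prop

/-! ### Ranking -/

/-- The position of `i` in the enumeration of a sequence in descending order. -/
theorem exists_equiv_ranked {v : ℕ → ℝ} (hv : ∀ i, 0 < v i) (h0 : Tendsto v atTop (𝓝 0)) :
    ∃ r : ℕ ≃ ℕ, ∀ i, ranked v (r i) = v i := by
  classical
  -- The set collects the indices ranked before `i`, with ties broken by index. It is finite since
  -- `v` tends to `0 < v i`; its cardinality will be the rank.
  have hfin : ∀ i, {j | v i < v j ∨ (v i = v j ∧ j < i)}.Finite := by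
    intro i
    have h1 : ∀ᶠ j in atTop, v j < v i := h0.eventually (gt_mem_nhds (hv i))
    obtain ⟨N, hN⟩ := eventually_atTop.1 h1
    refine (Set.finite_lt_nat (max N i)).subset fun j hj => ?_
    rcases hj with hj | hj
    · exact lt_max_of_lt_left (not_le.1 fun h => (hN j h).not_gt hj)
    · exact lt_max_of_lt_right hj.2
  let L : ℕ → Finset ℕ := fun i => (hfin i).toFinset
  have hL : ∀ i j, j ∈ L i ↔ v i < v j ∨ (v i = v j ∧ j < i) := fun i j => by
    simp [L]
  let r : ℕ → ℕ := fun i => (L i).card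
  have hlt : ∀ i, ∀ j ∈ L i, r j < r i := by
    intro i j hj
    refine Finset.card_lt_card ⟨fun k hk => ?_, fun h => ?_⟩
    · rw [hL] at hj hk ⊢
      grind
    · have := h hj
      rw [hL] at this
      grind
  have htri : ∀ i j, i ≠ j → j ∈ L i ∨ i ∈ L j := by
    intro i j hij
    rw [hL, hL]
    grind
  have hinj : Function.Injective r := by
    intro i j hij
    by_contra hne
    rcases htri i j hne with h | h
    · exact (hlt _ _ h).ne hij.symm
    · exact (hlt _ _ h).ne hij
  have hsurj : Function.Surjective r := by
    intro k
    obtain ⟨_, ⟨i, rfl⟩, hi⟩ := (Set.infinite_range_of_injective hinj).exists_gt k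
    -- An injective map of the `r i` predecessors of `i` into ranks below `r i` fills them all;
    -- since ranks are unbounded, none is missed.
    have h1 : (L i).image r = Finset.range (r i) := by
      refine Finset.eq_of_subset_of_card_le (fun x hx => ?_) ?_
      · obtain ⟨j, hj, rfl⟩ := Finset.mem_image.1 hx
        exact Finset.mem_range.2 (hlt i j hj)
      · rw [Finset.card_image_of_injective _ hinj, Finset.card_range]
    have h2 : k ∈ (L i).image r := by rw [h1]; exact Finset.mem_range.2 hi
    obtain ⟨j, -, hj⟩ := Finset.mem_image.1 h2
    exact ⟨j, hj⟩
  refine ⟨Equiv.ofBijective r ⟨hinj, hsurj⟩, fun i => ?_⟩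
  change ranked v (r i) = v i
  -- A set with `r i + 1` elements cannot lie inside `L i`, so it contains an index whose value is
  -- at most `v i`. Equality is attained by `L i` together with `i`.
  have hle : ∀ s : {s : Finset ℕ // s.card = r i + 1},
      s.1.inf' (Finset.card_pos.1 (by rw [s.2]; exact Nat.succ_pos _)) v ≤ v i := by
    rintro ⟨s, hs⟩
    obtain ⟨j, hj, hjL⟩ : ∃ j ∈ s, j ∉ L i := by
      by_contra! h
      have := Finset.card_le_card (show s ⊆ L i from h)
      change s.card ≤ r i at this
      omega
    refine (Finset.inf'_le v hj).trans ?_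
    rw [hL] at hjL
    grind
  have hiL : i ∉ L i := by
    rw [hL]
    grind
  let s₀ : {s : Finset ℕ // s.card = r i + 1} :=
    ⟨insert i (L i), by rw [Finset.card_insert_of_notMem hiL]⟩
  have : Nonempty {s : Finset ℕ // s.card = r i + 1} := ⟨s₀⟩
  refine le_antisymm (ciSup_le hle) ?_
  refine le_trans ?_ (le_ciSup (f := fun s : {s : Finset ℕ // s.card = r i + 1} =>
    s.1.inf' (Finset.card_pos.1 (by rw [s.2]; exact Nat.succ_pos _)) v)
    ⟨v i, by rintro _ ⟨s, rfl⟩; exact hle s⟩ s₀)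
  refine Finset.le_inf' _ _ fun j hj => ?_
  rcases Finset.mem_insert.1 hj with rfl | hj
  · exact le_rfl
  · rw [hL] at hj
    grind

theorem measurable_ranked : Measurable ranked := by
  refine measurable_pi_iff.2 fun k => ?_
  refine Measurable.iSup fun s => ?_
  have h : s.1.Nonempty := Finset.card_pos.1 (by rw [s.2]; exact Nat.succ_pos _)
  have key : ∀ (t : Finset ℕ) (ht : t.Nonempty), Measurable fun v : ℕ → ℝ => t.inf' ht v := by
    intro t ht
    induction ht using Finset.Nonempty.cons_induction with
    | singleton a => simpa using measurable_pi_apply a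
    | cons a t ha ht ih =>
      simp_rw [Finset.inf'_cons ht]
      exact (measurable_pi_apply a).inf ih
  exact key s.1 h

theorem measurable_randomMeasure : Measurable (randomMeasure (S := S)) := by
  rw [funext (randomMeasure_eq (S := S))]
  exact measurable_toProb.comp (((measurable_ranked.comp measurable_stick).comp measurable_fst).prodMk
    measurable_snd)

/-- The random measure `∑ᵢ Vᵢ δ_{ξᵢ}`, where `V` is the stick-breaking sequence. -/
def stickMeasure (z : (ℕ → ℝ) × (ℕ → S)) : ProbabilityMeasure S := toProb (stick z.1, z.2)

theorem measurable_stickMeasure : Measurable (stickMeasure (S := S)) :=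
  measurable_toProb.comp ((measurable_stick.comp measurable_fst).prodMk measurable_snd)

theorem coe_stickMeasure {U : ℕ → ℝ} (hU : U ∈ goodSticks) (ξ : ℕ → S) :
    (stickMeasure (U, ξ) : Measure S) = atomSum (stick U, ξ) :=
  coe_toProb (isProbabilityMeasure_atomSum (fun i => (stick_pos hU i).le) (hasSum_stick hU))

/-- Ranking permutes the summands; the permutation depends on the sticks only and can be moved onto
the types. -/
theorem exists_equiv_randomMeasure {U : ℕ → ℝ} (hU : U ∈ goodSticks) :
    ∃ r : ℕ ≃ ℕ, ∀ ξ : ℕ → S, randomMeasure (U, ξ) = stickMeasure (U, fun i => ξ (r i)) := by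
  obtain ⟨r, hr⟩ := exists_equiv_ranked (stick_pos hU)
    (hasSum_stick hU).summable.tendsto_atTop_zero
  refine ⟨r, fun ξ => ?_⟩
  have h1 : atomSum (ranked (stick U), ξ) = atomSum (stick U, fun i => ξ (r i)) := by
    refine Measure.ext fun A hA => ?_
    rw [atomSum, atomSum, Measure.sum_apply _ hA, Measure.sum_apply _ hA, ← r.tsum_eq]
    simp only [hr]
  have h2 := isProbabilityMeasure_atomSum (q := (stick U, fun i => ξ (r i)))
    (fun i => (stick_pos hU i).le) (hasSum_stick hU)
  refine Subtype.ext ?_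
  rw [randomMeasure_eq]
  change ((toProb _ : ProbabilityMeasure S) : Measure S) = (toProb _ : ProbabilityMeasure S)
  rw [coe_toProb h2, coe_toProb (h1 ▸ h2), h1]

end

end TwoParam

namespace TwoParam

noncomputable section

variable {S : Type*} [MeasurableSpace S]

/-! ### Beta variables -/

theorem ae_betaMeasure_mem_Ioo (a b : ℝ) : ∀ᵐ u ∂betaMeasure a b, u ∈ Set.Ioo (0 : ℝ) 1 := by
  have hm : Measurable (betaPDF a b) := (measurable_betaPDFReal a b).ennreal_ofReal
  rw [betaMeasure, ae_withDensity_iff hm]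
  refine Eventually.of_forall fun u hu => ⟨?_, ?_⟩
  · by_contra! h
    exact hu (betaPDF_eq_zero_of_nonpos h)
  · by_contra! h
    exact hu (betaPDF_eq_zero_of_one_le h)

/-- Multiplying the `Beta(a, b)` density by `1 - u` gives a multiple of the `Beta(a, b + 1)`
density; the Gamma recursion computes the factor. -/
theorem lintegral_one_sub_betaMeasure {a b : ℝ} (ha : 0 < a) (hb : 0 < b) :
    ∫⁻ u, ENNReal.ofReal (1 - u) ∂betaMeasure a b = ENNReal.ofReal (b / (a + b)) := by
  have hm : ∀ b, Measurable (betaPDF a b) := fun b => (measurable_betaPDFReal a b).ennreal_ofReal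
  have hbeta : beta a (b + 1) = beta a b * (b / (a + b)) := by
    have h1 := Real.Gamma_add_one hb.ne'
    have h2 := Real.Gamma_add_one (add_pos ha hb).ne'
    have h3 := (Real.Gamma_pos_of_pos (add_pos ha hb)).ne'
    have h4 := (add_pos ha hb).ne'
    rw [beta, beta, h1, ← add_assoc, h2]
    field_simp
  have hbpos := beta_pos ha hb
  rw [betaMeasure, lintegral_withDensity_eq_lintegral_mul _ (hm b) (by fun_prop)]
  have h1 : ∀ u, (betaPDF a b * fun u => ENNReal.ofReal (1 - u)) u =
      ENNReal.ofReal (b / (a + b)) * betaPDF a (b + 1) u := by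
    intro u
    rw [Pi.mul_apply]
    rcases le_or_gt u 0 with h | h
    · simp [betaPDF_eq_zero_of_nonpos h]
    rcases le_or_gt 1 u with h' | h'
    · simp [betaPDF_eq_zero_of_one_le h']
    have h2 : 0 < 1 - u := sub_pos.2 h'
    rw [betaPDF_of_pos_lt_one h h', betaPDF_of_pos_lt_one h h', ← ENNReal.ofReal_mul (by positivity),
      ← ENNReal.ofReal_mul (by positivity), hbeta, show b + 1 - 1 = (b - 1) + 1 by ring,
      Real.rpow_add_one h2.ne']
    congr 1
    have h4 := (add_pos ha hb).ne'
    field_simp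
  simp_rw [h1]
  rw [lintegral_const_mul _ (hm _), lintegral_betaPDF_eq_one ha (by linarith), mul_one]

theorem integral_one_sub_betaMeasure {a b : ℝ} (ha : 0 < a) (hb : 0 < b) :
    ∫ u, (1 - u) ∂betaMeasure a b = b / (a + b) := by
  rw [integral_eq_lintegral_of_nonneg_ae, lintegral_one_sub_betaMeasure ha hb,
    ENNReal.toReal_ofReal (by positivity)]
  · filter_upwards [ae_betaMeasure_mem_Ioo a b] with u hu
    exact sub_nonneg.2 hu.2.le
  · exact (by fun_prop : Measurable fun u : ℝ => 1 - u).aestronglyMeasurable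

/-- The law of the `i`-th stick. -/
def stickBeta (θ : ℝ) (i : ℕ) : Measure ℝ :=
  betaMeasure (1 - 1 / 2) (θ + ((i : ℝ) + 1) * (1 / 2))

theorem stickBeta_pos {θ : ℝ} (hθ : -(1 / 2) < θ) (i : ℕ) : 0 < θ + ((i : ℝ) + 1) * (1 / 2) := by
  have : (0 : ℝ) ≤ i := Nat.cast_nonneg i
  linarith

theorem isProbabilityMeasure_stickBeta {θ : ℝ} (hθ : -(1 / 2) < θ) (i : ℕ) :
    IsProbabilityMeasure (stickBeta θ i) :=
  isProbabilityMeasureBeta (by norm_num) (stickBeta_pos hθ i)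

theorem inputLaw_eq (θ : ℝ) (ν₀ : Measure S) : inputLaw (1 / 2) θ ν₀ =
    (Measure.infinitePi (stickBeta θ)).prod (Measure.infinitePi fun _ : ℕ => ν₀) := rfl

/-- The factors are `(2θ + 1 + i)/(2θ + 2 + i)`, so the product telescopes. -/
theorem prod_mean_stick {θ : ℝ} (hθ : -(1 / 2) < θ) (n : ℕ) :
    ∏ i ∈ Finset.range n, ∫ u, (1 - u) ∂stickBeta θ i = (2 * θ + 1) / (2 * θ + 1 + n) := by
  induction n with
  | zero => 
    have : 2 * θ + 1 ≠ 0 := by linarith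
    simp [this]
  | succ n ih =>
    have hn : (0 : ℝ) ≤ n := Nat.cast_nonneg n
    have h1 : 2 * θ + 1 + n ≠ 0 := by linarith
    have h2 : 2 * θ + 1 + (n + 1) ≠ 0 := by linarith
    have h3 : (1 - 1 / 2 : ℝ) + (θ + ((n : ℝ) + 1) * (1 / 2)) ≠ 0 := by linarith
    rw [Finset.prod_range_succ, ih, stickBeta,
      integral_one_sub_betaMeasure (by norm_num) (stickBeta_pos hθ n), Nat.cast_succ]
    rw [div_mul_div_comm, div_eq_div_iff (mul_ne_zero h1 h3) h2]
    ring

/-- The unbroken remainders decrease to a nonnegative limit. Their means tend to zero, so this limit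
has mean zero and vanishes almost surely. -/
theorem ae_mem_goodSticks {θ : ℝ} (hθ : -(1 / 2) < θ) :
    ∀ᵐ U ∂Measure.infinitePi (stickBeta θ), U ∈ goodSticks := by
  have := isProbabilityMeasure_stickBeta hθ
  set μ := Measure.infinitePi (stickBeta θ)
  have h1 : ∀ᵐ U ∂μ, ∀ i, U i ∈ Set.Ioo (0 : ℝ) 1 := by
    rw [ae_all_iff]
    exact fun i => (measurePreserving_eval_infinitePi (stickBeta θ) i).quasiMeasurePreserving.ae
      (ae_betaMeasure_mem_Ioo _ _)
  let p : ℕ → (ℕ → ℝ) → ℝ := fun n U => ∏ i ∈ Finset.range n, (1 - U i)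
  have hp : ∀ n, ∫ U, p n U ∂μ = (2 * θ + 1) / (2 * θ + 1 + n) := by
    intro n
    let f : (Finset.range n → ℝ) → ℝ := fun x => ∏ i, (1 - x i)
    have hf : Measurable f := by
      simp only [f]
      fun_prop
    have h2 : ∀ U : ℕ → ℝ, p n U = f ((Finset.range n).restrict U) := fun U =>
      (Finset.prod_coe_sort (Finset.range n) fun i => 1 - U i).symm
    rw [integral_congr_ae (Eventually.of_forall h2),
      integral_restrict_infinitePi (μ := stickBeta θ) hf.aestronglyMeasurable,
      integral_fintype_prod_eq_prod (f := fun _ u => 1 - u), ← prod_mean_stick hθ,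
      Finset.prod_coe_sort (Finset.range n) fun i => ∫ u, (1 - u) ∂stickBeta θ i]
  have hmem : ∀ᵐ U ∂μ, ∀ n, p n U ∈ Set.Icc (0 : ℝ) 1 := by
    filter_upwards [h1] with U hU n
    exact ⟨Finset.prod_nonneg fun i _ => (sub_pos.2 (hU i).2).le,
      Finset.prod_le_one (fun i _ => (sub_pos.2 (hU i).2).le) fun i _ => by linarith [(hU i).1]⟩
  have hlim : ∀ᵐ U ∂μ, Tendsto (fun n => p n U) atTop (𝓝 (⨅ n, p n U)) := by
    filter_upwards [h1, hmem] with U hU hm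
    refine tendsto_atTop_ciInf (antitone_nat_of_succ_le fun n => ?_)
      ⟨0, by rintro _ ⟨n, rfl⟩; exact (hm n).1⟩
    change p (n + 1) U ≤ p n U
    rw [show p (n + 1) U = p n U * (1 - U n) from Finset.prod_range_succ _ _]
    exact mul_le_of_le_one_right (hm n).1 (by linarith [(hU n).1])
  have hpm : ∀ n, Measurable (p n) := fun n => by
    simp only [p]
    fun_prop
  have hint := tendsto_integral_of_dominated_convergence (fun _ => (1 : ℝ))
    (fun n => (hpm n).aestronglyMeasurable) (integrable_const 1)
    (fun n => by
      filter_upwards [hmem] with U hU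
      rw [Real.norm_eq_abs, abs_of_nonneg (hU n).1]
      exact (hU n).2) hlim
  have hint0 : Tendsto (fun n => ∫ U, p n U ∂μ) atTop (𝓝 0) := by
    simp_rw [hp]
    exact tendsto_const_nhds.div_atTop
      (tendsto_atTop_add_const_left _ _ tendsto_natCast_atTop_atTop)
  have hzero := tendsto_nhds_unique hint hint0
  have hnn : ∀ᵐ U ∂μ, 0 ≤ ⨅ n, p n U := by
    filter_upwards [hmem] with U hU
    exact le_ciInf fun n => (hU n).1
  have hbd : ∀ᵐ U ∂μ, ‖⨅ n, p n U‖ ≤ 1 := by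
    filter_upwards [hmem, hnn] with U hU h0
    rw [Real.norm_eq_abs, abs_of_nonneg h0]
    exact (ciInf_le ⟨0, by rintro _ ⟨n, rfl⟩; exact (hU n).1⟩ 0).trans (hU 0).2
  have hinfm : Measurable fun U => ⨅ n, p n U := Measurable.iInf hpm
  rw [integral_eq_zero_iff_of_nonneg_ae hnn
    (Integrable.of_bound hinfm.aestronglyMeasurable 1 hbd)] at hzero
  filter_upwards [h1, hlim, hzero] with U hU hl hz
  refine ⟨hU, ?_⟩
  rw [Pi.zero_apply] at hz
  rw [← hz]
  exact hl

/-- Resampling one coordinate does not change a product law. -/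
theorem map_update_infinitePi {ι : Type*} [DecidableEq ι] {X : ι → Type*}
    [∀ i, MeasurableSpace (X i)] (μ : ∀ i, Measure (X i)) [∀ i, IsProbabilityMeasure (μ i)] (i : ι) :
    ((Measure.infinitePi μ).prod (μ i)).map (fun q => Function.update q.1 i q.2) =
      Measure.infinitePi μ := by
  refine Measure.eq_infinitePi μ fun s t ht => ?_
  have hm : Measurable fun q : (∀ i, X i) × X i => Function.update q.1 i q.2 := measurable_update'
  rw [Measure.map_apply hm (MeasurableSet.pi s.countable_toSet fun j _ => ht j)]
  by_cases hi : i ∈ s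
  · have h1 : (fun q : (∀ i, X i) × X i => Function.update q.1 i q.2) ⁻¹' (Set.pi s t) =
        (Set.pi (s.erase i : Finset ι) t) ×ˢ (t i) := by
      ext ⟨x, y⟩
      simp only [Set.mem_preimage, Set.mem_pi, Finset.mem_coe, Set.mem_prod, Finset.mem_erase]
      constructor
      · intro h
        exact ⟨fun j hj => by simpa [hj.1] using h j hj.2, by simpa using h i hi⟩
      · rintro ⟨h, h'⟩ j hj
        rcases eq_or_ne j i with rfl | hne
        · simpa using h'
        · simpa [hne] using h j ⟨hne, hj⟩
    rw [h1, Measure.prod_prod, Measure.infinitePi_pi μ (fun j _ => ht j), mul_comm,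
      Finset.mul_prod_erase s (fun j => μ j (t j)) hi]
  · have h1 : (fun q : (∀ i, X i) × X i => Function.update q.1 i q.2) ⁻¹' (Set.pi s t) =
        (Set.pi s t) ×ˢ Set.univ := by
      ext ⟨x, y⟩
      simp only [Set.mem_preimage, Set.mem_pi, Finset.mem_coe, Set.mem_prod, Set.mem_univ, and_true]
      refine forall₂_congr fun j hj => ?_
      rw [Function.update_of_ne (by rintro rfl; exact hi hj)]
    rw [h1, Measure.prod_prod, measure_univ, mul_one, Measure.infinitePi_pi μ (fun j _ => ht j)]

/-! ### The law of the random measure -/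

section Law

variable {θ : ℝ} (hθ : -(1 / 2) < θ) (ν₀ : Measure S) [IsProbabilityMeasure ν₀]

include hθ

theorem isProbabilityMeasure_inputLaw : IsProbabilityMeasure (inputLaw (1 / 2) θ ν₀) := by
  have := isProbabilityMeasure_stickBeta hθ
  rw [inputLaw_eq]
  infer_instance

omit [IsProbabilityMeasure ν₀] in
theorem ae_fst_mem_goodSticks : ∀ᵐ z ∂inputLaw (1 / 2) θ ν₀, z.1 ∈ goodSticks := by
  have := isProbabilityMeasure_stickBeta hθ
  rw [inputLaw_eq]
  exact Measure.quasiMeasurePreserving_fst.ae (ae_mem_goodSticks hθ)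

/-- For fixed sticks the ranking is a fixed permutation of i.i.d. types and preserves their law;
Fubini integrates over the sticks. -/
theorem dirichletProcess_eq_map_stickMeasure :
    dirichletProcess (1 / 2) θ ν₀ = (inputLaw (1 / 2) θ ν₀).map stickMeasure := by
  have := isProbabilityMeasure_stickBeta hθ
  refine Measure.ext fun A hA => ?_
  rw [dirichletProcess, Measure.map_apply measurable_randomMeasure hA,
    Measure.map_apply measurable_stickMeasure hA, inputLaw_eq,
    Measure.prod_apply (measurable_randomMeasure hA),
    Measure.prod_apply (measurable_stickMeasure hA)]
  refine lintegral_congr_ae ?_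
  filter_upwards [ae_mem_goodSticks hθ] with U hU
  obtain ⟨r, hr⟩ := exists_equiv_randomMeasure (S := S) hU
  have hmp : (Measure.infinitePi fun _ : ℕ => ν₀).map (fun ξ : ℕ → S => fun i => ξ (r i)) =
      Measure.infinitePi fun _ : ℕ => ν₀ := by
    have h1 := Measure.infinitePi_map_piCongrLeft (X := fun _ : ℕ => S) (fun _ : ℕ => ν₀) r.symm
    have h2 : (fun ξ : ℕ → S => fun i => ξ (r i)) =
        MeasurableEquiv.piCongrLeft (fun _ : ℕ => S) r.symm := by
      funext ξ i
      have h3 := MeasurableEquiv.piCongrLeft_apply_apply (β := fun _ : ℕ => S) r.symm ξ (r i)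
      rw [Equiv.symm_apply_apply] at h3
      exact h3.symm
    rw [h2]
    exact h1
  have hmr : Measurable fun ξ : ℕ → S => fun i => ξ (r i) :=
    measurable_pi_iff.2 fun i => measurable_pi_apply _
  have hmA : MeasurableSet (Prod.mk U ⁻¹' (stickMeasure ⁻¹' A) : Set (ℕ → S)) :=
    measurable_prodMk_left (measurable_stickMeasure hA)
  rw [← hmp, Measure.map_apply hmr hmA, hmp]
  congr 1
  ext ξ
  simp only [Set.mem_preimage, hr]

theorem lintegral_dirichletProcess {h : ProbabilityMeasure S → ℝ≥0∞} (hh : Measurable h) :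
    ∫⁻ μ, h μ ∂(dirichletProcess (1 / 2) θ ν₀) =
      ∫⁻ z, h (stickMeasure z) ∂inputLaw (1 / 2) θ ν₀ := by
  rw [dirichletProcess_eq_map_stickMeasure hθ, lintegral_map hh measurable_stickMeasure]

theorem lintegral_pairLaw {h : ProbabilityMeasure S × S → ℝ≥0∞} (hh : Measurable h) :
    ∫⁻ p, h p ∂pairLaw (dirichletProcess (1 / 2) θ ν₀) =
      ∫⁻ z, ∑' i, ENNReal.ofReal (stick z.1 i) * h (stickMeasure z, z.2 i)
        ∂inputLaw (1 / 2) θ ν₀ := by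
  rw [Measure.lintegral_compProd hh, lintegral_dirichletProcess hθ ν₀ hh.lintegral_kernel_prod_right']
  refine lintegral_congr_ae ?_
  filter_upwards [ae_fst_mem_goodSticks hθ ν₀] with z hz
  have h1 : ∀ μ : ProbabilityMeasure S, Measurable fun x => h (μ, x) := fun μ =>
    hh.comp measurable_prodMk_left
  rw [evalKernel_apply, coe_stickMeasure hz z.2, atomSum, lintegral_sum_measure]
  refine tsum_congr fun i => ?_
  rw [lintegral_smul_measure, lintegral_dirac' _ (h1 _)]
  rfl

/-- Given the sticks, each type has law `ν₀` and the weights sum to one. This makes `L¹(ν₀)`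
approximation of inner functions sufficient. -/
theorem snd_pairLaw {g : S → ℝ≥0∞} (hg : Measurable g) :
    ∫⁻ p, g p.2 ∂pairLaw (dirichletProcess (1 / 2) θ ν₀) = ∫⁻ x, g x ∂ν₀ := by
  have := isProbabilityMeasure_stickBeta hθ
  have hm : Measurable fun z : (ℕ → ℝ) × (ℕ → S) =>
      ∑' i, ENNReal.ofReal (stick z.1 i) * g (z.2 i) := by
    refine Measurable.tsum fun i => Measurable.mul ?_ ?_
    · exact ((measurable_pi_apply i).comp (measurable_stick.comp measurable_fst)).ennreal_ofReal
    · exact hg.comp ((measurable_pi_apply i).comp measurable_snd)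
  rw [lintegral_pairLaw hθ ν₀ (h := fun p => g p.2) (hg.comp measurable_snd), inputLaw_eq,
    lintegral_prod _ hm.aemeasurable]
  have h1 : ∀ᵐ U ∂Measure.infinitePi (stickBeta θ),
      ∫⁻ ξ, ∑' i, ENNReal.ofReal (stick U i) * g (ξ i) ∂(Measure.infinitePi fun _ : ℕ => ν₀) =
        ∫⁻ x, g x ∂ν₀ := by
    filter_upwards [ae_mem_goodSticks hθ] with U hU
    rw [lintegral_tsum (f := fun i (ξ : ℕ → S) => ENNReal.ofReal (stick U i) * g (ξ i)) fun i => (measurable_const.mul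
      (hg.comp (measurable_pi_apply i))).aemeasurable]
    have h2 : ∀ i, ∫⁻ ξ : ℕ → S, ENNReal.ofReal (stick U i) * g (ξ i)
        ∂(Measure.infinitePi fun _ : ℕ => ν₀) = ENNReal.ofReal (stick U i) * ∫⁻ x, g x ∂ν₀ := by
      intro i
      rw [lintegral_const_mul (f := fun ξ : ℕ → S => g (ξ i)) _ (hg.comp (measurable_pi_apply i)),
        (measurePreserving_eval_infinitePi (fun _ : ℕ => ν₀) i).lintegral_comp hg]
    simp_rw [h2]
    rw [ENNReal.tsum_mul_right, ← ENNReal.ofReal_tsum_of_nonneg (fun i => (stick_pos hU i).le)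
      (hasSum_stick hU).summable, (hasSum_stick hU).tsum_eq, ENNReal.ofReal_one, one_mul]
  rw [lintegral_congr_ae h1, lintegral_const, measure_univ, mul_one]

end Law

end

end TwoParam

namespace TwoParam

noncomputable section

/-! ### A one-dimensional closability criterion -/

/-- On a compact part of `(0, 1)` the beta density times `u` is bounded below. The weight `u` is
carried along because derivatives in a stick are controlled only with it. -/
theorem exists_setLIntegral_le_betaMeasure {a b : ℝ} (ha : 0 < a) (hb : 0 < b) {K : Set ℝ}
    (hK : IsCompact K) (hK1 : K ⊆ Set.Ioo 0 1) :
    ∃ C : ℝ≥0, ∀ h : ℝ → ℝ≥0∞, Measurable h →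
      ∫⁻ u in K, h u ≤ C * ∫⁻ u, h u * ENNReal.ofReal u ∂betaMeasure a b := by
  have hcont : ContinuousOn (fun u : ℝ =>
      (1 / beta a b * u ^ (a - 1) * (1 - u) ^ (b - 1) * u)⁻¹) K := by
    have hpos : ∀ u ∈ K, 0 < u ∧ 0 < 1 - u := fun u hu =>
      ⟨(hK1 hu).1, sub_pos.2 (hK1 hu).2⟩
    refine ContinuousOn.inv₀ ?_ fun u hu => ?_
    · refine ContinuousOn.mul (ContinuousOn.mul (continuousOn_const.mul ?_) ?_) continuousOn_id
      · exact continuousOn_id.rpow_const fun u hu => Or.inl (hpos u hu).1.ne'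
      · exact (continuousOn_const.sub continuousOn_id).rpow_const
          fun u hu => Or.inl (hpos u hu).2.ne'
    · obtain ⟨h1, h2⟩ := hpos u hu
      have := beta_pos ha hb
      positivity
  obtain ⟨C, hC⟩ := hK.exists_bound_of_continuousOn hcont
  refine ⟨C.toNNReal, fun h hh => ?_⟩
  have hm : Measurable (betaPDF a b) := (measurable_betaPDFReal a b).ennreal_ofReal
  rw [betaMeasure, lintegral_withDensity_eq_lintegral_mul _ hm (by fun_prop),
    ← lintegral_const_mul _ (by fun_prop)]
  refine le_trans (setLIntegral_mono' hK.measurableSet fun u hu => ?_) (setLIntegral_le_lintegral K _)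
  have h1 := (hK1 hu).1
  have h2 : 0 < 1 - u := sub_pos.2 (hK1 hu).2
  have h3 := beta_pos ha hb
  set d := 1 / beta a b * u ^ (a - 1) * (1 - u) ^ (b - 1) with hd
  have hd0 : 0 < d := by positivity
  have h4 : 1 ≤ C * (d * u) := by
    have h5 := hC u hu
    rw [Real.norm_eq_abs, abs_of_pos (by positivity)] at h5
    have h6 : (d * u)⁻¹ * (d * u) = 1 := inv_mul_cancel₀ (by positivity)
    rw [← h6]
    gcongr
  have h7 : (1 : ℝ≥0∞) ≤ C.toNNReal * (betaPDF a b u * ENNReal.ofReal u) := by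
    rw [betaPDF_of_pos_lt_one h1 (hK1 hu).2, ← hd, ← ENNReal.ofReal_mul hd0.le]
    change (1 : ℝ≥0∞) ≤ ENNReal.ofReal C * _
    rw [← ENNReal.ofReal_mul' (by positivity), ← ENNReal.ofReal_one]
    exact ENNReal.ofReal_le_ofReal h4
  calc h u = h u * 1 := (mul_one _).symm
    _ ≤ h u * (C.toNNReal * (betaPDF a b u * ENNReal.ofReal u)) := by gcongr
    _ = C.toNNReal * (betaPDF a b * fun u => h u * ENNReal.ofReal u) u := by
        rw [Pi.mul_apply]; ring

/-- Closability of the derivative on `(0, 1)` with respect to the beta law. -/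
theorem ae_eq_zero_of_approx_deriv {a b : ℝ} (ha : 0 < a) (hb : 0 < b) {γ : ℝ → ℝ}
    (hγ : Measurable γ) (hfin : ∫⁻ u, ‖γ u‖ₑ * ENNReal.ofReal u ∂betaMeasure a b ≠ ⊤)
    (happ : ∀ ε : ℝ≥0∞, 0 < ε → ∃ f : ℝ → ℝ, ContDiff ℝ 1 f ∧
      ∫⁻ u, (‖f u‖ₑ + ‖(1 - u) * deriv f u - γ u‖ₑ * ENNReal.ofReal u) ∂betaMeasure a b < ε) :
    ∀ᵐ u ∂betaMeasure a b, γ u = 0 := by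
  suffices h : ∀ᵐ u, u ∈ Set.Ioo (0 : ℝ) 1 → γ u = 0 by
    have h1 : ∀ᵐ u ∂betaMeasure a b, u ∈ Set.Ioo (0 : ℝ) 1 → γ u = 0 :=
      (withDensity_absolutelyContinuous _ _).ae_le h
    filter_upwards [h1, ae_betaMeasure_mem_Ioo a b] with u hu1 hu2 using hu1 hu2
  have hint : ∀ K : Set ℝ, IsCompact K → K ⊆ Set.Ioo 0 1 → IntegrableOn γ K := by
    intro K hK hK1
    obtain ⟨C, hC⟩ := exists_setLIntegral_le_betaMeasure ha hb hK hK1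
    refine ⟨hγ.aestronglyMeasurable, lt_of_le_of_lt (hC _ hγ.enorm) ?_⟩
    exact ENNReal.mul_lt_top ENNReal.coe_lt_top hfin.lt_top
  refine isOpen_Ioo.ae_eq_zero_of_integral_contDiff_smul_eq_zero
    ((locallyIntegrableOn_iff isOpen_Ioo.isLocallyClosed).2 fun K hK1 hK => hint K hK hK1) ?_
  intro χ hχ hχc hχ1
  obtain ⟨C, hC⟩ := exists_setLIntegral_le_betaMeasure ha hb hχc hχ1
  -- pairing with a continuous function supported in the support of `χ`
  have hpair : ∀ ψ : ℝ → ℝ, Continuous ψ → Function.support ψ ⊆ tsupport χ →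
      ∃ M : ℝ≥0, ∀ h : ℝ → ℝ, Measurable h →
        ‖∫ u, ψ u * h u‖ₑ ≤ M * ∫⁻ u, ‖h u‖ₑ * ENNReal.ofReal u ∂betaMeasure a b := by
    intro ψ hψ hψs
    obtain ⟨B, hB⟩ := IsCompact.exists_bound_of_continuousOn hχc hψ.continuousOn
    refine ⟨B.toNNReal * C, fun h hh => ?_⟩
    have h1 : ∀ u, ‖ψ u * h u‖ₑ ≤ (tsupport χ).indicator (fun u => ENNReal.ofReal B * ‖h u‖ₑ) u := by
      intro u
      by_cases hu : u ∈ tsupport χ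
      · rw [Set.indicator_of_mem hu, enorm_mul]
        gcongr
        rw [← ofReal_norm]
        exact ENNReal.ofReal_le_ofReal (hB u hu)
      · have : ψ u = 0 := by
          by_contra h0
          exact hu (hψs h0)
        simp [this]
    calc ‖∫ u, ψ u * h u‖ₑ ≤ ∫⁻ u, ‖ψ u * h u‖ₑ := enorm_integral_le_lintegral_enorm _
      _ ≤ ∫⁻ u, (tsupport χ).indicator (fun u => ENNReal.ofReal B * ‖h u‖ₑ) u := lintegral_mono h1
      _ = ENNReal.ofReal B * ∫⁻ u in tsupport χ, ‖h u‖ₑ := by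
          rw [lintegral_indicator (isClosed_tsupport χ).measurableSet,
            lintegral_const_mul _ hh.enorm]
      _ ≤ ENNReal.ofReal B * (C * ∫⁻ u, ‖h u‖ₑ * ENNReal.ofReal u ∂betaMeasure a b) := by
          gcongr
          exact hC _ hh.enorm
      _ = _ := by
          rw [← mul_assoc, ENNReal.coe_mul]
          rfl
  have hχ0 : Continuous χ := hχ.continuous
  -- Absorbing `1 - u` into the test function makes `∫ χ (1 - u) f'` equal to `-∫ η' f`, which is
  -- small with `f`.
  let η : ℝ → ℝ := fun u => χ u * (1 - u)
  have hη : ContDiff ℝ 1 η := (hχ.of_le (by simp)).mul (contDiff_const.sub contDiff_id)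
  have hηs : Function.support η ⊆ tsupport χ := fun u hu =>
    subset_tsupport χ (left_ne_zero_of_mul hu)
  have hη's : Function.support (deriv η) ⊆ tsupport χ := by
    refine support_deriv_subset.trans ?_
    exact closure_minimal hηs (isClosed_tsupport χ)
  have hη'c : Continuous (deriv η) := hη.continuous_deriv le_rfl
  obtain ⟨M₁, hM₁⟩ := hpair χ hχ0 (subset_tsupport χ)
  obtain ⟨M₂, hM₂⟩ := hpair (deriv η) hη'c hη's
  have hcs : ∀ ψ : ℝ → ℝ, Function.support ψ ⊆ tsupport χ → HasCompactSupport ψ := fun ψ hψ =>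
    hχc.of_isClosed_subset (isClosed_tsupport ψ) (closure_minimal hψ (isClosed_tsupport χ))
  have hle : ∀ ε : ℝ≥0∞, 0 < ε → ‖∫ u, χ u * γ u‖ₑ ≤ (M₁ + M₂) * ε := by
    intro ε hε
    obtain ⟨f, hf, hfε⟩ := happ ε hε
    have hf'c : Continuous (deriv f) := hf.continuous_deriv le_rfl
    have hparts : ∫ u, η u * deriv f u = -∫ u, deriv η u * f u := by
      refine integral_mul_deriv_eq_deriv_mul_of_integrable
        (fun u _ => (hη.differentiable one_ne_zero u).hasDerivAt)
        (fun u _ => (hf.differentiable one_ne_zero u).hasDerivAt) ?_ ?_ ?_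
      · exact (hη.continuous.mul hf'c).integrable_of_hasCompactSupport (hcs η hηs).mul_right
      · exact (hη'c.mul hf.continuous).integrable_of_hasCompactSupport (hcs _ hη's).mul_right
      · exact (hη.continuous.mul hf.continuous).integrable_of_hasCompactSupport
          (hcs η hηs).mul_right
    have hγint : Integrable fun u => χ u * γ u := by
      have h1 : IntegrableOn (fun u => χ u * γ u) (tsupport χ) :=
        (hint _ hχc hχ1).continuousOn_mul hχ0.continuousOn hχc
      rwa [integrableOn_iff_integrable_of_support_subset] at h1
      exact fun u hu => subset_tsupport χ (left_ne_zero_of_mul hu)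
    have hfint : Integrable fun u => χ u * ((1 - u) * deriv f u) :=
      (hχ0.mul ((continuous_const.sub continuous_id).mul hf'c)).integrable_of_hasCompactSupport
        (HasCompactSupport.mul_right hχc)
    have h2 : ∫ u, χ u * γ u = -(∫ u, χ u * ((1 - u) * deriv f u - γ u)) -
        ∫ u, deriv η u * f u := by
      rw [sub_eq_add_neg, ← hparts]
      have h3 : ∫ u, χ u * ((1 - u) * deriv f u - γ u) =
          (∫ u, η u * deriv f u) - ∫ u, χ u * γ u := by
        rw [← integral_sub ?_ hγint]
        · congr 1
          funext u
          simp only [η]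
          ring
        · convert hfint using 2
          simp only [η]
          ring
      rw [h3]
      ring
    have h4 : ∫⁻ u, ‖(1 - u) * deriv f u - γ u‖ₑ * ENNReal.ofReal u ∂betaMeasure a b ≤ ε :=
      (lintegral_mono fun u => le_add_self).trans hfε.le
    have h5 : ∫⁻ u, ‖f u‖ₑ * ENNReal.ofReal u ∂betaMeasure a b ≤ ε := by
      refine le_trans (lintegral_mono_ae ?_) hfε.le
      filter_upwards [ae_betaMeasure_mem_Ioo a b] with u hu
      refine le_add_right (mul_le_of_le_one_right' ?_)
      rw [← ENNReal.ofReal_one]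
      exact ENNReal.ofReal_le_ofReal hu.2.le
    rw [h2, add_mul]
    refine (enorm_sub_le).trans ?_
    rw [enorm_neg]
    gcongr
    · exact (hM₁ _ (by fun_prop)).trans (by gcongr)
    · exact (hM₂ _ hf.continuous.measurable).trans (by gcongr)
  have hzero : ‖∫ u, χ u * γ u‖ₑ = 0 := by
    refine le_antisymm (ENNReal.le_of_forall_pos_le_add fun δ hδ _ => ?_) bot_le
    have h1 := hle (δ / (M₁ + M₂ + 1) : ℝ≥0) (by positivity)
    refine h1.trans ?_
    rw [zero_add]
    have h2 : (M₁ + M₂) * (δ / (M₁ + M₂ + 1)) ≤ δ := by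
      rw [← mul_div_assoc]
      refine NNReal.div_le_of_le_mul ?_
      rw [mul_comm]
      exact mul_le_mul' le_rfl le_self_add
    exact_mod_cast h2
  simpa using hzero

end

end TwoParam

namespace TwoParam

noncomputable section

variable {S : Type*} [MeasurableSpace S]

/-! ### Varying one stick -/

theorem stick_update_of_lt (U : ℕ → ℝ) {i j : ℕ} (h : j < i) (u : ℝ) :
    stick (Function.update U i u) j = stick U j := by
  rw [stick, stick, Function.update_of_ne h.ne]
  congr 1
  refine Finset.prod_congr rfl fun l hl => ?_
  rw [Function.update_of_ne ((Finset.mem_range.1 hl).trans h).ne]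

theorem stick_update_self (U : ℕ → ℝ) (i : ℕ) (u : ℝ) :
    stick (Function.update U i u) i = u * ∏ l ∈ Finset.range i, (1 - U l) := by
  rw [stick, Function.update_self]
  congr 1
  refine Finset.prod_congr rfl fun l hl => ?_
  rw [Function.update_of_ne (Finset.mem_range.1 hl).ne]

theorem stick_update_of_gt (U : ℕ → ℝ) {i j : ℕ} (h : i < j) (u : ℝ) :
    stick (Function.update U i u) j =
      (1 - u) * (U j * ∏ l ∈ (Finset.range j).erase i, (1 - U l)) := by
  rw [stick, Function.update_of_ne h.ne', ← Finset.mul_prod_erase _ _ (Finset.mem_range.2 h),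
    Function.update_self]
  have : ∏ l ∈ (Finset.range j).erase i, (1 - Function.update U i u l) =
      ∏ l ∈ (Finset.range j).erase i, (1 - U l) :=
    Finset.prod_congr rfl fun l hl => by rw [Function.update_of_ne (Finset.ne_of_mem_erase hl)]
  rw [this]
  ring

/-- Each weight is affine in the `i`-th stick, hence is interpolated from its values at `Uᵢ` and at
`1`. At `1` the breaking stops after the `i`-th piece. -/
theorem stick_update_affine (U : ℕ → ℝ) (i j : ℕ) (hi : U i < 1) (u : ℝ) :
    stick (Function.update U i u) j = (1 - u) / (1 - U i) * stick U j +
      (u - U i) / (1 - U i) * stick (Function.update U i 1) j := by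
  have h0 : 1 - U i ≠ 0 := (sub_pos.2 hi).ne'
  have hU : stick U j = stick (Function.update U i (U i)) j := by rw [Function.update_eq_self]
  rcases lt_trichotomy j i with h | rfl | h
  · rw [stick_update_of_lt U h, stick_update_of_lt U h]
    field_simp
    ring
  · rw [hU, stick_update_self, stick_update_self, stick_update_self]
    field_simp
    ring
  · rw [hU, stick_update_of_gt U h, stick_update_of_gt U h, stick_update_of_gt U h]
    field_simp
    ring

theorem stick_update_one_of_gt (U : ℕ → ℝ) {i j : ℕ} (h : i < j) :
    stick (Function.update U i 1) j = 0 := by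
  rw [stick_update_of_gt U h]
  ring

theorem sum_stick_update_one (U : ℕ → ℝ) (i : ℕ) :
    ∑ j ∈ Finset.range (i + 1), stick (Function.update U i 1) j = 1 := by
  rw [sum_stick, Finset.prod_range_succ, Function.update_self]
  ring

theorem stick_update_one_mul_le {U : ℕ → ℝ} (hU : U ∈ goodSticks) {i j : ℕ} (h : j ≤ i) :
    0 ≤ stick (Function.update U i 1) j ∧ stick (Function.update U i 1) j * U i ≤ stick U j := by
  rcases h.lt_or_eq with h | rfl
  · rw [stick_update_of_lt U h]
    exact ⟨(stick_pos hU j).le, mul_le_of_le_one_right (stick_pos hU j).le (hU.1 i).2.le⟩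
  · rw [stick_update_self, one_mul, stick, mul_comm]
    exact ⟨Finset.prod_nonneg fun l _ => (sub_pos.2 (hU.1 l).2).le, le_rfl⟩

theorem hasSum_integral_stickMeasure {U : ℕ → ℝ} (hU : U ∈ goodSticks) (ξ : ℕ → S) {g : S → ℝ}
    (hg : Measurable g) (hgi : Integrable g (stickMeasure (U, ξ) : Measure S)) :
    HasSum (fun j => stick U j * g (ξ j)) (∫ x, g x ∂(stickMeasure (U, ξ) : Measure S)) := by
  rw [coe_stickMeasure hU, atomSum] at hgi ⊢
  refine (hasSum_integral_measure hgi).congr_fun fun j => ?_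
  rw [integral_smul_measure, integral_dirac' _ _ hg.stronglyMeasurable,
    ENNReal.toReal_ofReal (stick_pos hU j).le, smul_eq_mul]

/-- The weighted sum of `h` over the atoms up to the `i`-th one which corresponds to the derivative
in the direction of the `i`-th stick. -/
def stickSum (i : ℕ) (h : ProbabilityMeasure S × S → ℝ) (z : (ℕ → ℝ) × (ℕ → S)) : ℝ :=
  ∑ j ∈ Finset.range (i + 1), stick (Function.update z.1 i 1) j * h (stickMeasure z, z.2 j)

theorem measurable_stickSum (i : ℕ) {h : ProbabilityMeasure S × S → ℝ} (hh : Measurable h) :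
    Measurable (stickSum i h) := by
  refine Finset.measurable_sum _ fun j _ => Measurable.mul ?_ ?_
  · have h1 : Measurable fun z : (ℕ → ℝ) × (ℕ → S) => Function.update z.1 i 1 :=
      measurable_update_left.comp measurable_fst
    exact (measurable_pi_apply j).comp (measurable_stick.comp h1)
  · exact hh.comp (measurable_stickMeasure.prodMk ((measurable_pi_apply j).comp measurable_snd))

theorem stickSum_sub (i : ℕ) (g h : ProbabilityMeasure S × S → ℝ) (z : (ℕ → ℝ) × (ℕ → S)) :
    stickSum i (fun p => g p - h p) z = stickSum i g z - stickSum i h z := by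
  simp only [stickSum, mul_sub, Finset.sum_sub_distrib]

/-- Replacing `Uᵢ` by `1` enlarges only the `i`-th retained weight, by the factor `1/Uᵢ`.
Multiplication by `Uᵢ` thus brings the sum below the average of `|h|` over the atoms. -/
theorem enorm_stickSum_mul_le (i : ℕ) (h : ProbabilityMeasure S × S → ℝ)
    {z : (ℕ → ℝ) × (ℕ → S)} (hz : z.1 ∈ goodSticks) :
    ‖stickSum i h z‖ₑ * ENNReal.ofReal (z.1 i) ≤
      ∑' j, ENNReal.ofReal (stick z.1 j) * ‖h (stickMeasure z, z.2 j)‖ₑ := by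
  refine le_trans ?_ (ENNReal.sum_le_tsum (Finset.range (i + 1)))
  refine (mul_le_mul_left (enorm_sum_le _ _) _).trans ?_
  rw [Finset.sum_mul]
  refine Finset.sum_le_sum fun j hj => ?_
  obtain ⟨h1, h2⟩ := stick_update_one_mul_le hz (Nat.lt_succ_iff.1 (Finset.mem_range.1 hj))
  rw [enorm_mul, mul_right_comm, Real.enorm_eq_ofReal h1, ← ENNReal.ofReal_mul h1]
  gcongr

/-- The derivative of a cylinder function with respect to the `i`-th stick. -/
theorem exists_hasDeriv_stick (F : Cyl S) {U : ℕ → ℝ} (hU : U ∈ goodSticks) (ξ : ℕ → S) (i : ℕ) :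
    ∃ f : ℝ → ℝ, ContDiff ℝ 1 f ∧ ∀ u ∈ Set.Ioo (0 : ℝ) 1,
      f u = F.eval (stickMeasure (Function.update U i u, ξ)) ∧
      (1 - u) * deriv f u = stickSum i F.dir (Function.update U i u, ξ) := by
  have hi : 0 < 1 - U i := sub_pos.2 (hU.1 i).2
  set c := F.coords (stickMeasure (U, ξ)) with hc
  let m : Fin F.d → ℝ := fun l =>
    ∑ j ∈ Finset.range (i + 1), stick (Function.update U i 1) j * F.φ l (ξ j)
  -- The coordinates run along a line from `c` at `u = Uᵢ` to `m` at `u = 1`. The line is smooth on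
  -- all of `ℝ`, though it represents measures only for `u` in `(0, 1)`.
  let γ : ℝ → Fin F.d → ℝ := fun u => ((1 - u) / (1 - U i)) • c + ((u - U i) / (1 - U i)) • m
  have hcoords : ∀ u ∈ Set.Ioo (0 : ℝ) 1,
      F.coords (stickMeasure (Function.update U i u, ξ)) = γ u := by
    intro u hu
    funext l
    have h1 := hasSum_integral_stickMeasure hU ξ (F.measurable_φ l) (F.integrable_φ _ l)
    have h2 := hasSum_integral_stickMeasure (update_mem_goodSticks hU i hu) ξ (F.measurable_φ l)
      (F.integrable_φ _ l)
    have h3 : HasSum (fun j => stick (Function.update U i 1) j * F.φ l (ξ j)) (m l) :=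
      hasSum_sum_of_ne_finset_zero fun j hj => by
        rw [stick_update_one_of_gt U (by simpa [Nat.lt_succ_iff] using hj), zero_mul]
    refine h2.unique (((h1.mul_left _).add (h3.mul_left _)).congr_fun fun j => ?_)
    rw [stick_update_affine U i j (hU.1 i).2 u]
    ring
  have hγd : ∀ u, HasDerivAt γ ((1 - U i)⁻¹ • (m - c)) u := by
    intro u
    have h1 : HasDerivAt (fun u : ℝ => (1 - u) / (1 - U i)) (-1 / (1 - U i)) u :=
      ((hasDerivAt_id u).const_sub 1).div_const _
    have h2 : HasDerivAt (fun u : ℝ => (u - U i) / (1 - U i)) (1 / (1 - U i)) u :=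
      ((hasDerivAt_id u).sub_const _).div_const _
    refine ((h1.smul_const c).add (h2.smul_const m)).congr_deriv ?_
    rw [smul_sub, neg_div, neg_smul, one_div]
    abel
  have hγ : ContDiff ℝ 1 γ := by
    simp only [γ]
    fun_prop
  have hd : ∀ u, HasDerivAt (fun u => F.f (γ u))
      (fderiv ℝ F.f (γ u) ((1 - U i)⁻¹ • (m - c))) u := fun u =>
    (F.differentiable_f _).hasFDerivAt.comp_hasDerivAt u (hγd u)
  refine ⟨fun u => F.f (γ u), (F.smooth_f.of_le (by simp)).comp hγ, fun u hu => ⟨?_, ?_⟩⟩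
  · rw [Cyl.eval, hcoords u hu]
  · rw [(hd u).deriv, stickSum]
    simp only [Cyl.dir, hcoords u hu, Function.update_idem, ← smul_eq_mul, ← map_smul]
    rw [← map_sum]
    congr 1
    have h1 : ∀ l, γ u l = (1 - u) / (1 - U i) * c l + (u - U i) / (1 - U i) * m l := fun l => rfl
    funext l
    rw [Finset.sum_apply]
    simp only [Pi.smul_apply, smul_eq_mul, Pi.sub_apply, mul_sub, Finset.sum_sub_distrib]
    -- The retained weights sum to one, so the centred inner functions add up to `m - γ u`, which is
    -- `1 - u` times the velocity of `γ`.
    rw [← Finset.sum_mul, sum_stick_update_one, h1]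
    change _ = m l - _
    field_simp
    ring

/-! ### Closability of the gradient -/

section Closable

variable {θ : ℝ} (hθ : -(1 / 2) < θ) (ν₀ : Measure S) [IsProbabilityMeasure ν₀]

include hθ

/-- The coordinates are independent, so replacing `Uᵢ` by an independent copy leaves the joint law
unchanged. Statements about one stick can then be proved with all else frozen. -/
theorem lintegral_inputLaw_update (i : ℕ) {k : (ℕ → ℝ) × (ℕ → S) → ℝ≥0∞} (hk : Measurable k) :
    ∫⁻ z, k z ∂inputLaw (1 / 2) θ ν₀ =
      ∫⁻ z, ∫⁻ u, k (Function.update z.1 i u, z.2) ∂stickBeta θ i ∂inputLaw (1 / 2) θ ν₀ := by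
  have := isProbabilityMeasure_stickBeta hθ
  have h0 : Measurable fun U : ℕ → ℝ =>
      ∫⁻ ξ, k (U, ξ) ∂(Measure.infinitePi fun _ : ℕ => ν₀) := hk.lintegral_prod_right'
  have hupd : Measurable fun q : (ℕ → ℝ) × ℝ => Function.update q.1 i q.2 := measurable_update'
  have h1 : Measurable fun q : ((ℕ → ℝ) × (ℕ → S)) × ℝ =>
      k (Function.update q.1.1 i q.2, q.1.2) :=
    hk.comp ((hupd.comp ((measurable_fst.comp measurable_fst).prodMk measurable_snd)).prodMk
      (measurable_snd.comp measurable_fst))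
  rw [inputLaw_eq, lintegral_prod _ hk.aemeasurable,
    lintegral_prod _ h1.lintegral_prod_right'.aemeasurable]
  conv_lhs => rw [← map_update_infinitePi (stickBeta θ) i]
  have h2 : Measurable fun q : (ℕ → ℝ) × ℝ =>
      ∫⁻ ξ, k (Function.update q.1 i q.2, ξ) ∂(Measure.infinitePi fun _ : ℕ => ν₀) := h0.comp hupd
  rw [lintegral_map h0 hupd, lintegral_prod _ h2.aemeasurable]
  refine lintegral_congr fun U => ?_
  rw [lintegral_lintegral_swap]
  exact (hk.comp ((hupd.comp ((measurable_const (a := U)).prodMk measurable_fst)).prodMk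
    measurable_snd)).aemeasurable

theorem lintegral_stickSum_le (i : ℕ) {h : ProbabilityMeasure S × S → ℝ} (hh : Measurable h) :
    ∫⁻ z, ‖stickSum i h z‖ₑ * ENNReal.ofReal (z.1 i) ∂inputLaw (1 / 2) θ ν₀ ≤
      ∫⁻ p, ‖h p‖ₑ ∂pairLaw (dirichletProcess (1 / 2) θ ν₀) := by
  rw [lintegral_pairLaw hθ ν₀ hh.enorm]
  refine lintegral_mono_ae ?_
  filter_upwards [ae_fst_mem_goodSticks hθ ν₀] with z hz
  exact enorm_stickSum_mul_le i h hz

/-- If `Fₙ → 0` and the gradients of `Fₙ` converge to `w`, then the derivative of `w` along the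
`i`-th stick vanishes. -/
theorem ae_stickSum_eq_zero (F : ℕ → Cyl S) {w : ProbabilityMeasure S × S → ℝ} (hw : Measurable w)
    (hwfin : ∫⁻ p, ‖w p‖ₑ ∂pairLaw (dirichletProcess (1 / 2) θ ν₀) ≠ ⊤)
    (h1 : Tendsto (fun n => ∫⁻ μ, ‖(F n).eval μ‖ₑ ∂(dirichletProcess (1 / 2) θ ν₀)) atTop (𝓝 0))
    (h2 : Tendsto (fun n => ∫⁻ p, ‖(F n).dir p - w p‖ₑ
      ∂pairLaw (dirichletProcess (1 / 2) θ ν₀)) atTop (𝓝 0)) (i : ℕ) :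
    ∀ᵐ z ∂inputLaw (1 / 2) θ ν₀, stickSum i w z = 0 := by
  have := isProbabilityMeasure_stickBeta hθ
  have := isProbabilityMeasure_inputLaw hθ ν₀
  set Q := inputLaw (1 / 2) θ ν₀
  have hzi : Measurable fun z : (ℕ → ℝ) × (ℕ → S) => ENNReal.ofReal (z.1 i) :=
    ((measurable_pi_apply i).comp measurable_fst).ennreal_ofReal
  let k : ℕ → (ℕ → ℝ) × (ℕ → S) → ℝ≥0∞ := fun n z => ‖(F n).eval (stickMeasure z)‖ₑ +
    ‖stickSum i (F n).dir z - stickSum i w z‖ₑ * ENNReal.ofReal (z.1 i)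
  have hk : ∀ n, Measurable (k n) := fun n =>
    ((F n).measurable_eval.comp measurable_stickMeasure).enorm.add
      (((measurable_stickSum i (F n).measurable_dir).sub (measurable_stickSum i hw)).enorm.mul hzi)
  have hk0 : Tendsto (fun n => ∫⁻ z, k n z ∂Q) atTop (𝓝 0) := by
    have h3 := h1.add h2
    rw [add_zero] at h3
    refine tendsto_of_tendsto_of_tendsto_of_le_of_le tendsto_const_nhds h3 (fun _ => bot_le)
      fun n => ?_
    simp only [k]
    have h5 : Measurable fun z : (ℕ → ℝ) × (ℕ → S) => ‖(F n).eval (stickMeasure z)‖ₑ :=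
      ((F n).measurable_eval.comp measurable_stickMeasure).enorm
    rw [lintegral_add_left h5,
      lintegral_dirichletProcess hθ ν₀ (F n).measurable_eval.enorm]
    gcongr
    have h4 := lintegral_stickSum_le hθ ν₀ i (h := fun p => (F n).dir p - w p)
      ((F n).measurable_dir.sub hw)
    simpa only [stickSum_sub] using h4
  have hupd : Measurable fun q : ((ℕ → ℝ) × (ℕ → S)) × ℝ =>
      (Function.update q.1.1 i q.2, q.1.2) := by
    have h3 : Measurable fun q : (ℕ → ℝ) × ℝ => Function.update q.1 i q.2 := measurable_update'
    exact (h3.comp ((measurable_fst.comp measurable_fst).prodMk measurable_snd)).prodMk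
      (measurable_snd.comp measurable_fst)
  let a : ℕ → (ℕ → ℝ) × (ℕ → S) → ℝ≥0∞ := fun n z =>
    ∫⁻ u, k n (Function.update z.1 i u, z.2) ∂stickBeta θ i
  have ha : ∀ n, Measurable (a n) := fun n => ((hk n).comp hupd).lintegral_prod_right'
  -- Fatou's lemma replaces a subsequence: for almost every frozen configuration the one-dimensional
  -- error is small along infinitely many `n`.
  have hliminf : ∀ᵐ z ∂Q, liminf (fun n => a n z) atTop = 0 := by
    have h3 : ∫⁻ z, liminf (fun n => a n z) atTop ∂Q ≤ liminf (fun n => ∫⁻ z, a n z ∂Q) atTop :=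
      lintegral_liminf_le ha
    have h4 : liminf (fun n => ∫⁻ z, a n z ∂Q) atTop = 0 := by
      refine Tendsto.liminf_eq (hk0.congr fun n => ?_)
      exact lintegral_inputLaw_update hθ ν₀ i (hk n)
    rw [h4] at h3
    have h5 : Measurable fun z => liminf (fun n => a n z) atTop := Measurable.liminf ha
    exact (lintegral_eq_zero_iff h5).1 (le_antisymm h3 bot_le)
  have hfin : ∀ᵐ z ∂Q, ∫⁻ u, ‖stickSum i w (Function.update z.1 i u, z.2)‖ₑ * ENNReal.ofReal u
      ∂stickBeta θ i ≠ ⊤ := by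
    have hm : Measurable fun z => ‖stickSum i w z‖ₑ * ENNReal.ofReal (z.1 i) :=
      (measurable_stickSum i hw).enorm.mul hzi
    have h3 := lintegral_inputLaw_update hθ ν₀ i hm
    simp only [Function.update_self] at h3
    have h4 : ∫⁻ z, ∫⁻ u, ‖stickSum i w (Function.update z.1 i u, z.2)‖ₑ * ENNReal.ofReal u
        ∂stickBeta θ i ∂Q ≠ ⊤ := by
      rw [← h3]
      exact ((lintegral_stickSum_le hθ ν₀ i hw).trans_lt hwfin.lt_top).ne
    have h5 : Measurable fun z : (ℕ → ℝ) × (ℕ → S) =>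
        ∫⁻ u, ‖stickSum i w (Function.update z.1 i u, z.2)‖ₑ * ENNReal.ofReal u ∂stickBeta θ i :=
      Measurable.lintegral_prod_right' (f := fun q : ((ℕ → ℝ) × (ℕ → S)) × ℝ =>
        ‖stickSum i w (Function.update q.1.1 i q.2, q.1.2)‖ₑ * ENNReal.ofReal q.2)
        (((measurable_stickSum i hw).comp hupd).enorm.mul measurable_snd.ennreal_ofReal)
    filter_upwards [ae_lt_top h5 h4] with z hz using hz.ne
  have hupd0 : ∀ᵐ z ∂Q, ∫⁻ u, ‖stickSum i w (Function.update z.1 i u, z.2)‖ₑ ∂stickBeta θ i = 0 := by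
    filter_upwards [ae_fst_mem_goodSticks hθ ν₀, hliminf, hfin] with z hz hzl hzf
    have hmz : Measurable fun u : ℝ => stickSum i w (Function.update z.1 i u, z.2) :=
      ((measurable_stickSum i hw).comp hupd).comp (measurable_prodMk_left (x := z))
    have h3 := ae_eq_zero_of_approx_deriv (a := 1 - 1 / 2) (by norm_num) (stickBeta_pos hθ i)
      hmz hzf (fun ε hε => by
        have h4 : ∃ᶠ n in atTop, a n z < ε :=
          frequently_lt_of_liminf_lt (by isBoundedDefault) (hzl.trans_lt hε)
        obtain ⟨n, hn⟩ := h4.exists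
        obtain ⟨f, hf, hfu⟩ := exists_hasDeriv_stick (F n) hz z.2 i
        refine ⟨f, hf, lt_of_le_of_lt (le_of_eq ?_) hn⟩
        refine lintegral_congr_ae ?_
        filter_upwards [ae_betaMeasure_mem_Ioo (1 - 1 / 2) (θ + ((i : ℝ) + 1) * (1 / 2))] with u hu
        simp only [k, Function.update_self, ← (hfu u hu).1, ← (hfu u hu).2])
    rw [lintegral_eq_zero_iff hmz.enorm]
    filter_upwards [h3] with u hu
    simp [hu]
  have hzero : ∫⁻ z, ‖stickSum i w z‖ₑ ∂Q = 0 := by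
    rw [lintegral_inputLaw_update hθ ν₀ i (measurable_stickSum i hw).enorm, lintegral_congr_ae hupd0]
    simp
  rw [lintegral_eq_zero_iff (measurable_stickSum i hw).enorm] at hzero
  filter_upwards [hzero] with z hz
  simpa using hz

/-- The gradient is closable. -/
theorem ae_eq_zero_of_tendsto_dir (F : ℕ → Cyl S) {w : ProbabilityMeasure S × S → ℝ}
    (hw : Measurable w)
    (hwfin : ∫⁻ p, ‖w p‖ₑ ∂pairLaw (dirichletProcess (1 / 2) θ ν₀) ≠ ⊤)
    (h1 : Tendsto (fun n => ∫⁻ μ, ‖(F n).eval μ‖ₑ ∂(dirichletProcess (1 / 2) θ ν₀)) atTop (𝓝 0))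
    (h2 : Tendsto (fun n => ∫⁻ p, ‖(F n).dir p - w p‖ₑ
      ∂pairLaw (dirichletProcess (1 / 2) θ ν₀)) atTop (𝓝 0)) :
    w =ᵐ[pairLaw (dirichletProcess (1 / 2) θ ν₀)] 0 := by
  have h3 : ∀ᵐ z ∂inputLaw (1 / 2) θ ν₀, ∀ i, stickSum i w z = 0 :=
    ae_all_iff.2 fun i => ae_stickSum_eq_zero hθ ν₀ F hw hwfin h1 h2 i
  have h4 : ∀ᵐ z ∂inputLaw (1 / 2) θ ν₀, ∀ i, w (stickMeasure z, z.2 i) = 0 := by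
    filter_upwards [h3, ae_fst_mem_goodSticks hθ ν₀] with z hz hzg i
    -- Triangular elimination: once `w` vanishes at the earlier atoms, `stickSum i w` is `w` at the
    -- `i`-th atom times the positive factor `∏_{l<i} (1 - U_l)`.
    induction i using Nat.strong_induction_on with
    | _ i ih =>
      have h5 := hz i
      rw [stickSum, Finset.sum_range_succ, Finset.sum_eq_zero fun j hj => by
        rw [ih j (Finset.mem_range.1 hj), mul_zero], zero_add, stick_update_self, one_mul] at h5
      have h6 : ∏ l ∈ Finset.range i, (1 - z.1 l) ≠ 0 :=
        (Finset.prod_pos fun l _ => sub_pos.2 (hzg.1 l).2).ne'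
      exact (mul_eq_zero.1 h5).resolve_left h6
  have h5 : ∫⁻ p, ‖w p‖ₑ ∂pairLaw (dirichletProcess (1 / 2) θ ν₀) = 0 := by
    rw [lintegral_pairLaw hθ ν₀ hw.enorm, lintegral_congr_ae (g := fun _ => 0), lintegral_zero]
    filter_upwards [h4] with z hz
    simp [hz]
  rw [lintegral_eq_zero_iff hw.enorm] at h5
  filter_upwards [h5] with p hp
  simpa using hp

end Closable

end

end TwoParam

namespace TwoParam

noncomputable section

/-! ### Approximation by step functions -/

variable {S : Type*} [MeasurableSpace S]

namespace DyadicPartition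

variable {ν₀ : Measure S} (D : DyadicPartition ν₀)

theorem exists_mem_B (k : ℕ) (x : S) : ∃ j, x ∈ D.B k j := by
  have h : x ∈ ⋃ j, D.B k j := by rw [D.cover k]; trivial
  simpa using h

/-- The index of the set of the `k`-th partition which contains `x`. -/
def idx (k : ℕ) (x : S) : Fin (2 ^ k) := (D.exists_mem_B k x).choose

theorem mem_B_idx (k : ℕ) (x : S) : x ∈ D.B k (D.idx k x) := (D.exists_mem_B k x).choose_spec

theorem mem_B_iff {k : ℕ} {j : Fin (2 ^ k)} {x : S} : x ∈ D.B k j ↔ D.idx k x = j := by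
  refine ⟨fun h => ?_, fun h => h ▸ D.mem_B_idx k x⟩
  by_contra hne
  exact Set.disjoint_left.1 (D.disjoint_B k _ _ hne) (D.mem_B_idx k x) h

theorem preimage_idx (k : ℕ) (j : Fin (2 ^ k)) : D.idx k ⁻¹' {j} = D.B k j := by
  ext x
  simp [D.mem_B_iff]

theorem measurable_idx (k : ℕ) : Measurable (D.idx k) :=
  measurable_to_countable' fun j => by
    rw [D.preimage_idx]
    exact D.measurableSet_B k j

theorem idx_eq_half (k : ℕ) (x : S) : D.idx k x =
    ⟨(D.idx (k + 1) x : ℕ) / 2, by have := (D.idx (k + 1) x).2; have := pow_succ 2 k; omega⟩ := by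
  have h := D.mem_B_idx k x
  rw [D.refine_B, Set.mem_union, D.mem_B_iff, D.mem_B_iff] at h
  apply Fin.ext
  rcases h with h | h
  · simp only [h]
    omega
  · simp only [h]
    omega

/-- The filtration of the partitions. -/
def filtration : Filtration ℕ (inferInstance : MeasurableSpace S) where
  seq k := MeasurableSpace.comap (D.idx k) ⊤
  mono' := by
    refine monotone_nat_of_le_succ fun k => ?_
    have h : D.idx k = (fun j : Fin (2 ^ (k + 1)) => (⟨(j : ℕ) / 2, by
        have := j.2; have := pow_succ 2 k; omega⟩ : Fin (2 ^ k))) ∘ D.idx (k + 1) :=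
      funext fun x => D.idx_eq_half k x
    rw [h, ← MeasurableSpace.comap_comp]
    exact MeasurableSpace.comap_mono le_top
  le' k := (D.measurable_idx k).comap_le

theorem generateFrom_le_iSup :
    MeasurableSpace.generateFrom {C | ∃ k j, C = D.B k j} ≤ ⨆ k, D.filtration k := by
  refine MeasurableSpace.generateFrom_le ?_
  rintro _ ⟨k, j, rfl⟩
  refine le_iSup (fun k => (D.filtration k : MeasurableSpace S)) k _ ?_
  exact ⟨{j}, trivial, D.preimage_idx k j⟩

/-- Every measurable set agrees up to a null set with one generated by the partitions, so the two
functions have equal integrals over all measurable sets. -/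
theorem condExp_iSup_ae_eq [IsProbabilityMeasure ν₀] (hD : D.Generating) {φ : S → ℝ}
    (hφ : Integrable φ ν₀) : ν₀[φ | ⨆ k, D.filtration k] =ᵐ[ν₀] φ := by
  refine Integrable.ae_eq_of_forall_setIntegral_eq _ _ integrable_condExp hφ fun A hA _ => ?_
  obtain ⟨A', hA', hAA'⟩ := hD A hA
  rw [setIntegral_congr_set hAA', setIntegral_congr_set hAA',
    setIntegral_condExp (iSup_le fun k => D.filtration.le k) hφ (D.generateFrom_le_iSup _ hA')]

/-- Lévy's upward theorem for conditional expectations on the partitions. Clipping to `[-C, C]`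
makes the bound hold everywhere and does not increase the distance to `φ`. -/
theorem exists_approx [IsProbabilityMeasure ν₀] (hD : D.Generating) {φ : S → ℝ}
    (hφ : Measurable φ) {C : ℝ} (hC : ∀ x, |φ x| ≤ C) :
    ∃ h : (k : ℕ) → Fin (2 ^ k) → ℝ, (∀ k j, |h k j| ≤ C) ∧
      Tendsto (fun k => ∫⁻ x, ‖h k (D.idx k x) - φ x‖ₑ ∂ν₀) atTop (𝓝 0) := by
  have hint : Integrable φ ν₀ :=
    Integrable.of_bound hφ.aestronglyMeasurable C (Eventually.of_forall hC)
  have hfac : ∀ k, ∃ h : Fin (2 ^ k) → ℝ, ν₀[φ | D.filtration k] = h ∘ D.idx k := fun k => by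
    obtain ⟨h, -, hh⟩ := StronglyMeasurable.exists_eq_measurable_comp (mY := ⊤) (f := D.idx k)
      (stronglyMeasurable_condExp (m := D.filtration k) (μ := ν₀) (f := φ))
    exact ⟨h, hh⟩
  choose h hh using hfac
  obtain ⟨x₀⟩ : Nonempty S := nonempty_of_isProbabilityMeasure ν₀
  have hC0 : 0 ≤ C := (abs_nonneg _).trans (hC x₀)
  refine ⟨fun k j => max (-C) (min C (h k j)), fun k j => ?_, ?_⟩
  · rw [abs_le]
    exact ⟨le_max_left _ _, max_le (by linarith) (min_le_left _ _)⟩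
  · have h1 := tendsto_eLpNorm_condExp (μ := ν₀) (ℱ := D.filtration) φ
    refine tendsto_of_tendsto_of_tendsto_of_le_of_le tendsto_const_nhds h1 (fun _ => bot_le)
      fun k => ?_
    simp only [eLpNorm_one_eq_lintegral_enorm]
    refine lintegral_mono_ae ?_
    filter_upwards [D.condExp_iSup_ae_eq hD hint] with x hx
    rw [Pi.sub_apply, hx, hh, Function.comp_apply, ← ofReal_norm, ← ofReal_norm]
    refine ENNReal.ofReal_le_ofReal ?_
    have h2 : φ x = max (-C) (min C (φ x)) := by
      have := abs_le.1 (hC x)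
      rw [min_eq_right this.2, max_eq_right this.1]
    conv_lhs => rw [h2]
    rw [Real.norm_eq_abs, Real.norm_eq_abs]
    refine (abs_max_sub_max_le_max _ _ _ _).trans ?_
    rw [sub_self, abs_zero, max_eq_right (abs_nonneg _)]
    refine (abs_min_sub_min_le_max _ _ _ _).trans ?_
    rw [sub_self, abs_zero, max_eq_right (abs_nonneg _)]

end DyadicPartition

/-- The cylinder function with the same outer function and with other inner functions. -/
def Cyl.replace (F : Cyl S) (ψ : Fin F.d → S → ℝ) (hψ : ∀ i, Measurable (ψ i))
    (hb : ∀ i, ∃ C, ∀ x, |ψ i x| ≤ C) : Cyl S where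
  d := F.d
  φ := ψ
  measurable_φ := hψ
  bounded_φ := hb
  f := F.f
  smooth_f := F.smooth_f

theorem Cyl.coords_eq_integral (F : Cyl S) (μ : ProbabilityMeasure S) :
    F.coords μ = ∫ x, (fun i => F.φ i x) ∂(μ : Measure S) := by
  ext i
  rw [eval_integral (F.integrable_φ μ)]
  rfl

theorem Cyl.coords_affine {F G : Cyl S} {b : Fin G.d → ℝ} {L : (Fin F.d → ℝ) →L[ℝ] (Fin G.d → ℝ)}
    (hφ : ∀ x, (fun i => G.φ i x) = b + L fun j => F.φ j x) (μ : ProbabilityMeasure S) :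
    G.coords μ = b + L (F.coords μ) := by
  have h : Integrable (fun x j => F.φ j x) (μ : Measure S) := Integrable.of_eval (F.integrable_φ μ)
  have hG : (fun x i => G.φ i x) = fun x => b + L fun j => F.φ j x := funext hφ
  rw [G.coords_eq_integral, F.coords_eq_integral, hG,
    integral_add (integrable_const _) (L.integrable_comp h), L.integral_comp_comm h]
  simp

/-- Integration against a probability measure commutes with affine maps. By the chain rule the
derivatives agree too, as the constant cancels in the direction `δₓ - μ`. -/
theorem Cyl.eval_dir_affine {F G : Cyl S} {b : Fin G.d → ℝ}
    {L : (Fin F.d → ℝ) →L[ℝ] (Fin G.d → ℝ)}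
    (hφ : ∀ x, (fun i => G.φ i x) = b + L fun j => F.φ j x) (hf : F.f = fun y => G.f (b + L y)) :
    F.eval = G.eval ∧ F.dir = G.dir := by
  refine ⟨funext fun μ => ?_, funext fun p => ?_⟩
  · rw [Cyl.eval, Cyl.eval, coords_affine hφ, hf]
  · have h1 : HasFDerivAt (fun y => G.f (b + L y))
        ((fderiv ℝ G.f (b + L (F.coords p.1))).comp L) (F.coords p.1) :=
      (G.differentiable_f _).hasFDerivAt.comp (F.coords p.1) (L.hasFDerivAt.const_add b)
    rw [← hf] at h1
    rw [F.dir_of_hasFDerivAt p h1, Cyl.dir, ContinuousLinearMap.comp_apply, coords_affine hφ]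
    congr 1
    have h2 : (fun j => F.φ j p.2 - F.coords p.1 j) = (fun j => F.φ j p.2) - F.coords p.1 := rfl
    have h3 : (fun i => G.φ i p.2 - (b + L (F.coords p.1)) i) =
        (fun i => G.φ i p.2) - (b + L (F.coords p.1)) := rfl
    rw [h2, h3, map_sub, hφ]
    abel

/-! ### Step functions and the projection classes. -/

namespace DyadicPartition

variable {ν₀ : Measure S} (D : DyadicPartition ν₀)

/-- The projection class omits the mass of the last cell. As the indicators sum to one, the last
value becomes the constant term and the others enter as differences from it. -/
theorem apply_idx_eq (k : ℕ) (h : Fin (2 ^ k) → ℝ) (x : S) :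
    h (D.idx k x) = h ⟨2 ^ k - 1, Nat.sub_lt (by positivity) one_pos⟩ +
      ∑ j : Fin (2 ^ k - 1), (h (Fin.castLE (Nat.sub_le _ _) j) -
        h ⟨2 ^ k - 1, Nat.sub_lt (by positivity) one_pos⟩) *
          (D.B k (Fin.castLE (Nat.sub_le _ _) j)).indicator (fun _ => 1) x := by
  by_cases hx : (D.idx k x : ℕ) < 2 ^ k - 1
  · rw [Finset.sum_eq_single ⟨D.idx k x, hx⟩]
    · have h1 : Fin.castLE (Nat.sub_le _ _) (⟨D.idx k x, hx⟩ : Fin (2 ^ k - 1)) = D.idx k x := rfl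
      rw [h1, Set.indicator_of_mem (D.mem_B_idx k x)]
      ring
    · intro j _ hj
      rw [Set.indicator_of_notMem, mul_zero]
      rw [D.mem_B_iff]
      intro hj'
      apply hj
      apply Fin.ext
      simp [hj']
    · simp
  · have h1 : D.idx k x = ⟨2 ^ k - 1, Nat.sub_lt (by positivity) one_pos⟩ := by
      apply Fin.ext
      have := (D.idx k x).2
      simp only
      omega
    rw [Finset.sum_eq_zero, add_zero, h1]
    intro j _
    rw [Set.indicator_of_notMem, mul_zero]
    rw [D.mem_B_iff, h1]
    intro hj
    have h2 := congrArg Fin.val hj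
    have := j.2
    simp only [Fin.val_castLE] at h2
    omega

/-- A cylinder function over step functions of level `k` belongs to the `k`-th projection class. -/
theorem exists_mem_cylSet (k : ℕ) (F : Cyl S) (h : Fin F.d → Fin (2 ^ k) → ℝ)
    (hm : ∀ i, Measurable fun x => h i (D.idx k x))
    (hb : ∀ i, ∃ C, ∀ x, |h i (D.idx k x)| ≤ C) :
    ∃ E ∈ D.cylSet k, E.eval = (F.replace (fun i x => h i (D.idx k x)) hm hb).eval ∧
      E.dir = (F.replace (fun i x => h i (D.idx k x)) hm hb).dir := by
  let b : Fin F.d → ℝ := fun i => h i ⟨2 ^ k - 1, Nat.sub_lt (by positivity) one_pos⟩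
  let L : (Fin (2 ^ k - 1) → ℝ) →L[ℝ] (Fin F.d → ℝ) := ContinuousLinearMap.pi fun i =>
    ∑ j, (h i (Fin.castLE (Nat.sub_le _ _) j) - b i) • ContinuousLinearMap.proj j
  have hf : ContDiff ℝ ∞ fun y => F.f (b + L y) :=
    F.smooth_f.comp (contDiff_const.add L.contDiff)
  refine ⟨D.cyl k _ hf, ⟨_, hf, rfl⟩, Cyl.eval_dir_affine (F := D.cyl k _ hf)
    (G := F.replace (fun i x => h i (D.idx k x)) hm hb) (b := b) (L := L) (fun x => ?_) rfl⟩
  funext i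
  refine (D.apply_idx_eq k (h i) x).trans ?_
  change _ = b i + L (fun j => (D.B k (Fin.castLE (Nat.sub_le _ _) j)).indicator (fun _ => 1) x) i
  simp [L, b]

end DyadicPartition

end

end TwoParam

namespace TwoParam

noncomputable section

variable {S : Type*} [MeasurableSpace S]

/-! ### Convergence of cylinder functions -/

/-- Composition with a smooth function turns `L¹`-convergence of bounded functions into
`L²`-convergence. -/
theorem tendsto_eLpNorm_comp {α E : Type*} [MeasurableSpace α] {m : Measure α}
    [NormedAddCommGroup E] [NormedSpace ℝ E] [ProperSpace E] {g : E → ℝ} (hg : ContDiff ℝ 1 g)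
    {R : ℝ} {e : α → E} {en : ℕ → α → E} (he : ∀ p, ‖e p‖ ≤ R) (hen : ∀ n p, ‖en n p‖ ≤ R)
    (h : Tendsto (fun n => ∫⁻ p, ‖en n p - e p‖ₑ ∂m) atTop (𝓝 0)) :
    Tendsto (fun n => eLpNorm ((fun p => g (en n p)) - fun p => g (e p)) 2 m) atTop (𝓝 0) := by
  obtain ⟨K, hK⟩ := (isCompact_closedBall (0 : E) R).exists_bound_of_continuousOn
    (hg.continuous_fderiv one_ne_zero).continuousOn
  have hlip : ∀ x y : E, ‖x‖ ≤ R → ‖y‖ ≤ R → ‖g x - g y‖ ≤ K * ‖x - y‖ := fun x y hx hy =>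
    (convex_closedBall (0 : E) R).norm_image_sub_le_of_norm_fderiv_le
      (fun z _ => hg.differentiable one_ne_zero z) hK (by simpa using hy) (by simpa using hx)
  -- One of the two factors in the square is bounded by `2R`; this is how `L¹` convergence becomes
  -- `L²` convergence.
  have hsq : ∀ n p, ‖g (en n p) - g (e p)‖ₑ ^ (2 : ℝ) ≤
      ENNReal.ofReal (K ^ 2 * (2 * R)) * ‖en n p - e p‖ₑ := by
    intro n p
    have h1 := hlip _ _ (hen n p) (he p)
    have h2 : ‖en n p - e p‖ ≤ 2 * R := (norm_sub_le _ _).trans (by linarith [hen n p, he p])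
    have hR : 0 ≤ 2 * R := (norm_nonneg _).trans h2
    rw [← ofReal_norm, ← ofReal_norm, ENNReal.ofReal_rpow_of_nonneg (norm_nonneg _) (by norm_num),
      ← ENNReal.ofReal_mul (by positivity)]
    refine ENNReal.ofReal_le_ofReal ?_
    rw [Real.rpow_two]
    calc ‖g (en n p) - g (e p)‖ ^ 2 ≤ (K * ‖en n p - e p‖) ^ 2 := by gcongr
      _ = K ^ 2 * (‖en n p - e p‖ * ‖en n p - e p‖) := by ring
      _ ≤ K ^ 2 * (2 * R * ‖en n p - e p‖) := by gcongr
      _ = _ := by ring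
  have hlim : Tendsto (fun n => (ENNReal.ofReal (K ^ 2 * (2 * R)) *
      ∫⁻ p, ‖en n p - e p‖ₑ ∂m) ^ (1 / (2 : ℝ))) atTop (𝓝 0) := by
    have h1 := (ENNReal.Tendsto.const_mul h (Or.inr ENNReal.ofReal_ne_top)
      (a := ENNReal.ofReal (K ^ 2 * (2 * R)))).ennrpow_const (1 / (2 : ℝ))
    simpa using h1
  refine tendsto_of_tendsto_of_tendsto_of_le_of_le tendsto_const_nhds hlim (fun _ => bot_le)
    fun n => ?_
  simp only
  rw [eLpNorm_eq_lintegral_rpow_enorm_toReal (by norm_num) (by norm_num), ENNReal.toReal_ofNat,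
    ← lintegral_const_mul' _ _ ENNReal.ofReal_ne_top]
  gcongr with p
  exact hsq n p

namespace Cyl

theorem enorm_coords_sub_le {F G : Cyl S} (μ : ProbabilityMeasure S) (i : Fin F.d) (j : Fin G.d) :
    ‖F.coords μ i - G.coords μ j‖ₑ ≤ ∫⁻ x, ‖F.φ i x - G.φ j x‖ₑ ∂(μ : Measure S) := by
  rw [coords, coords, ← integral_sub (F.integrable_φ μ i) (G.integrable_φ μ j)]
  exact enorm_integral_le_lintegral_enorm _

end Cyl

theorem enorm_pi_le_sum {ι : Type*} [Fintype ι] (v : ι → ℝ) : ‖v‖ₑ ≤ ∑ i, ‖v i‖ₑ := by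
  have h : ‖v‖ ≤ ∑ i, ‖v i‖ := by
    refine (pi_norm_le_iff_of_nonneg (Finset.sum_nonneg fun i _ => norm_nonneg _)).2 fun i => ?_
    exact Finset.single_le_sum (f := fun i => ‖v i‖) (fun i _ => norm_nonneg _) (Finset.mem_univ i)
  rw [← ofReal_norm]
  refine (ENNReal.ofReal_le_ofReal h).trans ?_
  rw [ENNReal.ofReal_sum_of_nonneg fun i _ => norm_nonneg _]
  simp_rw [ofReal_norm]
  rfl

/-! ### Approximation of cylinder functions and their gradients. -/

section Law

variable {θ : ℝ} (hθ : -(1 / 2) < θ) (ν₀ : Measure S) [IsProbabilityMeasure ν₀]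

include hθ

theorem lintegral_enorm_coords_sub_le {F : Cyl S} (ψ : Fin F.d → S → ℝ) (hψ : ∀ i, Measurable (ψ i))
    (hb : ∀ i, ∃ C, ∀ x, |ψ i x| ≤ C) :
    ∫⁻ μ, ‖fun i => (∫ x, ψ i x ∂(μ : Measure S)) - F.coords μ i‖ₑ ∂(dirichletProcess (1 / 2) θ ν₀) ≤
      ∑ i, ∫⁻ x, ‖ψ i x - F.φ i x‖ₑ ∂ν₀ := by
  have hm : ∀ i, Measurable fun x => ‖ψ i x - F.φ i x‖ₑ := fun i =>
    ((hψ i).sub (F.measurable_φ i)).enorm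
  have hm' : ∀ i, Measurable fun μ : ProbabilityMeasure S =>
      ∫⁻ x, ‖ψ i x - F.φ i x‖ₑ ∂(μ : Measure S) := fun i =>
    (Measure.measurable_lintegral (hm i)).comp measurable_subtype_coe
  calc ∫⁻ μ, ‖fun i => (∫ x, ψ i x ∂(μ : Measure S)) - F.coords μ i‖ₑ ∂(dirichletProcess (1 / 2) θ ν₀)
      ≤ ∫⁻ μ, ∑ i, ∫⁻ x, ‖ψ i x - F.φ i x‖ₑ ∂(μ : Measure S)
          ∂(dirichletProcess (1 / 2) θ ν₀) := by
        refine lintegral_mono fun μ => (enorm_pi_le_sum _).trans ?_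
        exact Finset.sum_le_sum fun i _ =>
          Cyl.enorm_coords_sub_le (F := F.replace ψ hψ hb) (G := F) μ i i
    _ = ∑ i, ∫⁻ x, ‖ψ i x - F.φ i x‖ₑ ∂ν₀ := by
        rw [lintegral_finsetSum _ fun i _ => hm' i]
        refine Finset.sum_congr rfl fun i _ => ?_
        rw [← snd_pairLaw hθ ν₀ (hm i)]
        exact (Measure.lintegral_compProd (κ := evalKernel S)
          (f := fun p : ProbabilityMeasure S × S => ‖ψ i p.2 - F.φ i p.2‖ₑ)
          ((hm i).comp measurable_snd)).symm

theorem lintegral_enorm_arg_sub_le {F : Cyl S} (ψ : Fin F.d → S → ℝ) (hψ : ∀ i, Measurable (ψ i))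
    (hb : ∀ i, ∃ C, ∀ x, |ψ i x| ≤ C) :
    ∫⁻ p, ‖(((fun i => ∫ x, ψ i x ∂(p.1 : Measure S), fun i => ψ i p.2) :
        (Fin F.d → ℝ) × (Fin F.d → ℝ)) - (F.coords p.1, fun i => F.φ i p.2))‖ₑ
          ∂pairLaw (dirichletProcess (1 / 2) θ ν₀) ≤
      (∑ i, ∫⁻ x, ‖ψ i x - F.φ i x‖ₑ ∂ν₀) + ∑ i, ∫⁻ x, ‖ψ i x - F.φ i x‖ₑ ∂ν₀ := by
  have hm : ∀ i, Measurable fun x => ‖ψ i x - F.φ i x‖ₑ := fun i =>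
    ((hψ i).sub (F.measurable_φ i)).enorm
  have hmc : Measurable fun μ : ProbabilityMeasure S =>
      ‖fun i => (∫ x, ψ i x ∂(μ : Measure S)) - F.coords μ i‖ₑ := by
    refine Measurable.enorm (measurable_pi_iff.2 fun i => ?_)
    exact (measurable_pi_iff.1 (F.replace ψ hψ hb).measurable_coords i).sub
      (measurable_pi_iff.1 F.measurable_coords i)
  calc _ ≤ ∫⁻ p, (‖fun i => (∫ x, ψ i x ∂(p.1 : Measure S)) - F.coords p.1 i‖ₑ +
          ∑ i, ‖ψ i p.2 - F.φ i p.2‖ₑ) ∂pairLaw (dirichletProcess (1 / 2) θ ν₀) := by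
        refine lintegral_mono fun p => ?_
        have h1 : ∀ q : (Fin F.d → ℝ) × (Fin F.d → ℝ), ‖q‖ₑ ≤ ‖q.1‖ₑ + ‖q.2‖ₑ := fun q => by
          rw [← ofReal_norm, ← ofReal_norm, ← ofReal_norm,
            ← ENNReal.ofReal_add (norm_nonneg _) (norm_nonneg _)]
          refine ENNReal.ofReal_le_ofReal ?_
          rw [Prod.norm_def]
          exact max_le (by linarith [norm_nonneg q.2]) (by linarith [norm_nonneg q.1])
        exact (h1 _).trans (add_le_add le_rfl (enorm_pi_le_sum _))
    _ ≤ _ := by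
        have hmc' : Measurable fun p : ProbabilityMeasure S × S =>
            ‖fun i => (∫ x, ψ i x ∂(p.1 : Measure S)) - F.coords p.1 i‖ₑ :=
          hmc.comp measurable_fst
        rw [lintegral_add_left hmc']
        refine add_le_add ?_ (le_of_eq ?_)
        · rw [Measure.lintegral_compProd hmc']
          simp only [lintegral_const, measure_univ, mul_one]
          exact lintegral_enorm_coords_sub_le hθ ν₀ ψ hψ hb
        · rw [lintegral_finsetSum (f := fun i (p : ProbabilityMeasure S × S) => ‖ψ i p.2 - F.φ i p.2‖ₑ)
            _ fun i _ => (hm i).comp measurable_snd]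
          exact Finset.sum_congr rfl fun i _ => snd_pairLaw hθ ν₀ (hm i)

variable {ν₀}

/-- Every cylinder function is approximated, together with its gradient, by elements of the
projection classes. -/
theorem exists_tendsto_cylSet {D : DyadicPartition ν₀} (hD : D.Generating) (F : Cyl S) :
    ∃ E : ℕ → Cyl S, (∀ k, E k ∈ D.cylSet k) ∧
      Tendsto (fun k => ((E k).toL2 (dirichletProcess (1 / 2) θ ν₀),
        (E k).dirL2 (dirichletProcess (1 / 2) θ ν₀))) atTop
        (𝓝 (F.toL2 (dirichletProcess (1 / 2) θ ν₀), F.dirL2 (dirichletProcess (1 / 2) θ ν₀))) := by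
  choose C hC using F.bounded_φ
  choose h hh hlim using fun i => D.exists_approx hD (F.measurable_φ i) (hC i)
  have hm : ∀ k i, Measurable fun x => h i k (D.idx k x) := fun k i =>
    (measurable_of_countable (h i k)).comp (D.measurable_idx k)
  have hb : ∀ k i x, |h i k (D.idx k x)| ≤ C i := fun k i x => hh i k _
  choose E hE hEe hEd using fun k => D.exists_mem_cylSet k F (fun i => h i k) (hm k)
    fun i => ⟨C i, hb k i⟩
  refine ⟨E, hE, ?_⟩
  set R := ∑ i, |C i| with hR
  have hR0 : 0 ≤ R := Finset.sum_nonneg fun i _ => abs_nonneg _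
  have hCR : ∀ i, C i ≤ R := fun i => (le_abs_self _).trans
    (Finset.single_le_sum (f := fun i => |C i|) (fun i _ => abs_nonneg _) (Finset.mem_univ i))
  let G : ℕ → Cyl S := fun k =>
    F.replace (fun i x => h i k (D.idx k x)) (hm k) fun i => ⟨C i, hb k i⟩
  have hF1 : ∀ μ, ‖F.coords μ‖ ≤ R := fun μ =>
    (pi_norm_le_iff_of_nonneg hR0).2 fun i => (F.abs_coords_le (hC i) μ).trans (hCR i)
  have hG1 : ∀ k μ, ‖(G k).coords μ‖ ≤ R := fun k μ =>
    (pi_norm_le_iff_of_nonneg hR0).2 fun i => ((G k).abs_coords_le (hb k i) μ).trans (hCR i)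
  have hF2 : ∀ x, ‖fun i => F.φ i x‖ ≤ R := fun x =>
    (pi_norm_le_iff_of_nonneg hR0).2 fun i => (hC i x).trans (hCR i)
  have hG2 : ∀ k x, ‖fun i => h i k (D.idx k x)‖ ≤ R := fun k x =>
    (pi_norm_le_iff_of_nonneg hR0).2 fun i => (hb k i x).trans (hCR i)
  have hsum : Tendsto (fun k => ∑ i, ∫⁻ x, ‖h i k (D.idx k x) - F.φ i x‖ₑ ∂ν₀) atTop (𝓝 0) := by
    have := tendsto_finsetSum (Finset.univ : Finset (Fin F.d)) fun i _ => hlim i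
    simpa using this
  refine Tendsto.prodMk_nhds ?_ ?_
  · refine (Lp.tendsto_Lp_iff_tendsto_eLpNorm'' _ (fun k => (E k).memLp_eval _) _
      (F.memLp_eval _)).2 ?_
    simp only [hEe]
    exact tendsto_eLpNorm_comp (E := Fin F.d → ℝ) (g := F.f) (e := F.coords)
      (en := fun k => (G k).coords) (F.smooth_f.of_le (by simp)) hF1 hG1
      (tendsto_of_tendsto_of_tendsto_of_le_of_le tendsto_const_nhds hsum (fun _ => bot_le)
        fun k => lintegral_enorm_coords_sub_le hθ ν₀ _ (hm k) fun i => ⟨C i, hb k i⟩)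
  · refine (Lp.tendsto_Lp_iff_tendsto_eLpNorm'' _ (fun k => (E k).memLp_dir _) _
      (F.memLp_dir _)).2 ?_
    simp only [hEd]
    -- The gradient is the smooth function `(c, v) ↦ f'(c)(v - c)` of the coordinates and the inner
    -- functions at `x`, so the same composition lemma covers it.
    have hg : ContDiff ℝ 1 fun q : (Fin F.d → ℝ) × (Fin F.d → ℝ) =>
        fderiv ℝ F.f q.1 (q.2 - q.1) :=
      ((F.smooth_f.fderiv_right (m := 1) (by norm_num; exact ENat.LEInfty.out)).comp contDiff_fst).clm_apply
        (contDiff_snd.sub contDiff_fst)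
    have hsum2 := hsum.add hsum
    rw [add_zero] at hsum2
    exact tendsto_eLpNorm_comp (E := (Fin F.d → ℝ) × (Fin F.d → ℝ)) hg
      (e := fun p : ProbabilityMeasure S × S => (F.coords p.1, fun i => F.φ i p.2))
      (en := fun k p => ((G k).coords p.1, fun i => h i k (D.idx k p.2)))
      (fun p => max_le (hF1 _) (hF2 _)) (fun k p => max_le (hG1 k _) (hG2 k _))
      (tendsto_of_tendsto_of_tendsto_of_le_of_le tendsto_const_nhds hsum2 (fun _ => bot_le)
        fun k => lintegral_enorm_arg_sub_le hθ ν₀ _ (hm k) fun i => ⟨C i, hb k i⟩)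

end Law

end

end TwoParam

namespace TwoParam

noncomputable section

variable {S : Type*} [MeasurableSpace S]

/-! ### Density of the cylinder functions -/

/-- The sets of probability measures which are given by finitely many lower bounds. -/
def lowerSets (S : Type*) [MeasurableSpace S] : Set (Set (ProbabilityMeasure S)) :=
  {A | ∃ (d : ℕ) (B : Fin d → Set S) (c : Fin d → ℝ), (∀ l, MeasurableSet (B l)) ∧
    A = {μ : ProbabilityMeasure S | ∀ l, c l < (μ : Measure S).real (B l)}}

theorem isPiSystem_lowerSets : IsPiSystem (lowerSets S) := by
  rintro _ ⟨d, B, c, hB, rfl⟩ _ ⟨d', B', c', hB', rfl⟩ -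
  refine ⟨d + d', Fin.append B B', Fin.append c c',
    Fin.addCases (by simpa using hB) (by simpa using hB'), ?_⟩
  ext μ
  simp only [Set.mem_inter_iff, Set.mem_ofPred_eq]
  refine ⟨fun h => Fin.addCases (by simpa using h.1) (by simpa using h.2), fun h => ⟨fun l => ?_,
    fun l => ?_⟩⟩
  · simpa using h (Fin.castAdd d' l)
  · simpa using h (Fin.natAdd d l)

theorem measurable_measureReal {B : Set S} (hB : MeasurableSet B) :
    Measurable fun μ : ProbabilityMeasure S => (μ : Measure S).real B :=
  ((Measure.measurable_coe hB).comp measurable_subtype_coe).ennreal_toReal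

theorem measurableSet_of_mem_lowerSets {A : Set (ProbabilityMeasure S)} (hA : A ∈ lowerSets S) :
    MeasurableSet A := by
  obtain ⟨d, B, c, hB, rfl⟩ := hA
  have h : {μ : ProbabilityMeasure S | ∀ l, c l < (μ : Measure S).real (B l)} =
      ⋂ l, {μ : ProbabilityMeasure S | c l < (μ : Measure S).real (B l)} := by
    ext μ
    simp
  rw [h]
  exact MeasurableSet.iInter fun l => measurableSet_lt measurable_const
    (measurable_measureReal (hB l))

/-- The σ-algebra is generated by the evaluations `μ ↦ μ(B)`, and half-lines `(c, ∞)` generate the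
Borel sets of the line. -/
theorem generateFrom_lowerSets :
    (inferInstance : MeasurableSpace (ProbabilityMeasure S)) =
      MeasurableSpace.generateFrom (lowerSets S) := by
  apply le_antisymm
  · have h1 : ∀ B : Set S, MeasurableSet B →
        Measurable[MeasurableSpace.generateFrom (lowerSets S)]
          fun μ : ProbabilityMeasure S => (μ : Measure S) B := by
      intro B hB
      have h2 : Measurable[MeasurableSpace.generateFrom (lowerSets S)]
          fun μ : ProbabilityMeasure S => (μ : Measure S).real B := by
        refine measurable_of_Ioi (mδ := MeasurableSpace.generateFrom (lowerSets S)) fun c => ?_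
        refine MeasurableSpace.measurableSet_generateFrom ⟨1, fun _ => B, fun _ => c,
          fun _ => hB, ?_⟩
        ext μ
        simp
      have h3 := @Measurable.ennreal_ofReal _ (MeasurableSpace.generateFrom (lowerSets S)) _ h2
      simpa using h3
    have h4 := @Measure.measurable_of_measurable_coe _ _ _
      (MeasurableSpace.generateFrom (lowerSets S)) (fun μ : ProbabilityMeasure S => (μ : Measure S))
      h1
    exact h4.comap_le
  · exact MeasurableSpace.generateFrom_le fun A hA => measurableSet_of_mem_lowerSets hA

/-- Smooth approximations of the indicator functions of sets in `lowerSets S`. -/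
def lowerCyl {d : ℕ} {B : Fin d → Set S} (hB : ∀ l, MeasurableSet (B l)) (c : Fin d → ℝ) (n : ℕ) :
    Cyl S where
  d := d
  φ := fun l => (B l).indicator fun _ => 1
  measurable_φ := fun l => measurable_const.indicator (hB l)
  bounded_φ := fun l => ⟨1, fun x => by by_cases h : x ∈ B l <;> simp [h]⟩
  f := fun x => ∏ l, Real.smoothTransition (n * (x l - c l))
  smooth_f := contDiff_prod fun l _ => Real.smoothTransition.contDiff.comp (by fun_prop)

theorem eval_lowerCyl {d : ℕ} {B : Fin d → Set S} (hB : ∀ l, MeasurableSet (B l)) (c : Fin d → ℝ)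
    (n : ℕ) (μ : ProbabilityMeasure S) : (lowerCyl hB c n).eval μ =
      ∏ l, Real.smoothTransition (n * ((μ : Measure S).real (B l) - c l)) := by
  change ∏ l, Real.smoothTransition
    (n * (∫ x, (B l).indicator (fun _ => 1) x ∂(μ : Measure S) - c l)) = _
  refine Finset.prod_congr rfl fun l _ => ?_
  rw [integral_indicator_const _ (hB l), smul_eq_mul, mul_one]

theorem tendsto_eval_lowerCyl {d : ℕ} {B : Fin d → Set S} (hB : ∀ l, MeasurableSet (B l))
    (c : Fin d → ℝ) (μ : ProbabilityMeasure S) :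
    Tendsto (fun n => (lowerCyl hB c n).eval μ) atTop
      (𝓝 ({μ : ProbabilityMeasure S | ∀ l, c l < (μ : Measure S).real (B l)}.indicator
        (fun _ => 1) μ)) := by
  simp only [eval_lowerCyl]
  refine tendsto_const_nhds.congr' ?_
  by_cases h : ∀ l, c l < (μ : Measure S).real (B l)
  · rw [Set.indicator_of_mem (by exact h)]
    have h1 : ∀ l, ∀ᶠ n : ℕ in atTop, 1 ≤ (n : ℝ) * ((μ : Measure S).real (B l) - c l) := fun l =>
      (tendsto_natCast_atTop_atTop.atTop_mul_const (sub_pos.2 (h l))).eventually_ge_atTop 1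
    filter_upwards [eventually_all.2 h1] with n hn
    exact (Finset.prod_eq_one fun l _ => Real.smoothTransition.one_of_one_le (hn l)).symm
  · rw [Set.indicator_of_notMem (by exact h)]
    push Not at h
    obtain ⟨l, hl⟩ := h
    refine Eventually.of_forall fun n => (Finset.prod_eq_zero (Finset.mem_univ l) ?_).symm
    exact Real.smoothTransition.zero_of_nonpos
      (mul_nonpos_of_nonneg_of_nonpos n.cast_nonneg (sub_nonpos.2 hl))

theorem abs_eval_lowerCyl_le {d : ℕ} {B : Fin d → Set S} (hB : ∀ l, MeasurableSet (B l))
    (c : Fin d → ℝ) (n : ℕ) (μ : ProbabilityMeasure S) : |(lowerCyl hB c n).eval μ| ≤ 1 := by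
  rw [eval_lowerCyl, Finset.abs_prod]
  refine Finset.prod_le_one (fun _ _ => abs_nonneg _) fun l _ => ?_
  rw [abs_of_nonneg (Real.smoothTransition.nonneg _)]
  exact Real.smoothTransition.le_one _

theorem Cyl.inner_toL2 (P : Measure (ProbabilityMeasure S)) [IsFiniteMeasure P] (F : Cyl S)
    (w : Lp ℝ 2 P) : inner ℝ (F.toL2 P) w = ∫ μ, F.eval μ * w μ ∂P := by
  rw [L2.inner_def]
  refine integral_congr_ae ?_
  filter_upwards [(F.memLp_eval P).coeFn_toLp] with μ h
  simp only [toL2, h]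
  simp [mul_comm]

/-- Smoothed indicators are cylinder functions, so `w` integrates to zero over the π-system
`lowerSets`. The π-λ theorem extends this to all measurable sets. -/
theorem eq_zero_of_forall_inner_toL2 {P : Measure (ProbabilityMeasure S)} [IsFiniteMeasure P]
    {w : Lp ℝ 2 P} (h : ∀ F : Cyl S, inner ℝ (F.toL2 P) w = 0) : w = 0 := by
  have hw : Integrable w P := (Lp.memLp w).integrable (by norm_num)
  have hlow : ∀ A ∈ lowerSets S, ∫ μ in A, w μ ∂P = 0 := by
    rintro A ⟨d, B, c, hB, hA⟩
    have hAm : MeasurableSet A := measurableSet_of_mem_lowerSets ⟨d, B, c, hB, hA⟩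
    have h1 : Tendsto (fun n => ∫ μ, (lowerCyl hB c n).eval μ * w μ ∂P) atTop
        (𝓝 (∫ μ, A.indicator (fun _ => 1) μ * w μ ∂P)) := by
      refine tendsto_integral_of_dominated_convergence (fun μ => ‖w μ‖) (fun n => ?_) hw.norm
        (fun n => Eventually.of_forall fun μ => ?_) (Eventually.of_forall fun μ => ?_)
      · exact (lowerCyl hB c n).measurable_eval.aestronglyMeasurable.mul hw.aestronglyMeasurable
      · rw [norm_mul]
        exact mul_le_of_le_one_left (norm_nonneg _) (abs_eval_lowerCyl_le hB c n μ)
      · rw [hA]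
        exact (tendsto_eval_lowerCyl hB c μ).mul_const _
    simp_rw [← Cyl.inner_toL2, h] at h1
    rw [← integral_indicator hAm]
    refine Eq.trans (integral_congr_ae (Eventually.of_forall fun μ => ?_))
      (tendsto_nhds_unique h1 tendsto_const_nhds)
    by_cases hμ : μ ∈ A <;> simp [hμ]
  have huniv : ∫ μ, w μ ∂P = 0 := by
    -- The whole space is the member of the π-system with no constraints.
    have h1 := hlow Set.univ ⟨0, Fin.elim0, Fin.elim0, fun l => l.elim0, by
      ext μ
      simp⟩
    simpa using h1
  have hall : ∀ A, MeasurableSet A → ∫ μ in A, w μ ∂P = 0 := by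
    intro A hA
    induction A, hA using MeasurableSpace.induction_on_inter generateFrom_lowerSets
      isPiSystem_lowerSets with
    | empty => simp
    | basic A hA => exact hlow A hA
    | compl A hA ih =>
      have := integral_add_compl hA hw
      rw [ih, huniv, zero_add] at this
      exact this
    | iUnion A hd hA ih =>
      rw [integral_iUnion hA hd hw.integrableOn]
      simp [ih]
  have h0 := hw.ae_eq_zero_of_forall_setIntegral_eq_zero fun A hA _ => hall A hA
  exact (Lp.eq_zero_iff_ae_eq_zero).2 h0

theorem dense_of_toL2_mem {P : Measure (ProbabilityMeasure S)} [IsFiniteMeasure P]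
    {K : Submodule ℝ (Lp ℝ 2 P)} (h : ∀ F : Cyl S, F.toL2 P ∈ K) : Dense (K : Set (Lp ℝ 2 P)) := by
  rw [Submodule.dense_iff_topologicalClosure_eq_top, Submodule.topologicalClosure_eq_top_iff,
    Submodule.eq_bot_iff]
  exact fun w hw => eq_zero_of_forall_inner_toL2 fun F => hw _ (h F)

/-! ### Closability -/

theorem lintegral_enorm_le_eLpNorm_two {α : Type*} [MeasurableSpace α] {m : Measure α}
    [IsProbabilityMeasure m] {f : α → ℝ} (hf : AEStronglyMeasurable f m) :
    ∫⁻ x, ‖f x‖ₑ ∂m ≤ eLpNorm f 2 m := by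
  rw [← eLpNorm_one_eq_lintegral_enorm]
  exact eLpNorm_le_eLpNorm_of_exponent_le (by norm_num) hf

/-- On probability spaces `L²` convergence implies `L¹` convergence, which is all that closability
of the gradient needs. -/
theorem snd_eq_zero_of_mem_closure_graph {θ : ℝ} (hθ : -(1 / 2) < θ) (ν₀ : Measure S)
    [IsProbabilityMeasure ν₀] {P : Measure (ProbabilityMeasure S)} [IsFiniteMeasure P]
    (hP : P = dirichletProcess (1 / 2) θ ν₀) {x : Lp ℝ 2 P × Lp ℝ 2 (pairLaw P)}
    (hx : x ∈ (Cyl.graph P (Cyl.isLinearClass_univ (S := S))).topologicalClosure)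
    (h0 : x.1 = 0) : x.2 = 0 := by
  have := isProbabilityMeasure_inputLaw hθ ν₀
  have : IsProbabilityMeasure P := by
    rw [hP, dirichletProcess_eq_map_stickMeasure hθ]
    exact Measure.isProbabilityMeasure_map measurable_stickMeasure.aemeasurable
  obtain ⟨m, hm, hlim⟩ := mem_closure_iff_seq_limit.1
    (show x ∈ closure (Cyl.graph P Cyl.isLinearClass_univ : Set _) from hx)
  choose F _ hF using hm
  obtain rfl : m = fun n => ((F n).toL2 P, (F n).dirL2 P) := funext hF
  have h1 : Tendsto (fun n => (F n).toL2 P) atTop (𝓝 0) := by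
    have := (continuous_fst.tendsto _).comp hlim
    rwa [h0] at this
  have h2 : Tendsto (fun n => (F n).dirL2 P) atTop (𝓝 x.2) := (continuous_snd.tendsto _).comp hlim
  rw [Lp.tendsto_Lp_iff_tendsto_eLpNorm'] at h1 h2
  have hw := (Lp.stronglyMeasurable x.2).measurable
  have hwfin : ∫⁻ p, ‖x.2 p‖ₑ ∂pairLaw P ≠ ⊤ :=
    ((lintegral_enorm_le_eLpNorm_two hw.aestronglyMeasurable).trans_lt
      (Lp.memLp x.2).eLpNorm_lt_top).ne
  have h3 : Tendsto (fun n => ∫⁻ μ, ‖(F n).eval μ‖ₑ ∂P) atTop (𝓝 0) := by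
    refine tendsto_of_tendsto_of_tendsto_of_le_of_le tendsto_const_nhds h1 (fun _ => bot_le)
      fun n => ?_
    refine (lintegral_enorm_le_eLpNorm_two (F n).measurable_eval.aestronglyMeasurable).trans
      (le_of_eq (eLpNorm_congr_ae ?_))
    filter_upwards [((F n).memLp_eval P).coeFn_toLp, Lp.coeFn_zero ℝ 2 P] with μ h3 h4
    simp only [Pi.sub_apply, Cyl.toL2, h3, h4]
    simp
  have h4 : Tendsto (fun n => ∫⁻ p, ‖(F n).dir p - x.2 p‖ₑ ∂pairLaw P) atTop (𝓝 0) := by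
    refine tendsto_of_tendsto_of_tendsto_of_le_of_le tendsto_const_nhds h2 (fun _ => bot_le)
      fun n => ?_
    refine (lintegral_enorm_le_eLpNorm_two
      ((F n).measurable_dir.sub hw).aestronglyMeasurable).trans (le_of_eq (eLpNorm_congr_ae ?_))
    filter_upwards [((F n).memLp_dir P).coeFn_toLp] with p h3
    simp only [Pi.sub_apply, Cyl.dirL2, h3]
  subst hP
  exact (Lp.eq_zero_iff_ae_eq_zero).2 (ae_eq_zero_of_tendsto_dir hθ ν₀ F hw hwfin h3 h4)

end

end TwoParam

/-! ### Existence of the forms and convergence of their semigroups. -/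

theorem theorem3p4 {S : Type*} [MetricSpace S] [LocallyCompactSpace S]
    [TopologicalSpace.SeparableSpace S] [MeasurableSpace S] [BorelSpace S]
    (θ : ℝ) (hθ : -(1 / 2) < θ)
    (ν₀ : Measure S) [IsProbabilityMeasure ν₀] (hν₀ : ∀ x, ν₀ {x} = 0)
    (D : DyadicPartition ν₀) (hD : D.Generating)
    (P : Measure (ProbabilityMeasure S)) [IsFiniteMeasure P]
    (hP : P = dirichletProcess (1 / 2) θ ν₀) :
    (∀ k, ∃ (E : ClosedForm (Lp ℝ 2 P)) (T : ℝ≥0 → Lp ℝ 2 P →L[ℝ] Lp ℝ 2 P),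
      E.IsClosureOf (Cyl.toL2 P) (energy P) (D.cylSet k) ∧ E.IsSemigroup T) ∧
    (∃ (Ξ : ClosedForm (Lp ℝ 2 P)) (T : ℝ≥0 → Lp ℝ 2 P →L[ℝ] Lp ℝ 2 P),
      Ξ.IsRelaxationOf (Cyl.toL2 P) (energy P) ∧ Dense (Ξ.dom : Set (Lp ℝ 2 P)) ∧
        Ξ.IsSemigroup T) ∧
    ∀ (E : ℕ → ClosedForm (Lp ℝ 2 P)) (Tk : ℕ → ℝ≥0 → Lp ℝ 2 P →L[ℝ] Lp ℝ 2 P)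
      (Ξ : ClosedForm (Lp ℝ 2 P)) (T : ℝ≥0 → Lp ℝ 2 P →L[ℝ] Lp ℝ 2 P),
      (∀ k, (E k).IsClosureOf (Cyl.toL2 P) (energy P) (D.cylSet k) ∧ (E k).IsSemigroup (Tk k)) →
      Ξ.IsRelaxationOf (Cyl.toL2 P) (energy P) → Ξ.IsSemigroup T →
      ∀ (t : ℝ≥0) (F : Lp ℝ 2 P), Tendsto (fun k => Tk k t F) atTop (𝓝 (T t F)) := by
  have h0 : ∀ x ∈ (Cyl.graph P (Cyl.isLinearClass_univ (S := S))).topologicalClosure,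
      x.1 = 0 → x.2 = 0 := fun x hx => snd_eq_zero_of_mem_closure_graph hθ ν₀ hP hx
  have hle : ∀ k, Cyl.graph P (D.isLinearClass_cylSet k) ≤
      Cyl.graph P (Cyl.isLinearClass_univ (S := S)) := by
    rintro k _ ⟨F, -, rfl⟩
    exact ⟨F, Set.mem_univ _, rfl⟩
  -- Closability on all cylinder functions is inherited by each projection class.
  have h0k : ∀ k, ∀ x ∈ (Cyl.graph P (D.isLinearClass_cylSet k)).topologicalClosure,
      x.1 = 0 → x.2 = 0 := fun k x hx => h0 x (Submodule.topologicalClosure_mono (hle k) hx)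
  have hE : ∀ k, (ClosedForm.ofGraph _
      (Cyl.graph P (D.isLinearClass_cylSet k)).isClosed_topologicalClosure
      (h0k k)).IsClosureOf (Cyl.toL2 P) (energy P) (D.cylSet k) := fun k =>
    ClosedForm.isClosureOf_ofGraph (Cyl.energy_eq P) (fun _ => Cyl.mem_graph) (h0k k)
  have hΞ : (ClosedForm.ofGraph _
      (Cyl.graph P (Cyl.isLinearClass_univ (S := S))).isClosed_topologicalClosure
      h0).IsRelaxationOf (Cyl.toL2 P) (energy P) :=
    ClosedForm.isRelaxationOf_ofGraph (Cyl.energy_eq P)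
      (fun _ => Cyl.mem_graph.trans (by simp)) h0
  have hdense : ∀ Ξ : ClosedForm (Lp ℝ 2 P), Ξ.IsRelaxationOf (Cyl.toL2 P) (energy P) →
      Dense (Ξ.dom : Set (Lp ℝ 2 P)) := fun Ξ h => dense_of_toL2_mem fun F => (h.1 F).1
  refine ⟨fun k => ⟨_, _, hE k, ClosedForm.isSemigroup_semigroup _⟩,
    ⟨_, _, hΞ, hdense _ hΞ, ClosedForm.isSemigroup_semigroup _⟩, ?_⟩
  intro E Tk Ξ T hETk hΞ' hT t F
  -- Uniqueness identifies the given forms and semigroups with the constructed ones.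
  obtain rfl := hΞ'.unique hΞ
  obtain rfl : E = _ := funext fun k => (hETk k).1.unique (hE k)
  obtain rfl := hT.unique (ClosedForm.isSemigroup_semigroup _)
  obtain rfl : Tk = _ := funext fun k => (hETk k).2.unique (ClosedForm.isSemigroup_semigroup _)
  refine ClosedForm.tendsto_semigroup (hdense _ hΞ)
    (fun f => ClosedForm.tendsto_resolvent_ofGraph hle ?_ h0 h0k f) t F
  rintro _ ⟨G, -, rfl⟩
  subst hP
  obtain ⟨G', hG', hlim⟩ := exists_tendsto_cylSet hθ hD G
  exact ⟨_, fun k => ⟨G' k, hG' k, rfl⟩, hlim⟩
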